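/- Let $d\sigma$ be the surface measure on the unit sphere $\mathbb S^2\subset\mathbb R^3$, $\Delta_\sigma$ its Laplace–Beltrami operator, and $\|h\|_{\dot H^2(\mathbb S^2)}=\|\Delta_\sigma h\|_{L^2(\mathbb S^2)}$ the homogeneous Sobolev seminorm. For a non-negative $g\in L^1(\mathbb S^2)$ let $(g_t)_{t>0}$ be the solution of the heat equation $\partial_t g_t=\Delta_\sigma g_t$ on $\mathbb S^2$ with initial datum $g$ and, for a weight $\omega$, set $$\mathbf K^\omega(g)=\int_0^{+\infty}\|\sqrt{g_t}\|^2_{\dot H^2(\mathbb S^2)}\,\omega(t)\,dt\in[0,+\infty].$$ For $N\ge 2$ and a probability measure on $\mathbb R^{3N}$ with density $F$ with respect to the Lebesgue measure, set $$\mathbb K^\omega_\beta(F)=\int_{\mathbb R^3\times\mathbb R_+\times\mathbb R^{3(N-2)}}\beta(r)\,\mathbf K^\omega\big(\sigma\mapsto F(z+r\sigma,\,z-r\sigma,\,v_3,\dots,v_N)\big)\,8r^2\,dz\,dr\,dv_3\cdots dv_N\in[0,+\infty],$$ and $\mathbb K^\omega_\beta(F)=+\infty$ for a probability measure $F$ without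 density. The Fisher information of a probability measure with density $F$ on $\mathbb R^{3j}$ is $I(F)=\frac1j\int_{\mathbb R^{3j}}|\nabla\log F|^2F=\frac1j\int_{\mathbb R^{3j}}\frac{|\nabla F|^2}{F}$ (weak gradient), and $+\infty$ if there is no density or the density is not weakly differentiable. Let $\omega:\mathbb R_+\to\mathbb R_+$ be measurable and let $\beta:\mathbb R\to\mathbb R$ be non-negative and lower semicontinuous. Then: 1. (Approximate lower semicontinuity.) Let $N\ge2$. If probability measures $F^n$ ($n\in\mathbb N$) and $F$ on $\mathbb R^{3N}$ have densities and $F^n\rightharpoonup F$ weakly, then $\mathbb K^\omega_\beta(F)\le 48\liminf_{n\to\infty}\mathbb K^\omega_\beta(F^n)$. 2. (Approximate superadditivity.) For $2\le j\le N$ and every probability density $F$ on $\mathbb R^{3N}$, the marginal $F^{:j}=\int_{\mathbb R^{3(N-j)}}F\,dv_{j+1}\cdots dv_N$ satisfies $\mathbb K^\omega_\beta(F^{:j})\le 48\,\mathbb K^\omega_\beta(F)$. 3. (Approximate affinity in infinite dimension.) Let $\nu\in\mathcal P(\mathcal P(\mathbb R^3))$ and $\nu^j=\int_{\mathcal P(\mathbb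 R^3)}\rho^{\otimes j}\,\nu(d\rho)\in\mathcal P(\mathbb R^{3j})$ for $j\ge1$. If $\sup_{j\ge1}I(\nu^j)<+\infty$ and $\int_{\mathbb R^3}|v|^2\,\nu^1(dv)<+\infty$, then $$\int_{\mathcal P(\mathbb R^3)}\mathbb K^\omega_\beta(\rho\otimes\rho)\,\nu(d\rho)\le 768\,\liminf_{j\to\infty}\mathbb K^\omega_\beta(\nu^j).$$ -/

import Mathlib

open MeasureTheory Filter Topology
open scoped ENNReal

noncomputable section

namespace KacBoltzmann

/-- The velocity space `ℝ³`. -/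
abbrev E3 : Type := EuclideanSpace ℝ (Fin 3)

/-- The space `ℝ^{3N}` of the velocities `(v_1, …, v_N)`; `v_i` is `v (i - 1)`. -/
abbrev Config (N : ℕ) : Type := Fin N → E3

/-- The unit sphere `𝕊²` of `ℝ³`. -/
abbrev S2 : Type := Metric.sphere (0 : E3) 1

/-- The surface measure `dσ` on `𝕊²`, normalized by `dx = r² dr dσ` (total mass `4π`). -/
def surface : Measure S2 := (volume : Measure E3).toSphere

/-! ### Calculus on the sphere -/

/-- The extension of `h : 𝕊² → ℝ` to `ℝ³ ∖ {0}` that is constant along rays, `x ↦ h (x / |x|)`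
(and `0` at the origin). -/
def radial (h : S2 → ℝ) (x : E3) : ℝ :=
  if hx : x = 0 then 0 else h ⟨‖x‖⁻¹ • x, by simp [norm_smul, hx]⟩

/-- Smooth functions on the sphere. -/
def SphSmooth (h : S2 → ℝ) : Prop :=
  ContDiffOn ℝ (⊤ : ℕ∞) (radial h) {0}ᶜ

/-- The Laplace–Beltrami operator `Δ_σ` of `𝕊²`: the Euclidean Laplacian of the extension that is
constant along rays, evaluated on the sphere. -/
def sphLaplacian (h : S2 → ℝ) (σ : S2) : ℝ :=
  Laplacian.laplacian (radial h) (σ : E3)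

/-- `w` is the weak Laplacian of `h` on the sphere, both functions being square-integrable. -/
def IsWeakSphLaplacian (h w : S2 → ℝ) : Prop :=
  MemLp h 2 surface ∧ MemLp w 2 surface ∧
    ∀ φ : S2 → ℝ, SphSmooth φ →
      ∫ σ, h σ * sphLaplacian φ σ ∂surface = ∫ σ, w σ * φ σ ∂surface

/-- The squared homogeneous Sobolev seminorm `‖h‖²` of `Ḣ²(𝕊²)`, that is `‖Δ_σ h‖²` in `L²(𝕊²)`,
with value `+∞` if `h` is not in `H²(𝕊²)`. The infimum runs over the weak Laplacians of `h`, which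
agree almost everywhere. -/
def sobolevH2Sq (h : S2 → ℝ) : ℝ≥0∞ :=
  ⨅ (w : S2 → ℝ) (_ : IsWeakSphLaplacian h w), ∫⁻ σ, ENNReal.ofReal (w σ ^ 2) ∂surface

/-- `u = (g_t)_{t > 0}` is the solution of the heat equation `∂_t g_t = Δ_σ g_t` on `𝕊²` with
integrable initial datum `g`: it is smooth in `(t, σ)` for `t > 0`, and `g_t → g` in `L¹(𝕊²)` as
`t → 0`. -/
structure IsSphHeatFlow (g : S2 → ℝ) (u : ℝ → S2 → ℝ) : Prop where
  integrable : Integrable g surface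
  smooth : ContDiffOn ℝ (⊤ : ℕ∞) (fun p : ℝ × E3 => radial (u p.1) p.2) (Set.Ioi 0 ×ˢ {0}ᶜ)
  heat : ∀ t : ℝ, 0 < t → ∀ σ : S2, HasDerivAt (fun s => u s σ) (sphLaplacian (u t) σ) t
  initial : Tendsto (fun t => ∫⁻ σ, ‖u t σ - g σ‖ₑ ∂surface) (𝓝[>] 0) (𝓝 0)

/-- The functional `𝐊^ω(g) = ∫₀^∞ ‖√g_t‖² ω(t) dt` (with the seminorm of `Ḣ²(𝕊²)`) of a
non-negative integrable `g` on the sphere, `g_t` being the heat flow started from `g`. The infimum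
runs over the solutions of the heat equation started from `g`, which agree for all `t > 0`. -/
def sphK (ω : ℝ → ℝ) (g : S2 → ℝ) : ℝ≥0∞ :=
  ⨅ (u : ℝ → S2 → ℝ) (_ : IsSphHeatFlow g u),
    ∫⁻ t in Set.Ioi (0 : ℝ),
      sobolevH2Sq (fun σ => Real.sqrt (u t σ)) * ENNReal.ofReal (ω t)

/-! ### The functional on `ℝ^{3N}` -/

/-- The configuration `(v_1, …, v_N)` with `v_1 = z + r σ`, `v_2 = z - r σ` and
`(v_3, …, v_N) = w`. -/
def zrsConfig (N : ℕ) (z : E3) (r : ℝ) (σ : S2) (w : Config (N - 2)) : Config N :=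
  fun i =>
    if (i : ℕ) = 0 then z + r • (σ : E3)
    else if (i : ℕ) = 1 then z - r • (σ : E3)
    else if h : (i : ℕ) - 2 < N - 2 then w ⟨(i : ℕ) - 2, h⟩ else 0

/-- `𝕂_β^ω(F) = ∫ β(r) 𝐊^ω(F(z, r, ·, v_3, …, v_N)) 8r² dz dr dv_3 … dv_N` for a density `F` on
`ℝ^{3N}`, `N ≥ 2`. -/
def densK (ω β : ℝ → ℝ) (N : ℕ) (F : Config N → ℝ) : ℝ≥0∞ :=
  ∫⁻ z : E3, ∫⁻ r in Set.Ioi (0 : ℝ), ∫⁻ w : Config (N - 2),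
    ENNReal.ofReal (β r) * sphK ω (fun σ => F (zrsConfig N z r σ w)) * ENNReal.ofReal (8 * r ^ 2)

/-- The density of `μ` with respect to the Lebesgue measure. -/
def density {N : ℕ} (μ : Measure (Config N)) (v : Config N) : ℝ :=
  (μ.rnDeriv volume v).toReal

open Classical in
/-- `𝕂_β^ω(μ)` for a measure `μ` on `ℝ^{3N}`: the functional of its density, and `+∞` if `μ` has
no density. -/
def KK (ω β : ℝ → ℝ) {N : ℕ} (μ : Measure (Config N)) : ℝ≥0∞ :=
  if μ ≪ volume then densK ω β N (density μ) else ⊤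

/-! ### Marginals, hierarchies, Fisher information -/

/-- The marginal `F^{:j}` of the first `j` velocities. -/
def marginal {j N : ℕ} (h : j ≤ N) (μ : Measure (Config N)) : Measure (Config j) :=
  μ.map fun v i => v (Fin.castLE h i)

/-- The `j`-th marginal `ν^j = ∫ ρ^{⊗ j} ν(dρ)` of `ν ∈ 𝒫(𝒫(ℝ³))`. -/
def hierarchy (ν : ProbabilityMeasure (ProbabilityMeasure E3)) (j : ℕ) : Measure (Config j) :=
  (ν : Measure (ProbabilityMeasure E3)).bind fun ρ => Measure.pi fun _ : Fin j => (ρ : Measure E3)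

/-- `G = (G i k)` is the weak gradient of `F` on `ℝ^{3N}`, `G i k` being the derivative in the
`k`-th coordinate of the `i`-th velocity. -/
def IsWeakGradient {N : ℕ} (F : Config N → ℝ) (G : Fin N → Fin 3 → Config N → ℝ) : Prop :=
  LocallyIntegrable F ∧ ∀ i k, LocallyIntegrable (G i k) ∧
    ∀ φ : Config N → ℝ, ContDiff ℝ (⊤ : ℕ∞) φ → HasCompactSupport φ →
      ∫ v, F v * fderiv ℝ φ v (Pi.single i (EuclideanSpace.single k 1)) = -∫ v, G i k v * φ v

open Classical in
/-- The Fisher information `I(μ) = (1/N) ∫ |∇ log F|² F = (1/N) ∫ |∇F|² / F` of a measure `μ` on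
`ℝ^{3N}` with density `F`, and `+∞` if `μ` has no density or its density is not weakly
differentiable. In the quotient `0 / 0 = 0` and `a / 0 = +∞` for `a > 0`. The infimum runs over
the weak gradients of `F`, which agree almost everywhere. -/
def fisherInfo {N : ℕ} (μ : Measure (Config N)) : ℝ≥0∞ :=
  if μ ≪ volume then
    (N : ℝ≥0∞)⁻¹ * ⨅ (G : Fin N → Fin 3 → Config N → ℝ) (_ : IsWeakGradient (density μ) G),
      ∫⁻ v, ENNReal.ofReal (∑ i, ∑ k, G i k v ^ 2) / ENNReal.ofReal (density μ v)
  else ⊤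

end KacBoltzmann

end

/-! All three statements would follow from writing the functional as a supremum of linear pairings
with continuous functions. Up to the factor 17 this is possible, and the factor is lost only once in
each statement.

On the sphere, put g = h². Then ∇g = 2h∇h and Δg = 2hΔh + 2|∇h|². Completing squares produces
expressions linear in (g, ∇g, Δg), indexed by a slope c and a vector b, whose pointwise supremum
lies between (Δh)² and (Δh + |∇h|²/h)² + (Δh)² (`exists_affForm_eq`, `affForm_le`). The excess is
controlled after integration by ∫|∇h|⁴/h² ≤ 9∫(Δh)² (`integral_gradSq_div_sq_le`), obtained by
integrating a divergence and using that the rotation fields commute with the Laplacian. Since the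
heat flow is linear in its datum, these forms at time t are integrals of the datum against explicit
kernels. Hence `sphK` ≤ `formK` ≤ 17 `sphK`, where `formK` is an integral over time and space of a
supremum of linear forms.

This needs an actual heat flow, with positivity and uniqueness. The flow is convolution with the
zonal kernel given by the Legendre series in ξ = (1 + x·y)/2. Its Taylor coefficients in ξ are
non-negative because (n+1)ξⁿ is an approximate point mass at ξ = 1, and the flow sends monomials to
polynomials whose coefficients solve the forward equations of a death process. Uniqueness follows by
letting ∫√(1+d²) decrease, d being the difference of two solutions.

In the variables (z, r, σ, w) the Lebesgue measure is the product of `paramMeasure` and the surface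
measure. A bounded continuous function is a test function if, on each sphere, its pairing with any
non-negative g is at most β(r) times `formK` of g. Finite maxima of the linear forms are
approximated by continuous convex combinations, so KK(μ) ≤ sup ∫Ψ dμ ≤ 17 KK(μ) for μ with a density
(`KK_le_iSup`, `ofReal_integral_le_KK`). The first two statements are now immediate: a supremum of
weakly continuous maps is lower semicontinuous, and a test function of the first j velocities
remains admissible on more velocities.

For the third, the test function attaining the supremum for ρ⊗ρ depends on ρ. It is selected from
v₃, …, vₙ by comparing empirical means over disjoint pairs. Admissibility is checked with those
velocities frozen, so the selected function is admissible on all n velocities, and the law of large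
numbers makes the selection nearly optimal under ρ^{⊗n} (`lintegral_iSup_le_liminf`). The same
selection, applied to differences between indicators and their averages over small translations,
turns the Fisher bound into absolute continuity of ν-almost every ρ (`ae_absolutelyContinuous`),
which the duality requires. -/

noncomputable section

namespace KacBoltzmann

/-! ### Rotation fields -/

/-- The generator `x ↦ e_i × x` of the rotations around the `i`-th axis. -/
def rotGen (i : Fin 3) : E3 →L[ℝ] E3 :=
  (EuclideanSpace.proj (i + 1) : E3 →L[ℝ] ℝ).smulRight
      (EuclideanSpace.single (i + 2) (1 : ℝ)) -
    (EuclideanSpace.proj (i + 2) : E3 →L[ℝ] ℝ).smulRight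
      (EuclideanSpace.single (i + 1) (1 : ℝ))

theorem rotGen_apply (i : Fin 3) (x : E3) :
    rotGen i x = x (i + 1) • EuclideanSpace.single (i + 2) (1 : ℝ) -
      x (i + 2) • EuclideanSpace.single (i + 1) (1 : ℝ) := by
  simp [rotGen]

/-- The derivative of `f` along the rotation field `x ↦ e_i × x`. -/
def rot (i : Fin 3) (f : E3 → ℝ) (x : E3) : ℝ := fderiv ℝ f x (rotGen i x)

theorem rot_zero_apply (i : Fin 3) (f : E3 → ℝ) : rot i f 0 = 0 := by simp [rot]

/-- Smoothness away from the origin. -/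
abbrev SmoothAway (f : E3 → ℝ) : Prop := ContDiffOn ℝ (⊤ : ℕ∞) f {0}ᶜ

theorem isOpen_compl_zero : IsOpen ({0}ᶜ : Set E3) := isOpen_compl_singleton

theorem SmoothAway.contDiffAt {f : E3 → ℝ} (hf : SmoothAway f) {x : E3} (hx : x ≠ 0) :
    ContDiffAt ℝ (⊤ : ℕ∞) f x :=
  ContDiffOn.contDiffAt hf (isOpen_compl_zero.mem_nhds hx)

theorem SmoothAway.differentiableAt {f : E3 → ℝ} (hf : SmoothAway f) {x : E3} (hx : x ≠ 0) :
    DifferentiableAt ℝ f x :=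
  (hf.contDiffAt hx).differentiableAt (by simp)

theorem SmoothAway.fderiv {f : E3 → ℝ} (hf : SmoothAway f) :
    ContDiffOn ℝ (⊤ : ℕ∞) (fderiv ℝ f) {0}ᶜ :=
  ContDiffOn.fderiv_of_isOpen hf isOpen_compl_zero (by simp)

theorem SmoothAway.rot {f : E3 → ℝ} (hf : SmoothAway f) (i : Fin 3) : SmoothAway (rot i f) :=
  hf.fderiv.clm_apply (rotGen i).contDiff.contDiffOn

theorem rot_add {f g : E3 → ℝ} (hf : SmoothAway f) (hg : SmoothAway g) (i : Fin 3) (x : E3) :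
    rot i (fun x => f x + g x) x = rot i f x + rot i g x := by
  by_cases hx : x = 0
  · subst hx; simp [rot_zero_apply]
  · simp only [rot]
    rw [fderiv_fun_add (hf.differentiableAt hx) (hg.differentiableAt hx)]; rfl

theorem rot_mul {f g : E3 → ℝ} (hf : SmoothAway f) (hg : SmoothAway g) (i : Fin 3) (x : E3) :
    rot i (fun x => f x * g x) x = f x * rot i g x + rot i f x * g x := by
  by_cases hx : x = 0
  · subst hx; simp [rot_zero_apply]
  · simp only [rot]
    rw [fderiv_fun_mul (hf.differentiableAt hx) (hg.differentiableAt hx)]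
    simp [mul_comm]

theorem rot_comp {f : E3 → ℝ} (hf : SmoothAway f) {φ : ℝ → ℝ} {φ' : ℝ} (i : Fin 3) {x : E3}
    (hx : x ≠ 0) (hφ : HasDerivAt φ φ' (f x)) :
    rot i (fun x => φ (f x)) x = φ' * rot i f x := by
  have := hφ.comp_hasFDerivAt x (hf.differentiableAt hx).hasFDerivAt
  simp only [rot]
  rw [show (fun x => φ (f x)) = φ ∘ f from rfl, this.fderiv]; simp

theorem rot_rot {f : E3 → ℝ} (hf : SmoothAway f) (i j : Fin 3) {x : E3} (hx : x ≠ 0) :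
    rot i (rot j f) x = fderiv ℝ (fderiv ℝ f) x (rotGen i x) (rotGen j x) +
      fderiv ℝ f x (rotGen j (rotGen i x)) := by
  have h1 : DifferentiableAt ℝ (fderiv ℝ f) x :=
    (hf.fderiv.contDiffAt (isOpen_compl_zero.mem_nhds hx)).differentiableAt (by simp)
  have h2 := h1.hasFDerivAt.clm_apply (rotGen j).hasFDerivAt (x := x)
  have h3 : rot j f = fun y => (fderiv ℝ f y) (rotGen j y) := rfl
  conv_lhs => rw [rot, h3, h2.fderiv]
  simp [add_comm]

theorem snd_fderiv_symm {f : E3 → ℝ} (hf : SmoothAway f) {x : E3} (hx : x ≠ 0) (u v : E3) :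
    fderiv ℝ (fderiv ℝ f) x u v = fderiv ℝ (fderiv ℝ f) x v u :=
  ((hf.contDiffAt hx).isSymmSndFDerivAt (by simp; exact WithTop.coe_le_coe.2 (le_top : (2 : ℕ∞) ≤ ⊤))) u v

/-- The second-order parts cancel by symmetry of the second derivative. What remains is the
derivative along the commutator of two cross-product generators, which is the third generator up to
sign. -/
theorem rot_comm {f : E3 → ℝ} (hf : SmoothAway f) (i : Fin 3) :
    rot i (rot (i + 1) f) = fun x => rot (i + 1) (rot i f) x - rot (i + 2) f x := by
  funext x
  by_cases hx : x = 0
  · subst hx; simp [rot_zero_apply]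
  · rw [rot_rot hf _ _ hx, rot_rot hf _ _ hx, snd_fderiv_symm hf hx, rot, add_sub_assoc,
      ← map_sub]
    congr 2
    fin_cases i <;> ext k <;> fin_cases k <;> simp [rotGen_apply] 

/-- The sum of squares of the rotation fields, which is the Laplace–Beltrami operator on `𝕊²`. -/
def rotLap (f : E3 → ℝ) (x : E3) : ℝ := ∑ i, rot i (rot i f) x

theorem SmoothAway.sub {f g : E3 → ℝ} (hf : SmoothAway f) (hg : SmoothAway g) :
    SmoothAway (fun x => f x - g x) := ContDiffOn.sub hf hg

theorem SmoothAway.mul {f g : E3 → ℝ} (hf : SmoothAway f) (hg : SmoothAway g) :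
    SmoothAway (fun x => f x * g x) := ContDiffOn.mul hf hg

theorem SmoothAway.add {f g : E3 → ℝ} (hf : SmoothAway f) (hg : SmoothAway g) :
    SmoothAway (fun x => f x + g x) := ContDiffOn.add hf hg

theorem rot_sub {f g : E3 → ℝ} (hf : SmoothAway f) (hg : SmoothAway g) (i : Fin 3) (x : E3) :
    rot i (fun x => f x - g x) x = rot i f x - rot i g x := by
  by_cases hx : x = 0
  · subst hx; simp [rot_zero_apply]
  · simp only [rot]
    rw [fderiv_fun_sub (hf.differentiableAt hx) (hg.differentiableAt hx)]; rfl

/-- The sum of squares is the Casimir element of the rotation algebra, hence central. This replaces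
the curvature term of a Bochner formula in the integral identities below. -/
theorem rotLap_rot {f : E3 → ℝ} (hf : SmoothAway f) (j : Fin 3) :
    rotLap (rot j f) = rot j (rotLap f) := by
  funext x
  have c1 : ∀ i : Fin 3, ∀ {f : E3 → ℝ}, SmoothAway f → ∀ y, rot (i + 1) (rot i f) y =
      rot i (rot (i + 1) f) y + rot (i + 2) f y := by
    intro i f hf y
    rw [rot_comm hf]; ring
  have c2 : ∀ i : Fin 3, ∀ {f : E3 → ℝ}, SmoothAway f → rot (i + 1) (rot i f) =
      fun y => rot i (rot (i + 1) f) y + rot (i + 2) f y := fun i f hf => funext (c1 i hf)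
  have hs : rot j (rotLap f) x = rot j (rot 0 (rot 0 f)) x + rot j (rot 1 (rot 1 f)) x +
      rot j (rot 2 (rot 2 f)) x := by
    have : rotLap f = fun x => (rot 0 (rot 0 f) x + rot 1 (rot 1 f) x) + rot 2 (rot 2 f) x := by
      funext x; simp [rotLap, Fin.sum_univ_three]
    rw [this, rot_add (((hf.rot 0).rot 0).add ((hf.rot 1).rot 1)) ((hf.rot 2).rot 2),
      rot_add ((hf.rot 0).rot 0) ((hf.rot 1).rot 1)]
  rw [hs]
  simp only [rotLap, Fin.sum_univ_three]
  have a01 := c1 0 (hf.rot 0) x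
  have d01 : ∀ k, rot k (rot 1 (rot 0 f)) x = rot k (rot 0 (rot 1 f)) x + rot k (rot 2 f) x := by
    intro k
    have := c2 0 hf
    simp only [zero_add] at this
    rw [this, rot_add ((hf.rot 1).rot 0) (hf.rot 2)]
  have d12 : ∀ k, rot k (rot 2 (rot 1 f)) x = rot k (rot 1 (rot 2 f)) x + rot k (rot 0 f) x := by
    intro k
    have := c2 1 hf
    rw [show (1 : Fin 3) + 1 = 2 from rfl, show (1 : Fin 3) + 2 = 0 from rfl] at this
    rw [this, rot_add ((hf.rot 2).rot 1) (hf.rot 0)]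
  have d20 : ∀ k, rot k (rot 0 (rot 2 f)) x = rot k (rot 2 (rot 0 f)) x + rot k (rot 1 f) x := by
    intro k
    have := c2 2 hf
    rw [show (2 : Fin 3) + 1 = 0 from rfl, show (2 : Fin 3) + 2 = 1 from rfl] at this
    rw [this, rot_add ((hf.rot 0).rot 2) (hf.rot 1)]
  have e01 : ∀ k, rot 1 (rot 0 (rot k f)) x = rot 0 (rot 1 (rot k f)) x + rot 2 (rot k f) x :=
    fun k => c1 0 (hf.rot k) x
  have e12 : ∀ k, rot 2 (rot 1 (rot k f)) x = rot 1 (rot 2 (rot k f)) x + rot 0 (rot k f) x :=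
    fun k => c1 1 (hf.rot k) x
  have e20 : ∀ k, rot 0 (rot 2 (rot k f)) x = rot 2 (rot 0 (rot k f)) x + rot 1 (rot k f) x :=
    fun k => c1 2 (hf.rot k) x
  have g01 := c1 0 hf x
  have g12 := c1 1 hf x
  have g20 := c1 2 hf x
  rw [show (1 : Fin 3) + 1 = 2 from rfl, show (1 : Fin 3) + 2 = 0 from rfl] at g12
  rw [show (2 : Fin 3) + 1 = 0 from rfl, show (2 : Fin 3) + 2 = 1 from rfl] at g20
  simp only [zero_add] at g01
  -- For each index i other than j, moving R_j through R_i² leaves two mixed products. They cancel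
  -- against those coming from the third index, so the claim is linear in the commutator identities
  -- collected above.
  fin_cases j
  · simp only [Fin.zero_eta]
    linarith [d01 1, d12 1, d20 2, e01 1, e20 2, d20 2, d01 1, e12 0, e01 0, e20 0, d12 0,
      d01 2, d20 1]
  · simp only [Fin.mk_one]
    linarith [d01 0, d12 2, e01 0, e12 2, d12 2, d01 0]
  · simp only [Fin.reduceFinMk]
    linarith [d20 0, d12 1, e20 0, e12 1]

end KacBoltzmann
end

noncomputable section

namespace KacBoltzmann

/-! ### Functions that are constant along rays -/

/-- The direction `x / |x|` of a vector. -/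
def unitDir (x : E3) : E3 := ‖x‖⁻¹ • x

theorem norm_unitDir {x : E3} (hx : x ≠ 0) : ‖unitDir x‖ = 1 := by
  simp [unitDir, norm_smul, hx]

theorem unitDir_ne_zero {x : E3} (hx : x ≠ 0) : unitDir x ≠ 0 := by
  rw [← norm_ne_zero_iff, norm_unitDir hx]; exact one_ne_zero

theorem unitDir_of_norm {x : E3} (hx : ‖x‖ = 1) : unitDir x = x := by simp [unitDir, hx]

theorem sphere_norm (σ : S2) : ‖(σ : E3)‖ = 1 := by simp

theorem sphere_ne_zero (σ : S2) : (σ : E3) ≠ 0 := by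
  rw [← norm_ne_zero_iff, sphere_norm]; exact one_ne_zero

theorem unitDir_sphere (σ : S2) : unitDir σ = σ := unitDir_of_norm (sphere_norm σ)

theorem unitDir_smul {c : ℝ} (hc : 0 < c) (x : E3) : unitDir (c • x) = unitDir x := by
  simp only [unitDir, norm_smul, Real.norm_of_nonneg hc.le, smul_smul, mul_inv]
  congr 1
  field_simp

theorem contDiffOn_unitDir : ContDiffOn ℝ (⊤ : ℕ∞) unitDir {0}ᶜ := by
  intro x hx
  have hx' : x ≠ 0 := hx
  exact (((contDiffAt_norm ℝ hx').inv (by simpa using hx')).smul contDiffAt_id).contDiffWithinAt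

theorem inner_rotGen (i : Fin 3) (x y : E3) : inner ℝ (rotGen i x) y = -inner ℝ x (rotGen i y) := by
  fin_cases i <;> simp [rotGen_apply, PiLp.inner_apply, Fin.sum_univ_three]

theorem inner_rotGen_self (i : Fin 3) (x : E3) : inner ℝ x (rotGen i x) = 0 := by
  have := inner_rotGen i x x
  rw [real_inner_comm] at this; linarith

theorem smoothAway_norm_inv : SmoothAway (fun x => ‖x‖⁻¹) := by
  intro x hx
  have hx' : x ≠ 0 := hx
  exact ((contDiffAt_norm ℝ hx').inv (by simpa using hx')).contDiffWithinAt

theorem rot_norm_inv (i : Fin 3) {x : E3} (hx : x ≠ 0) : rot i (fun x => ‖x‖⁻¹) x = 0 := by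
  have h1 : SmoothAway (fun x : E3 => ‖x‖ ^ 2) := (contDiff_norm_sq ℝ).contDiffOn
  have h2 : rot i (fun x : E3 => ‖x‖ ^ 2) x = 0 := by
    simp only [rot]
    rw [fderiv_norm_sq_apply]
    simp [inner_rotGen_self]
  have h3 : (fun x : E3 => ‖x‖⁻¹) = fun x => (Real.sqrt (‖x‖ ^ 2))⁻¹ := by
    funext x; rw [Real.sqrt_sq (norm_nonneg _)]
  have h4 : (0 : ℝ) < ‖x‖ ^ 2 := by positivity
  have h5 : DifferentiableAt ℝ (fun s : ℝ => (Real.sqrt s)⁻¹) (‖x‖ ^ 2) :=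
    (Real.hasDerivAt_sqrt h4.ne').differentiableAt.inv (Real.sqrt_ne_zero'.2 h4)
  rw [h3, rot_comp h1 i hx h5.hasDerivAt, h2, mul_zero]

theorem hasFDerivAt_unitDir_rotGen (i : Fin 3) {x : E3} (hx : x ≠ 0) :
    fderiv ℝ unitDir x (rotGen i x) = rotGen i (unitDir x) := by
  have h := (smoothAway_norm_inv.differentiableAt hx).hasFDerivAt.smul (hasFDerivAt_id x)
  have h' : fderiv ℝ unitDir x = _ := h.fderiv
  rw [h']
  have := rot_norm_inv i hx
  simp only [rot] at this
  simp [this, unitDir]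

/-- The generators are linear and tangent to spheres, so they commute with normalization. Rotation
derivatives on the sphere therefore depend only on the restriction to the sphere, whichever
extension is used. -/
theorem rot_comp_unitDir {F : E3 → ℝ} (hF : SmoothAway F) (i : Fin 3) {x : E3} (hx : x ≠ 0) :
    rot i (fun x => F (unitDir x)) x = rot i F (unitDir x) := by
  have h1 := (hF.differentiableAt (unitDir_ne_zero hx)).hasFDerivAt
  have h2 := ((contDiffOn_unitDir.contDiffAt (isOpen_compl_zero.mem_nhds hx)).differentiableAt
    (by simp)).hasFDerivAt
  have h3 := h1.comp x h2
  simp only [rot]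
  rw [show (fun x => F (unitDir x)) = F ∘ unitDir from rfl, h3.fderiv]
  simp [hasFDerivAt_unitDir_rotGen i hx]

/-- Smooth functions on `ℝ³ ∖ {0}` that are constant along rays. -/
structure RaySmooth (f : E3 → ℝ) : Prop where
  smooth : SmoothAway f
  ray : ∀ x, x ≠ 0 → f (unitDir x) = f x

theorem RaySmooth.smul {f : E3 → ℝ} (hf : RaySmooth f) {c : ℝ} (hc : 0 < c) (x : E3) (hx : x ≠ 0) :
    f (c • x) = f x := by
  rw [← hf.ray _ (smul_ne_zero hc.ne' hx), unitDir_smul hc, hf.ray _ hx]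

theorem SmoothAway.comp_unitDir {F : E3 → ℝ} (hF : SmoothAway F) :
    RaySmooth (fun x => F (unitDir x)) where
  smooth := ContDiffOn.comp hF contDiffOn_unitDir fun _ hx => unitDir_ne_zero hx
  ray x hx := by rw [unitDir_of_norm (norm_unitDir hx)]

theorem rot_congr {f g : E3 → ℝ} (h : ∀ x, x ≠ 0 → f x = g x) (i : Fin 3) : rot i f = rot i g := by
  funext x
  by_cases hx : x = 0
  · subst hx; simp [rot_zero_apply]
  · have : f =ᶠ[𝓝 x] g := by
      filter_upwards [isOpen_compl_zero.mem_nhds hx] with y hy using h y hy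
    simp only [rot, this.fderiv_eq]

theorem rotLap_congr {f g : E3 → ℝ} (h : ∀ x, x ≠ 0 → f x = g x) : rotLap f = rotLap g := by
  funext x
  simp only [rotLap, rot_congr h]

theorem RaySmooth.rot {f : E3 → ℝ} (hf : RaySmooth f) (i : Fin 3) : RaySmooth (rot i f) where
  smooth := hf.smooth.rot i
  ray x hx := by
    rw [← rot_comp_unitDir hf.smooth i hx, rot_congr hf.ray]

theorem RaySmooth.sub {f g : E3 → ℝ} (hf : RaySmooth f) (hg : RaySmooth g) :
    RaySmooth (fun x => f x - g x) :=
  ⟨hf.smooth.sub hg.smooth, fun x hx => by rw [hf.ray x hx, hg.ray x hx]⟩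

theorem RaySmooth.mul {f g : E3 → ℝ} (hf : RaySmooth f) (hg : RaySmooth g) :
    RaySmooth (fun x => f x * g x) :=
  ⟨hf.smooth.mul hg.smooth, fun x hx => by rw [hf.ray x hx, hg.ray x hx]⟩

theorem RaySmooth.sum {ι : Type*} [Fintype ι] {f : ι → E3 → ℝ} (hf : ∀ i, RaySmooth (f i)) :
    RaySmooth (fun x => ∑ i, f i x) :=
  ⟨ContDiffOn.sum fun i _ => (hf i).smooth,
    fun x hx => Finset.sum_congr rfl fun i _ => (hf i).ray x hx⟩

theorem RaySmooth.rotLap {f : E3 → ℝ} (hf : RaySmooth f) : RaySmooth (rotLap f) :=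
  RaySmooth.sum fun i => (hf.rot i).rot i

theorem RaySmooth.comp {f : E3 → ℝ} (hf : RaySmooth f) {φ : ℝ → ℝ}
    (hφ : ∀ x, x ≠ 0 → ContDiffAt ℝ (⊤ : ℕ∞) φ (f x)) : RaySmooth (fun x => φ (f x)) where
  smooth x hx := ((hφ x hx).comp x (hf.smooth.contDiffAt hx)).contDiffWithinAt
  ray x hx := by rw [hf.ray x hx]

theorem radial_of_ne {h : S2 → ℝ} {x : E3} (hx : x ≠ 0) :
    radial h x = h ⟨unitDir x, by simpa using norm_unitDir hx⟩ := by
  simp [radial, hx, unitDir]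

theorem radial_sphere (h : S2 → ℝ) (σ : S2) : radial h σ = h σ := by
  rw [radial_of_ne (sphere_ne_zero σ)]
  congr 1
  ext1
  exact unitDir_sphere σ

theorem SphSmooth.raySmooth {h : S2 → ℝ} (hh : SphSmooth h) : RaySmooth (radial h) where
  smooth := hh
  ray x hx := by
    rw [radial_of_ne (unitDir_ne_zero hx), radial_of_ne hx]
    congr 2
    exact unitDir_of_norm (norm_unitDir hx)

theorem radial_restrict {f : E3 → ℝ} (hf : ∀ x, x ≠ 0 → f (unitDir x) = f x) {x : E3}
    (hx : x ≠ 0) : radial (fun σ : S2 => f σ) x = f x := by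
  rw [radial_of_ne hx]; exact hf x hx

theorem RaySmooth.sphSmooth {f : E3 → ℝ} (hf : RaySmooth f) : SphSmooth (fun σ : S2 => f σ) :=
  ContDiffOn.congr hf.smooth fun _ hx => radial_restrict hf.ray hx

theorem RaySmooth.euler {f : E3 → ℝ} (hf : RaySmooth f) {x : E3} (hx : x ≠ 0) :
    fderiv ℝ f x x = 0 := by
  have h1 : HasDerivAt (fun s : ℝ => s • x) x 1 := by
    simpa using (hasDerivAt_id (1 : ℝ)).smul_const x
  have h0 : HasFDerivAt f (fderiv ℝ f x) ((1 : ℝ) • x) := by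
    rw [one_smul]; exact (hf.smooth.differentiableAt hx).hasFDerivAt
  have h2 : HasDerivAt (fun s : ℝ => f (s • x)) (fderiv ℝ f x x) 1 := h0.comp_hasDerivAt 1 h1
  have h3 : (fun s : ℝ => f (s • x)) =ᶠ[𝓝 1] fun _ => f x := by
    filter_upwards [lt_mem_nhds (zero_lt_one : (0 : ℝ) < 1)] with s hs using hf.smul hs x hx
  exact h2.unique ((hasDerivAt_const 1 (f x)).congr_of_eventuallyEq h3)

theorem RaySmooth.euler_snd {f : E3 → ℝ} (hf : RaySmooth f) {x : E3} (hx : x ≠ 0) :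
    fderiv ℝ (fderiv ℝ f) x x x = 0 := by
  have h1 : DifferentiableAt ℝ (fderiv ℝ f) x :=
    (hf.smooth.fderiv.contDiffAt (isOpen_compl_zero.mem_nhds hx)).differentiableAt (by simp)
  have h2 := h1.hasFDerivAt.clm_apply (hasFDerivAt_id x)
  have h3 : (fun y => (fderiv ℝ f y) (id y)) =ᶠ[𝓝 x] fun _ => 0 := by
    filter_upwards [isOpen_compl_zero.mem_nhds hx] with y hy using hf.euler hy
  have h4 := h2.unique ((hasFDerivAt_const (0 : ℝ) x).congr_of_eventuallyEq h3)
  have h5 := congrArg (fun L => L x) h4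
  simpa [hf.euler hx] using h5

theorem eq_sum_single (x : E3) : x = x 0 • EuclideanSpace.single 0 (1 : ℝ) +
    x 1 • EuclideanSpace.single 1 (1 : ℝ) + x 2 • EuclideanSpace.single 2 (1 : ℝ) := by
  ext k; fin_cases k <;> simp

/-- In ℝ³ the sum of the squared rotation fields is |x|²Δf − D²f(x,x) − 2 df(x). The last two terms
vanish by the Euler relations for functions constant along rays, and |x| = 1. -/
theorem RaySmooth.laplacian_eq {f : E3 → ℝ} (hf : RaySmooth f) {x : E3} (hx : ‖x‖ = 1) :
    Laplacian.laplacian f x = KacBoltzmann.rotLap f x := by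
  have hx0 : x ≠ 0 := by rw [← norm_ne_zero_iff, hx]; exact one_ne_zero
  have e1 := hf.euler hx0
  have e2 := hf.euler_snd hx0
  have hn : x 0 ^ 2 + x 1 ^ 2 + x 2 ^ 2 = 1 := by
    have := EuclideanSpace.norm_sq_eq x
    rw [hx] at this; simpa [Fin.sum_univ_three] using this.symm
  have hL := congrFun (InnerProductSpace.laplacian_eq_iteratedFDeriv_orthonormalBasis f
    (EuclideanSpace.basisFun (Fin 3) ℝ)) x
  have s01 := snd_fderiv_symm hf.smooth hx0 (EuclideanSpace.single 0 1) (EuclideanSpace.single 1 1)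
  have s02 := snd_fderiv_symm hf.smooth hx0 (EuclideanSpace.single 0 1) (EuclideanSpace.single 2 1)
  have s12 := snd_fderiv_symm hf.smooth hx0 (EuclideanSpace.single 1 1) (EuclideanSpace.single 2 1)
  refine hL.trans ?_
  simp only [KacBoltzmann.rotLap, Fin.sum_univ_three, rot_rot hf.smooth _ _ hx0, iteratedFDeriv_two_apply,
    Matrix.cons_val_zero, Matrix.cons_val_one, EuclideanSpace.basisFun_apply]
  generalize hD : fderiv ℝ (fderiv ℝ f) x = D at *
  generalize hd : fderiv ℝ f x = d at *
  have hxe : D x x = D (x 0 • EuclideanSpace.single 0 (1 : ℝ) +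
    x 1 • EuclideanSpace.single 1 (1 : ℝ) + x 2 • EuclideanSpace.single 2 (1 : ℝ)) 
    (x 0 • EuclideanSpace.single 0 (1 : ℝ) +
    x 1 • EuclideanSpace.single 1 (1 : ℝ) + x 2 • EuclideanSpace.single 2 (1 : ℝ)) := by
    rw [← eq_sum_single]
  have hxd : d x = d (x 0 • EuclideanSpace.single 0 (1 : ℝ) +
    x 1 • EuclideanSpace.single 1 (1 : ℝ) + x 2 • EuclideanSpace.single 2 (1 : ℝ)) := by
    rw [← eq_sum_single]
  rw [hxe] at e2
  rw [hxd] at e1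
  simp only [rotGen_apply, map_add, map_sub, map_smul, smul_eq_mul, add_apply,
    sub_apply, smul_apply, zero_add, show (1 : Fin 3) + 1 = 2 from rfl,
    show (1 : Fin 3) + 2 = 0 from rfl, show (2 : Fin 3) + 1 = 0 from rfl,
    show (2 : Fin 3) + 2 = 1 from rfl] at e1 e2 ⊢
  simp only [PiLp.single_apply, Fin.isValue, Fin.reduceEq, if_true, if_false]
  linear_combination (-(D (EuclideanSpace.single 0 1) (EuclideanSpace.single 0 1) +
    D (EuclideanSpace.single 1 1) (EuclideanSpace.single 1 1) +
    D (EuclideanSpace.single 2 1) (EuclideanSpace.single 2 1))) * hn + e2 + 2 * e1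

/-! ### Integration on the sphere -/

instance : IsFiniteMeasure surface := inferInstanceAs (IsFiniteMeasure (volume : Measure E3).toSphere)

theorem surface_ne_zero : surface ≠ 0 := Measure.toSphere_ne_zero _

theorem SmoothAway.continuous_sphere {f : E3 → ℝ} (hf : SmoothAway f) :
    Continuous (fun σ : S2 => f σ) :=
  hf.continuousOn.comp_continuous continuous_subtype_val fun σ => sphere_ne_zero σ

theorem integrable_surface {f : S2 → ℝ} (hf : Continuous f) : Integrable f surface :=
  hf.integrable_of_hasCompactSupport (HasCompactSupport.of_compactSpace f)

theorem SmoothAway.integrable_sphere {f : E3 → ℝ} (hf : SmoothAway f) :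
    Integrable (fun σ : S2 => f σ) surface := integrable_surface hf.continuous_sphere

theorem measurePreserving_polar : MeasurePreserving (homeomorphUnitSphereProd E3)
    ((volume : Measure E3).comap (↑)) (surface.prod (Measure.volumeIoiPow 2)) := by
  have := (volume : Measure E3).measurePreserving_homeomorphUnitSphereProd
  simpa [surface] using this

theorem integral_polar (G : E3 → ℝ) :
    ∫ x, G x = ∫ p : S2 × Set.Ioi (0 : ℝ), G ((p.2 : ℝ) • (p.1 : E3))
      ∂(surface.prod (Measure.volumeIoiPow 2)) := by
  have h1 : ∫ x, G x = ∫ x : ({(0)}ᶜ : Set E3), G x.1 ∂((volume : Measure E3).comap (↑)) := by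
    rw [integral_subtype_comap (measurableSet_singleton _).compl fun x ↦ G x,
      restrict_compl_singleton]
  rw [h1, ← measurePreserving_polar.integral_comp (Homeomorph.measurableEmbedding _)
    (fun p : S2 × Set.Ioi (0 : ℝ) => G ((p.2 : ℝ) • (p.1 : E3)))]
  refine integral_congr_ae (Eventually.of_forall fun x => ?_)
  have hx : ‖(x : E3)‖ ≠ 0 := norm_ne_zero_iff.2 x.2
  simp [smul_smul, mul_inv_cancel₀ hx]

/-- A smooth bump on `ℝ` around `1`. -/
def bumpOne : ContDiffBump (1 : ℝ) := ⟨1 / 4, 1 / 2, by norm_num, by norm_num⟩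

/-- A smooth radial function supported in an annulus. -/
def annulus (x : E3) : ℝ := bumpOne (‖x‖ ^ 2)

theorem contDiff_annulus : ContDiff ℝ (⊤ : ℕ∞) annulus :=
  bumpOne.contDiff.comp (contDiff_norm_sq ℝ)

theorem annulus_eq_zero {x : E3} (hx : ‖x‖ ^ 2 < 1 / 2 ∨ 2 < ‖x‖ ^ 2) : annulus x = 0 := by
  apply bumpOne.zero_of_le_dist
  rw [Real.dist_eq]
  change (1 / 2 : ℝ) ≤ _
  rcases hx with h | h
  · rw [abs_of_neg (by linarith)]; linarith
  · rw [abs_of_pos (by linarith)]; linarith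

theorem contDiff_annulus_mul {f : E3 → ℝ} (hf : SmoothAway f) :
    ContDiff ℝ (⊤ : ℕ∞) (fun x => annulus x * f x) := by
  rw [contDiff_iff_contDiffAt]
  intro x
  by_cases hx : x = 0
  · have : (fun x => annulus x * f x) =ᶠ[𝓝 x] fun _ => 0 := by
      have hc : Continuous fun y : E3 => ‖y‖ ^ 2 := by fun_prop
      have : ∀ᶠ y in 𝓝 x, ‖y‖ ^ 2 < 1 / 2 :=
        hc.continuousAt.eventually_lt continuousAt_const (by simp [hx])
      filter_upwards [this] with y hy
      rw [annulus_eq_zero (Or.inl hy), zero_mul]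
    exact contDiffAt_const.congr_of_eventuallyEq this
  · exact contDiff_annulus.contDiffAt.mul (hf.contDiffAt hx)

theorem hasCompactSupport_annulus_mul (f : E3 → ℝ) :
    HasCompactSupport (fun x => annulus x * f x) := by
  refine HasCompactSupport.intro (isCompact_closedBall (0 : E3) 2) fun x hx => ?_
  rw [mem_closedBall_zero_iff, not_le] at hx
  rw [annulus_eq_zero (Or.inr (by nlinarith)), zero_mul]

theorem integral_coord_mul_fderiv {G : E3 → ℝ} (hG : ContDiff ℝ (⊤ : ℕ∞) G)
    (hc : HasCompactSupport G) {j k : Fin 3} (hjk : j ≠ k) :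
    ∫ x : E3, x j * fderiv ℝ G x (EuclideanSpace.single k 1) = 0 := by
  have hd : Continuous fun x : E3 => fderiv ℝ G x (EuclideanSpace.single k (1 : ℝ)) :=
    (hG.continuous_fderiv (by simp)).clm_apply continuous_const
  have hcd : HasCompactSupport fun x : E3 => fderiv ℝ G x (EuclideanSpace.single k (1 : ℝ)) :=
    hc.fderiv_apply (𝕜 := ℝ) _
  have hj : ∀ x : E3, fderiv ℝ (fun x : E3 => x j) x (EuclideanSpace.single k (1 : ℝ)) = 0 := by
    intro x
    rw [show (fun x : E3 => x j) = (EuclideanSpace.proj j : E3 →L[ℝ] ℝ) from rfl,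
      ContinuousLinearMap.fderiv]
    simp [hjk]
  have hjc : Continuous fun x : E3 => x j := (EuclideanSpace.proj j : E3 →L[ℝ] ℝ).continuous
  rw [integral_mul_fderiv_eq_neg_fderiv_mul_of_integrable]
  · simp [hj]
  · simp [hj]
  · exact (hjc.mul hd).integrable_of_hasCompactSupport hcd.mul_left
  · exact (hjc.mul hG.continuous).integrable_of_hasCompactSupport hc.mul_left
  · exact fun x _ => (EuclideanSpace.proj j : E3 →L[ℝ] ℝ).differentiableAt
  · exact fun x _ => hG.differentiable (by simp) x

theorem integral_rot_of_compactSupport {G : E3 → ℝ} (hG : ContDiff ℝ (⊤ : ℕ∞) G)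
    (hc : HasCompactSupport G) (i : Fin 3) : ∫ x : E3, rot i G x = 0 := by
  have hint : ∀ j k : Fin 3,
      Integrable fun x : E3 => x j * fderiv ℝ G x (EuclideanSpace.single k (1 : ℝ)) := by
    intro j k
    have hd : Continuous fun x : E3 => fderiv ℝ G x (EuclideanSpace.single k (1 : ℝ)) :=
      (hG.continuous_fderiv (by simp)).clm_apply continuous_const
    have hcd : HasCompactSupport fun x : E3 => fderiv ℝ G x (EuclideanSpace.single k (1 : ℝ)) :=
      hc.fderiv_apply (𝕜 := ℝ) _
    have hjc : Continuous fun x : E3 => x j := (EuclideanSpace.proj j : E3 →L[ℝ] ℝ).continuous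
    exact (hjc.mul hd).integrable_of_hasCompactSupport hcd.mul_left
  have h : ∀ x, rot i G x = x (i + 1) * fderiv ℝ G x (EuclideanSpace.single (i + 2) (1 : ℝ)) -
      x (i + 2) * fderiv ℝ G x (EuclideanSpace.single (i + 1) (1 : ℝ)) := by
    intro x; simp [rot, rotGen_apply]
  simp_rw [h]
  rw [integral_sub (hint _ _) (hint _ _), integral_coord_mul_fderiv hG hc,
    integral_coord_mul_fderiv hG hc, sub_zero]
  · fin_cases i <;> decide
  · fin_cases i <;> decide

theorem rot_annulus (i : Fin 3) (x : E3) : rot i annulus x = 0 := by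
  by_cases hx : x = 0
  · subst hx; exact rot_zero_apply _ _
  have h1 : SmoothAway (fun x : E3 => ‖x‖ ^ 2) := (contDiff_norm_sq ℝ).contDiffOn
  have h2 : rot i (fun x : E3 => ‖x‖ ^ 2) x = 0 := by
    simp only [rot]
    rw [fderiv_norm_sq_apply]
    simp [inner_rotGen_self]
  have h3 := rot_comp h1 (φ := bumpOne) i hx
    ((bumpOne.contDiff (n := 1)).differentiable (by simp) _).hasDerivAt
  rw [h2, mul_zero] at h3
  exact h3

theorem integral_annulus_mul {f : E3 → ℝ} (hf : RaySmooth f) :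
    ∫ x, annulus x * f x = (∫ σ : S2, f σ ∂surface) *
      ∫ r : Set.Ioi (0 : ℝ), bumpOne ((r : ℝ) ^ 2) ∂(Measure.volumeIoiPow 2) := by
  rw [integral_polar, ← integral_prod_mul]
  refine integral_congr_ae (Eventually.of_forall fun p => ?_)
  have hr : (0 : ℝ) < p.2 := p.2.2
  simp only [annulus, norm_smul, sphere_norm, mul_one, Real.norm_eq_abs, sq_abs]
  rw [hf.smul hr _ (sphere_ne_zero _), mul_comm]

theorem integral_bumpOne_pos :
    0 < ∫ r : Set.Ioi (0 : ℝ), bumpOne ((r : ℝ) ^ 2) ∂(Measure.volumeIoiPow 2) := by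
  have h1 : RaySmooth (fun _ => (1 : ℝ)) := ⟨contDiffOn_const, fun _ _ => rfl⟩
  have h := integral_annulus_mul h1
  have hpos : 0 < ∫ x, annulus x * (1 : ℝ) := by
    have hcont : Continuous fun x : E3 => annulus x * (1 : ℝ) :=
      (contDiff_annulus_mul h1.smooth).continuous
    refine hcont.integral_pos_of_hasCompactSupport_nonneg_nonzero
      (hasCompactSupport_annulus_mul _) (fun x => ?_) (x := EuclideanSpace.single 0 (1 : ℝ)) ?_
    · change (0 : ℝ) ≤ annulus x * 1
      rw [mul_one]; exact bumpOne.nonneg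
    · have : annulus (EuclideanSpace.single 0 (1 : ℝ)) = 1 := by
        apply bumpOne.one_of_mem_closedBall
        simp only [PiLp.norm_single, norm_one, one_pow]
        exact Metric.mem_closedBall_self bumpOne.rIn_pos.le
      simp [this]
  rw [h] at hpos
  exact pos_of_mul_pos_right hpos (by simp)

/-- The statement is transferred to ℝ³ by multiplying with a radial cutoff, which rotations do not
see. There the rotation fields are divergence free, and polar coordinates split off a strictly
positive radial factor. -/
theorem integral_rot {f : E3 → ℝ} (hf : RaySmooth f) (i : Fin 3) :
    ∫ σ : S2, rot i f σ ∂surface = 0 := by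
  have h1 := integral_annulus_mul (hf.rot i)
  have h2 := integral_rot_of_compactSupport (contDiff_annulus_mul hf.smooth)
    (hasCompactSupport_annulus_mul f) i
  have h3 : ∀ x, rot i (fun x => annulus x * f x) x = annulus x * rot i f x := by
    intro x
    rw [rot_mul contDiff_annulus.contDiffOn hf.smooth, rot_annulus, zero_mul, add_zero]
  simp_rw [h3] at h2
  rw [h2] at h1
  exact (mul_eq_zero.1 h1.symm).resolve_right integral_bumpOne_pos.ne'

theorem integral_rot_mul {f g : E3 → ℝ} (hf : RaySmooth f) (hg : RaySmooth g) (i : Fin 3) :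
    ∫ σ : S2, rot i f σ * g σ ∂surface = -∫ σ : S2, f σ * rot i g σ ∂surface := by
  have h := integral_rot (hf.mul hg) i
  simp_rw [rot_mul hf.smooth hg.smooth] at h
  rw [integral_add (hf.smooth.mul (hg.rot i).smooth).integrable_sphere
    ((hf.rot i).smooth.mul hg.smooth).integrable_sphere] at h
  linarith

theorem integral_rotLap_mul {f g : E3 → ℝ} (hf : RaySmooth f) (hg : RaySmooth g) :
    ∫ σ : S2, rotLap f σ * g σ ∂surface = -∑ i, ∫ σ : S2, rot i f σ * rot i g σ ∂surface := by
  simp only [rotLap, Finset.sum_mul]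
  rw [integral_finsetSum _ fun i _ =>
    (((hf.rot i).rot i).smooth.mul hg.smooth).integrable_sphere, ← Finset.sum_neg_distrib]
  exact Finset.sum_congr rfl fun i _ => integral_rot_mul (hf.rot i) hg i

theorem integral_mul_rotLap_comm {f g : E3 → ℝ} (hf : RaySmooth f) (hg : RaySmooth g) :
    ∫ σ : S2, f σ * rotLap g σ ∂surface = ∫ σ : S2, rotLap f σ * g σ ∂surface := by
  rw [integral_rotLap_mul hf hg]
  simp_rw [mul_comm (f _)]
  rw [integral_rotLap_mul hg hf]
  simp_rw [mul_comm]

/-- Integrating by parts once gives −∫(ΔR_j f)(R_j f). Commuting Δ with R_j and summing over j gives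
−Σ∫R_j(Δf) R_j f, which is ∫(Δf)² after a second integration by parts. -/
theorem integral_rot_rot_sq {f : E3 → ℝ} (hf : RaySmooth f) :
    ∑ j, ∑ i, ∫ σ : S2, rot i (rot j f) σ ^ 2 ∂surface = ∫ σ : S2, rotLap f σ ^ 2 ∂surface := by
  have h1 : ∀ j, ∑ i, ∫ σ : S2, rot i (rot j f) σ ^ 2 ∂surface =
      -∫ σ : S2, rotLap (rot j f) σ * rot j f σ ∂surface := by
    intro j
    rw [integral_rotLap_mul (hf.rot j) (hf.rot j), neg_neg]
    simp_rw [pow_two]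
  simp_rw [h1, rotLap_rot hf.smooth, pow_two]
  rw [integral_rotLap_mul hf hf.rotLap, Finset.sum_neg_distrib]
  simp_rw [mul_comm]

end KacBoltzmann
end

noncomputable section

namespace KacBoltzmann

/-! ### The logarithmic gradient is controlled by the Laplacian -/

/-- The carré du champ `|∇_σ h|²`. -/
def gradSq (h : E3 → ℝ) (x : E3) : ℝ := ∑ i, rot i h x ^ 2

theorem RaySmooth.gradSq {h : E3 → ℝ} (hh : RaySmooth h) : RaySmooth (gradSq h) :=
  RaySmooth.sum fun i => by simpa only [pow_two] using (hh.rot i).mul (hh.rot i)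

theorem RaySmooth.inv {h : E3 → ℝ} (hh : RaySmooth h) (hpos : ∀ x, x ≠ 0 → 0 < h x) :
    RaySmooth (fun x => (h x)⁻¹) :=
  hh.comp fun x hx => contDiffAt_inv ℝ (hpos x hx).ne'

theorem rot_sum {ι : Type*} [Fintype ι] {f : ι → E3 → ℝ} (hf : ∀ i, SmoothAway (f i)) (k : Fin 3)
    (x : E3) : rot k (fun x => ∑ i, f i x) x = ∑ i, rot k (f i) x := by
  by_cases hx : x = 0
  · subst hx; simp [rot_zero_apply]
  · simp only [rot]
    rw [fderiv_fun_sum fun i _ => (hf i).differentiableAt hx]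
    simp

theorem rot_gradSq {h : E3 → ℝ} (hh : RaySmooth h) (i : Fin 3) (x : E3) :
    rot i (gradSq h) x = 2 * ∑ j, rot j h x * rot i (rot j h) x := by
  have : gradSq h = fun x => ∑ j, rot j h x * rot j h x := by
    funext x; simp [gradSq, pow_two]
  rw [this, rot_sum fun j => ((hh.rot j).mul (hh.rot j)).smooth, Finset.mul_sum]
  refine Finset.sum_congr rfl fun j _ => ?_
  rw [rot_mul (hh.rot j).smooth (hh.rot j).smooth]; ring

/-- The field with components h⁻¹|∇h|² R_i h has integral-free divergence. Expanding it expresses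
(|∇h|²/h)² through the first power of |∇h|²/h times second derivatives, which Young's inequality
absorbs. -/
theorem integral_gradSq_div_sq_le {h : E3 → ℝ} (hh : RaySmooth h)
    (hpos : ∀ x, x ≠ 0 → 0 < h x) :
    ∫ σ : S2, (gradSq h σ * (h σ)⁻¹) ^ 2 ∂surface ≤ 9 * ∫ σ : S2, rotLap h σ ^ 2 ∂surface := by
  have hi := hh.inv hpos
  have hG := hh.gradSq
  set f : Fin 3 → E3 → ℝ := fun i x => ((h x)⁻¹ * gradSq h x) * rot i h x with hf
  have hfs : ∀ i, RaySmooth (f i) := fun i => (hi.mul hG).mul (hh.rot i)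
  have hpt : ∀ σ : S2, (gradSq h σ * (h σ)⁻¹) ^ 2 ≤ -2 * ∑ i, rot i (f i) σ +
      (3 * rotLap h σ ^ 2 + 6 * ∑ j, ∑ i, rot i (rot j h) σ ^ 2) := by
    intro σ
    have hx := sphere_ne_zero σ
    have hp := hpos σ hx
    have hr : ∀ i, rot i (f i) σ = (h σ)⁻¹ * gradSq h σ * rot i (rot i h) σ +
        ((h σ)⁻¹ * (2 * ∑ j, rot j h σ * rot i (rot j h) σ) +
          (-((h σ) ^ 2)⁻¹ * rot i h σ) * gradSq h σ) * rot i h σ := by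
      intro i
      rw [hf, rot_mul (hi.mul hG).smooth (hh.rot i).smooth, rot_mul hi.smooth hG.smooth,
        rot_gradSq hh, rot_comp hh.smooth i hx (hasDerivAt_inv hp.ne')]
    have key : ∑ i, rot i (f i) σ = (gradSq h σ * (h σ)⁻¹) * rotLap h σ +
        2 * ∑ j, ∑ i, (rot i h σ * rot j h σ * (h σ)⁻¹) * rot i (rot j h) σ -
        (gradSq h σ * (h σ)⁻¹) ^ 2 := by
      simp_rw [hr]
      simp only [rotLap, gradSq, Fin.sum_univ_three]
      field_simp
      ring
    have hY : (gradSq h σ * (h σ)⁻¹) ^ 2 =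
        ∑ j, ∑ i, (rot i h σ * rot j h σ * (h σ)⁻¹) ^ 2 := by
      simp only [gradSq, Fin.sum_univ_three]
      ring
    -- The Young weights 1/3 here and 1/6 below absorb half of the left-hand side. After doubling,
    -- the coefficients are 3 for (Δh)² and 6 for the squared second derivatives, which have equal
    -- integrals; hence 9.
    have h1 : (∑ j, ∑ i, (rot i h σ * rot j h σ * (h σ)⁻¹) * rot i (rot j h) σ) * 2 ≤
        1 / 3 * (gradSq h σ * (h σ)⁻¹) ^ 2 + 3 * ∑ j, ∑ i, rot i (rot j h) σ ^ 2 := by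
      rw [hY, Finset.mul_sum, Finset.mul_sum, Finset.sum_mul, ← Finset.sum_add_distrib]
      refine Finset.sum_le_sum fun j _ => ?_
      rw [Finset.mul_sum, Finset.mul_sum, Finset.sum_mul, ← Finset.sum_add_distrib]
      refine Finset.sum_le_sum fun i _ => ?_
      nlinarith [sq_nonneg ((rot i h σ * rot j h σ * (h σ)⁻¹) - 3 * rot i (rot j h) σ)]
    have h2 : (gradSq h σ * (h σ)⁻¹) * rotLap h σ ≤
        1 / 6 * (gradSq h σ * (h σ)⁻¹) ^ 2 + 3 / 2 * rotLap h σ ^ 2 := by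
      nlinarith [sq_nonneg ((gradSq h σ * (h σ)⁻¹) - 3 * rotLap h σ)]
    linarith
  have i1 : Integrable (fun σ : S2 => (gradSq h σ * (h σ)⁻¹) ^ 2) surface := by
    have := ((hG.mul hi).mul (hG.mul hi)).smooth.integrable_sphere
    simpa only [pow_two] using this
  have i2 : ∀ i, Integrable (fun σ : S2 => rot i (f i) σ) surface :=
    fun i => ((hfs i).rot i).smooth.integrable_sphere
  have i3 : Integrable (fun σ : S2 => rotLap h σ ^ 2) surface := by
    have := (hh.rotLap.mul hh.rotLap).smooth.integrable_sphere
    simpa only [pow_two] using this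
  have i4 : ∀ j i, Integrable (fun σ : S2 => rot i (rot j h) σ ^ 2) surface := by
    intro j i
    have := (((hh.rot j).rot i).mul ((hh.rot j).rot i)).smooth.integrable_sphere
    simpa only [pow_two] using this
  have i5 : Integrable (fun σ : S2 => ∑ j, ∑ i, rot i (rot j h) σ ^ 2) surface :=
    integrable_finsetSum _ fun j _ => integrable_finsetSum _ fun i _ => i4 j i
  have i6 : Integrable (fun σ : S2 => ∑ i, rot i (f i) σ) surface :=
    integrable_finsetSum _ fun i _ => i2 i
  have hle := integral_mono i1 ((i6.const_mul (-2)).add ((i3.const_mul 3).add (i5.const_mul 6))) hpt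
  refine hle.trans (le_of_eq ?_)
  have e1 : ∫ σ : S2, ∑ i, rot i (f i) σ ∂surface = 0 := by
    rw [integral_finsetSum _ fun i _ => i2 i]
    exact Finset.sum_eq_zero fun i _ => integral_rot (hfs i) i
  have e2 : ∫ σ : S2, ∑ j, ∑ i, rot i (rot j h) σ ^ 2 ∂surface =
      ∫ σ : S2, rotLap h σ ^ 2 ∂surface := by
    rw [← integral_rot_rot_sq hh, integral_finsetSum _ fun j _ =>
      integrable_finsetSum _ fun i _ => i4 j i]
    exact Finset.sum_congr rfl fun j _ => integral_finsetSum _ fun i _ => i4 j i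
  simp only [Pi.add_apply]
  have i7 : Integrable (fun σ : S2 => 3 * rotLap h σ ^ 2 +
      6 * ∑ j, ∑ i, rot i (rot j h) σ ^ 2) surface := (i3.const_mul 3).add (i5.const_mul 6)
  rw [integral_add (i6.const_mul (-2)) i7,
    integral_add (i3.const_mul 3) (i5.const_mul 6), integral_const_mul, integral_const_mul,
    integral_const_mul, e1, e2]
  ring

/-! ### Affine minorants of the squared Laplacian of the square root -/

/-- The affine functions of `(g, ∇g, Δg)` whose supremum dominates `(Δ√g)²`. The parameter `c` is
the slope in `Δg`. -/
def affForm (c : ℝ) (b : Fin 3 → ℝ) (g : ℝ) (p : Fin 3 → ℝ) (q : ℝ) : ℝ :=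
  if 0 ≤ c then c * q - c ^ 2 * g
  else c * q - c * ∑ i, b i * p i + c * ((∑ i, b i ^ 2) / 2) * g - c ^ 2 * g

theorem rot_sq {h : E3 → ℝ} (hh : RaySmooth h) (i : Fin 3) (x : E3) :
    rot i (fun x => h x ^ 2) x = 2 * h x * rot i h x := by
  simp_rw [pow_two]
  rw [rot_mul hh.smooth hh.smooth]; ring

theorem rotLap_sq {h : E3 → ℝ} (hh : RaySmooth h) (x : E3) :
    rotLap (fun x => h x ^ 2) x = 2 * h x * rotLap h x + 2 * gradSq h x := by
  simp only [rotLap, gradSq, Finset.mul_sum, ← Finset.sum_add_distrib]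
  refine Finset.sum_congr rfl fun i _ => ?_
  have h2 : SmoothAway (fun x => 2 * h x) := contDiffOn_const.mul hh.smooth
  rw [show rot i (fun x => h x ^ 2) = fun x => (2 * h x) * rot i h x from funext (rot_sq hh i),
    rot_mul h2 (hh.rot i).smooth, rot_mul contDiffOn_const hh.smooth]
  have : rot i (fun _ => (2 : ℝ)) x = 0 := by simp [rot]
  rw [this]; ring

/-- For c ≥ 0, completing the square bounds the form by (Δg)²/(4g) = (Δh + |∇h|²/h)². For c < 0,
Young's inequality on b·∇g removes the 2|∇h|² contained in Δg; what is left is 2chΔh − c²h² ≤ (Δh)².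
-/
theorem affForm_le (c : ℝ) (b : Fin 3 → ℝ) {h : ℝ} (hpos : 0 < h) (d : Fin 3 → ℝ) (D : ℝ) :
    affForm c b (h ^ 2) (fun i => 2 * h * d i) (2 * h * D + 2 * ∑ i, d i ^ 2) ≤
      (D + (∑ i, d i ^ 2) * h⁻¹) ^ 2 + D ^ 2 := by
  unfold affForm
  split_ifs with hc
  · have : 2 * h * D + 2 * ∑ i, d i ^ 2 = 2 * h * (D + (∑ i, d i ^ 2) * h⁻¹) := by field_simp
    rw [this]
    nlinarith [sq_nonneg (c * h - (D + (∑ i, d i ^ 2) * h⁻¹)), sq_nonneg D]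
  · push Not at hc
    have h1 : ∑ i, b i * (2 * h * d i) ≤ (∑ i, b i ^ 2) / 2 * h ^ 2 + 2 * ∑ i, d i ^ 2 := by
      simp only [Fin.sum_univ_three]
      nlinarith [sq_nonneg (b 0 * h - 2 * d 0), sq_nonneg (b 1 * h - 2 * d 1),
        sq_nonneg (b 2 * h - 2 * d 2)]
    have h2 := mul_le_mul_of_nonneg_left h1 (neg_nonneg.2 hc.le)
    nlinarith [sq_nonneg (c * h - D), sq_nonneg (D + (∑ i, d i ^ 2) * h⁻¹)]

/-- The optimal slope is c = Δh/h. If Δh < 0, the optimal vector b = 2∇h/h recovers (Δh)² exactly.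
If Δh > 0, the surplus 2c|∇h|² has the favourable sign and no vector is needed. -/
theorem exists_affForm_eq {h : ℝ} (hpos : 0 < h) (d : Fin 3 → ℝ) (D : ℝ) :
    ∃ c b, (0 < c ∨ c < 0 ∨ D = 0) ∧ D ^ 2 ≤
      affForm c b (h ^ 2) (fun i => 2 * h * d i) (2 * h * D + 2 * ∑ i, d i ^ 2) := by
  rcases lt_trichotomy D 0 with hD | hD | hD
  · refine ⟨D / h, fun i => 2 * d i / h, Or.inr (Or.inl (div_neg_of_neg_of_pos hD hpos)), ?_⟩
    rw [affForm, if_neg (not_le.2 (div_neg_of_neg_of_pos hD hpos))]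
    simp only [Fin.sum_univ_three]
    field_simp
    apply le_of_eq; ring
  · refine ⟨0, 0, Or.inr (Or.inr hD), ?_⟩
    simp [affForm, hD]
  · have hD' : 0 < D / h := div_pos hD hpos
    refine ⟨D / h, 0, Or.inl hD', ?_⟩
    rw [affForm, if_pos hD'.le]
    have : (0 : ℝ) ≤ ∑ i, d i ^ 2 := Finset.sum_nonneg fun _ _ => sq_nonneg _
    have h3 : D / h * (2 * h * D + 2 * ∑ i, d i ^ 2) - (D / h) ^ 2 * h ^ 2 =
      D ^ 2 + D / h * (2 * ∑ i, d i ^ 2) := by field_simp; ring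
    rw [h3]
    nlinarith [mul_nonneg hD'.le this]

/-- A countable family of slopes that is dense. -/
def slope (k : ℕ) : ℝ × (Fin 3 → ℝ) := TopologicalSpace.denseSeq _ k

/-- The `k`-th affine form; the form with index `0` vanishes. -/
def affSeq : ℕ → ℝ → (Fin 3 → ℝ) → ℝ → ℝ
  | 0 => fun _ _ _ => 0
  | k + 1 => affForm (slope k).1 (slope k).2

theorem continuousAt_affForm {c : ℝ} (hc : 0 < c ∨ c < 0) (b : Fin 3 → ℝ) (g : ℝ) (p : Fin 3 → ℝ)
    (q : ℝ) : ContinuousAt (fun s : ℝ × (Fin 3 → ℝ) => affForm s.1 s.2 g p q) (c, b) := by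
  rcases hc with hc | hc
  · have : (fun s : ℝ × (Fin 3 → ℝ) => affForm s.1 s.2 g p q) =ᶠ[𝓝 (c, b)]
        fun s => s.1 * q - s.1 ^ 2 * g := by
      filter_upwards [continuousAt_fst.eventually (lt_mem_nhds hc)] with s hs
      rw [affForm, if_pos (le_of_lt hs)]
    refine ContinuousAt.congr ?_ this.symm
    exact Continuous.continuousAt (by fun_prop)
  · have : (fun s : ℝ × (Fin 3 → ℝ) => affForm s.1 s.2 g p q) =ᶠ[𝓝 (c, b)]
        fun s => s.1 * q - s.1 * ∑ i, s.2 i * p i + s.1 * ((∑ i, s.2 i ^ 2) / 2) * g -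
          s.1 ^ 2 * g := by
      filter_upwards [continuousAt_fst.eventually (gt_mem_nhds hc)] with s hs
      rw [affForm, if_neg (not_le.2 hs)]
    refine ContinuousAt.congr ?_ this.symm
    exact Continuous.continuousAt (by fun_prop)

/-- The form is continuous in its parameters away from c = 0, and the optimal slope vanishes only
when Δh = 0, where there is nothing to prove. A dense sequence of parameters therefore suffices. -/
theorem ofReal_sq_le_iSup_affSeq {h : ℝ} (hpos : 0 < h) (d : Fin 3 → ℝ) (D : ℝ) :
    ENNReal.ofReal (D ^ 2) ≤ ⨆ k, ENNReal.ofReal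
      (affSeq k (h ^ 2) (fun i => 2 * h * d i) (2 * h * D + 2 * ∑ i, d i ^ 2)) := by
  obtain ⟨c, b, hcb, hle⟩ := exists_affForm_eq hpos d D
  by_cases hD : D = 0
  · simp [hD]
  have hc : 0 < c ∨ c < 0 := by tauto
  refine (ENNReal.ofReal_le_ofReal hle).trans ?_
  refine le_of_forall_lt fun a ha => ?_
  have hcont := (ENNReal.continuous_ofReal.continuousAt.comp (continuousAt_affForm hc b (h ^ 2)
    (fun i => 2 * h * d i) (2 * h * D + 2 * ∑ i, d i ^ 2))).eventually (lt_mem_nhds ha)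
  obtain ⟨k, hk⟩ := (TopologicalSpace.denseRange_denseSeq (ℝ × (Fin 3 → ℝ))).exists_mem_open
    isOpen_interior ⟨(c, b), mem_interior_iff_mem_nhds.2 hcont⟩
  have hk' := interior_subset hk
  simp only [Set.mem_ofPred_eq, Function.comp_apply] at hk'
  exact lt_of_lt_of_le hk' (le_iSup (fun k => ENNReal.ofReal
      (affSeq k (h ^ 2) (fun i => 2 * h * d i) (2 * h * D + 2 * ∑ i, d i ^ 2))) (k + 1))

theorem affSeq_le (k : ℕ) {h : ℝ} (hpos : 0 < h) (d : Fin 3 → ℝ) (D : ℝ) :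
    affSeq k (h ^ 2) (fun i => 2 * h * d i) (2 * h * D + 2 * ∑ i, d i ^ 2) ≤
      (D + (∑ i, d i ^ 2) * h⁻¹) ^ 2 + D ^ 2 := by
  cases k with
  | zero => simp only [affSeq]; positivity
  | succ k => exact affForm_le _ _ hpos d D

/-- The supremum of the affine forms of `g` and its derivatives at a point. -/
def supForm (g : E3 → ℝ) (x : E3) : ℝ≥0∞ :=
  ⨆ k, ENNReal.ofReal (affSeq k (g x) (fun i => rot i g x) (rotLap g x))

theorem lintegral_sq_le_supForm {h : E3 → ℝ} (hh : RaySmooth h) (hpos : ∀ x, x ≠ 0 → 0 < h x) :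
    ∫⁻ σ : S2, ENNReal.ofReal (rotLap h σ ^ 2) ∂surface ≤
      ∫⁻ σ : S2, supForm (fun x => h x ^ 2) σ ∂surface := by
  refine lintegral_mono fun σ => ?_
  simp only [supForm, rot_sq hh, rotLap_sq hh]
  exact ofReal_sq_le_iSup_affSeq (hpos σ (sphere_ne_zero σ)) (fun i => rot i h σ) (rotLap h σ)

/-- Pointwise (D + X)² + D² ≤ 5D² + (4/3)X², with X = |∇h|²/h. Together with ∫X² ≤ 9∫D² this gives 5
+ 12 = 17, the only constant lost in the whole argument. -/
theorem lintegral_supForm_le {h : E3 → ℝ} (hh : RaySmooth h) (hpos : ∀ x, x ≠ 0 → 0 < h x) :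
    ∫⁻ σ : S2, supForm (fun x => h x ^ 2) σ ∂surface ≤
      17 * ∫⁻ σ : S2, ENNReal.ofReal (rotLap h σ ^ 2) ∂surface := by
  have hi := hh.inv hpos
  have hG := hh.gradSq
  have i1 : Integrable (fun σ : S2 => (gradSq h σ * (h σ)⁻¹) ^ 2) surface := by
    have := ((hG.mul hi).mul (hG.mul hi)).smooth.integrable_sphere
    simpa only [pow_two] using this
  have i3 : Integrable (fun σ : S2 => rotLap h σ ^ 2) surface := by
    have := (hh.rotLap.mul hh.rotLap).smooth.integrable_sphere
    simpa only [pow_two] using this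
  calc ∫⁻ σ : S2, supForm (fun x => h x ^ 2) σ ∂surface
      ≤ ∫⁻ σ : S2, ENNReal.ofReal (5 * rotLap h σ ^ 2 +
          4 / 3 * (gradSq h σ * (h σ)⁻¹) ^ 2) ∂surface := by
        refine lintegral_mono fun σ => iSup_le fun k => ENNReal.ofReal_le_ofReal ?_
        simp only [rot_sq hh, rotLap_sq hh]
        refine (affSeq_le k (hpos σ (sphere_ne_zero σ)) (fun i => rot i h σ) (rotLap h σ)).trans ?_
        change (rotLap h σ + gradSq h σ * (h σ)⁻¹) ^ 2 + _ ≤ _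
        nlinarith [sq_nonneg (3 * rotLap h σ - gradSq h σ * (h σ)⁻¹)]
    _ = ENNReal.ofReal (∫ σ : S2, (5 * rotLap h σ ^ 2 +
          4 / 3 * (gradSq h σ * (h σ)⁻¹) ^ 2) ∂surface) := by
        have i8 : Integrable (fun σ : S2 => 5 * rotLap h σ ^ 2 +
            4 / 3 * (gradSq h σ * (h σ)⁻¹) ^ 2) surface :=
          (i3.const_mul 5).add (i1.const_mul (4 / 3))
        rw [ofReal_integral_eq_lintegral_ofReal i8]
        exact Eventually.of_forall fun σ => by simp only [Pi.zero_apply]; positivity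
    _ ≤ ENNReal.ofReal (17 * ∫ σ : S2, rotLap h σ ^ 2 ∂surface) := by
        refine ENNReal.ofReal_le_ofReal ?_
        rw [integral_add (i3.const_mul 5) (i1.const_mul (4 / 3)), integral_const_mul,
          integral_const_mul]
        linarith [integral_gradSq_div_sq_le hh hpos]
    _ = 17 * ∫⁻ σ : S2, ENNReal.ofReal (rotLap h σ ^ 2) ∂surface := by
        rw [ENNReal.ofReal_mul (by norm_num), ofReal_integral_eq_lintegral_ofReal i3
          (Eventually.of_forall fun σ => sq_nonneg _)]
        simp

end KacBoltzmann
end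

noncomputable section

namespace KacBoltzmann

/-! ### The Sobolev seminorm of smooth functions -/

theorem RaySmooth.radial_eq {f : E3 → ℝ} (hf : RaySmooth f) :
    ∀ x, x ≠ 0 → radial (fun σ : S2 => f σ) x = f x := fun _ hx => radial_restrict hf.ray hx

theorem SphSmooth.sphLaplacian_eq {h : S2 → ℝ} (hh : SphSmooth h) (σ : S2) :
    sphLaplacian h σ = rotLap (radial h) σ :=
  hh.raySmooth.laplacian_eq (sphere_norm σ)

theorem RaySmooth.sphLaplacian_eq {f : E3 → ℝ} (hf : RaySmooth f) (σ : S2) :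
    sphLaplacian (fun σ : S2 => f σ) σ = KacBoltzmann.rotLap f σ := by
  rw [hf.sphSmooth.sphLaplacian_eq, rotLap_congr hf.radial_eq]

theorem memLp_surface {f : S2 → ℝ} (hf : Continuous f) (p : ℝ≥0∞) : MemLp f p surface :=
  hf.memLp_of_hasCompactSupport (HasCompactSupport.of_compactSpace f)

theorem RaySmooth.isWeakSphLaplacian {f : E3 → ℝ} (hf : RaySmooth f) :
    IsWeakSphLaplacian (fun σ => f σ) (fun σ => KacBoltzmann.rotLap f σ) := by
  refine ⟨memLp_surface hf.smooth.continuous_sphere 2,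
    memLp_surface hf.rotLap.smooth.continuous_sphere 2, fun φ hφ => ?_⟩
  simp_rw [hφ.sphLaplacian_eq]
  rw [integral_mul_rotLap_comm hf hφ.raySmooth]
  simp_rw [radial_sphere]

/-- Testing a weak Laplacian w against the smooth function Δf gives ∫wΔf = ∫(Δf)². Expanding ∫(w −
Δf)² ≥ 0 shows that no weak Laplacian has smaller norm. -/
theorem RaySmooth.sobolevH2Sq_eq {f : E3 → ℝ} (hf : RaySmooth f) :
    sobolevH2Sq (fun σ => f σ) =
      ∫⁻ σ : S2, ENNReal.ofReal (KacBoltzmann.rotLap f σ ^ 2) ∂surface := by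
  refine le_antisymm (iInf₂_le _ hf.isWeakSphLaplacian) (le_iInf₂ fun w hw => ?_)
  obtain ⟨-, hw2, hw3⟩ := hw
  have hL := hf.rotLap
  have h1 := hw3 (fun σ => KacBoltzmann.rotLap f σ) hL.sphSmooth
  simp_rw [hL.sphLaplacian_eq] at h1
  rw [integral_mul_rotLap_comm hf hL] at h1
  have hL2 : MemLp (fun σ : S2 => KacBoltzmann.rotLap f σ) 2 surface :=
    memLp_surface hL.smooth.continuous_sphere 2
  have iw : Integrable (fun σ => w σ ^ 2) surface := hw2.integrable_sq
  have iL := hL2.integrable_sq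
  have iwL : Integrable (fun σ => w σ * KacBoltzmann.rotLap f σ) surface :=
    hw2.integrable_mul hL2
  have h2 : 0 ≤ ∫ σ : S2, (w σ - KacBoltzmann.rotLap f σ) ^ 2 ∂surface :=
    integral_nonneg fun σ => sq_nonneg _
  have h3 : ∫ σ : S2, (w σ - KacBoltzmann.rotLap f σ) ^ 2 ∂surface =
      ∫ σ : S2, w σ ^ 2 ∂surface - 2 * (∫ σ : S2, w σ * KacBoltzmann.rotLap f σ ∂surface) +
        ∫ σ : S2, KacBoltzmann.rotLap f σ ^ 2 ∂surface := by
    rw [← integral_const_mul, ← integral_sub iw (iwL.const_mul 2), ← integral_add]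
    · exact integral_congr_ae (Eventually.of_forall fun σ => by ring)
    · exact iw.sub (iwL.const_mul 2)
    · exact iL
  rw [← ofReal_integral_eq_lintegral_ofReal iw (Eventually.of_forall fun σ => sq_nonneg _),
    ← ofReal_integral_eq_lintegral_ofReal iL (Eventually.of_forall fun σ => sq_nonneg _)]
  refine ENNReal.ofReal_le_ofReal ?_
  have h4 : ∫ σ : S2, KacBoltzmann.rotLap f σ * KacBoltzmann.rotLap f σ ∂surface =
    ∫ σ : S2, KacBoltzmann.rotLap f σ ^ 2 ∂surface := by simp_rw [pow_two]
  linarith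

theorem sobolevH2Sq_congr {h h' : S2 → ℝ} (hh : h =ᵐ[surface] h') :
    sobolevH2Sq h = sobolevH2Sq h' := by
  have key : ∀ {h h' : S2 → ℝ}, h =ᵐ[surface] h' → ∀ w, IsWeakSphLaplacian h w →
      IsWeakSphLaplacian h' w := by
    intro h h' hh w hw
    refine ⟨(memLp_congr_ae hh).1 hw.1, hw.2.1, fun φ hφ => ?_⟩
    rw [← hw.2.2 φ hφ]
    exact integral_congr_ae (hh.symm.mono fun σ hσ => by simp only [hσ])
  refine le_antisymm ?_ ?_
  · exact le_iInf₂ fun w hw => iInf₂_le w (key hh.symm w hw)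
  · exact le_iInf₂ fun w hw => iInf₂_le w (key hh w hw)

/-! ### Uniqueness of the heat flow -/

theorem IsSphHeatFlow.raySmooth {g : S2 → ℝ} {u : ℝ → S2 → ℝ} (hu : IsSphHeatFlow g u) {t : ℝ}
    (ht : 0 < t) : RaySmooth (radial (u t)) := by
  refine SphSmooth.raySmooth ?_
  have h1 : ContDiff ℝ (⊤ : ℕ∞) (fun x : E3 => (t, x)) := contDiff_const.prodMk contDiff_id
  exact hu.smooth.comp h1.contDiffOn fun x hx => ⟨ht, hx⟩

theorem continuousOn_sphere_time {f : ℝ × E3 → ℝ}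
    (hf : ContinuousOn f (Set.Ioi 0 ×ˢ {0}ᶜ)) :
    ContinuousOn (fun p : ℝ × S2 => f (p.1, (p.2 : E3))) (Set.Ioi 0 ×ˢ Set.univ) :=
  hf.comp (by fun_prop) fun p hp => ⟨hp.1, sphere_ne_zero p.2⟩

theorem hasDerivAt_sqrt_one_add_sq (s : ℝ) :
    HasDerivAt (fun s : ℝ => Real.sqrt (1 + s ^ 2)) (s / Real.sqrt (1 + s ^ 2)) s := by
  have h1 : HasDerivAt (fun s : ℝ => 1 + s ^ 2) (2 * s) s := by
    simpa using (hasDerivAt_pow 2 s).const_add 1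
  have h2 := h1.sqrt (by positivity)
  convert! h2 using 1
  field_simp

theorem contDiff_div_sqrt : ContDiff ℝ (⊤ : ℕ∞) (fun s : ℝ => s / Real.sqrt (1 + s ^ 2)) := by
  refine contDiff_id.div ?_ fun s => (Real.sqrt_pos.2 (by positivity)).ne'
  exact ContDiff.sqrt (by fun_prop) fun s => by positivity

theorem deriv_div_sqrt_nonneg (s : ℝ) :
    0 ≤ deriv (fun s : ℝ => s / Real.sqrt (1 + s ^ 2)) s := by
  have hp : 0 < Real.sqrt (1 + s ^ 2) := Real.sqrt_pos.2 (by positivity)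
  have h := (hasDerivAt_id s).fun_div (hasDerivAt_sqrt_one_add_sq s) hp.ne'
  rw [show (fun s : ℝ => s / Real.sqrt (1 + s ^ 2)) = fun y => id y / Real.sqrt (1 + y ^ 2)
    from rfl, h.deriv]
  apply div_nonneg _ (sq_nonneg _)
  simp only [id]
  have hsq := Real.sq_sqrt (show 0 ≤ 1 + s ^ 2 by positivity)
  rw [sub_nonneg, ← mul_div_assoc, div_le_iff₀ hp]
  nlinarith

/-- The factor is the derivative of the convex function √(1+s²), so after integration by parts the
integrand is a non-negative multiple of −|∇d|². -/
theorem integral_mul_rotLap_nonpos {d : E3 → ℝ} (hd : RaySmooth d) :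
    ∫ σ : S2, d σ / Real.sqrt (1 + d σ ^ 2) * rotLap d σ ∂surface ≤ 0 := by
  have hφ : RaySmooth (fun x => d x / Real.sqrt (1 + d x ^ 2)) :=
    hd.comp fun x _ => contDiff_div_sqrt.contDiffAt
  have h := integral_rotLap_mul hd hφ
  simp_rw [mul_comm (rotLap d _)] at h
  rw [h, neg_nonpos]
  refine Finset.sum_nonneg fun i _ => integral_nonneg fun σ => ?_
  simp only [Pi.zero_apply]
  rw [rot_comp hd.smooth i (sphere_ne_zero σ)
    (contDiff_div_sqrt.differentiable (by simp) _).hasDerivAt]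
  have := deriv_div_sqrt_nonneg (d σ)
  nlinarith [mul_nonneg this (sq_nonneg (rot i d σ))]

/-- The initial datum is attained only in L¹, so an L² energy need not be controlled at time 0. The
function √(1+s²) is a smooth convex substitute for |s|: its integral along the difference decreases
and is compared with the L¹ norm as time tends to 0. -/
theorem IsSphHeatFlow.unique {g : S2 → ℝ} {u v : ℝ → S2 → ℝ} (hu : IsSphHeatFlow g u)
    (hv : IsSphHeatFlow g v) {t : ℝ} (ht : 0 < t) : u t =ᵐ[surface] v t := by
  set d : ℝ → E3 → ℝ := fun t x => radial (u t) x - radial (v t) x with hd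
  have hds : ∀ {t}, 0 < t → RaySmooth (d t) := fun ht => (hu.raySmooth ht).sub (hv.raySmooth ht)
  have hjoint : ContDiffOn ℝ (⊤ : ℕ∞) (fun p : ℝ × E3 => d p.1 p.2) (Set.Ioi 0 ×ˢ {0}ᶜ) :=
    hu.smooth.sub hv.smooth
  have ho : IsOpen (Set.Ioi (0 : ℝ) ×ˢ ({0}ᶜ : Set E3)) := isOpen_Ioi.prod isOpen_compl_zero
  have hder : ∀ {t}, 0 < t → ∀ σ : S2, HasDerivAt (fun s => d s σ) (rotLap (d t) σ) t := by
    intro t ht σ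
    have h1 := (hu.heat t ht σ).sub (hv.heat t ht σ)
    rw [SphSmooth.sphLaplacian_eq (hu.raySmooth ht).smooth,
      SphSmooth.sphLaplacian_eq (hv.raySmooth ht).smooth] at h1
    have e : rotLap (d t) σ = rotLap (radial (u t)) σ - rotLap (radial (v t)) σ := by
      simp only [rotLap, hd, ← Finset.sum_sub_distrib]
      refine Finset.sum_congr rfl fun i _ => ?_
      rw [show rot i (fun x => radial (u t) x - radial (v t) x) = fun x =>
        rot i (radial (u t)) x - rot i (radial (v t)) x from funext
          (rot_sub (hu.raySmooth ht).smooth (hv.raySmooth ht).smooth i),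
        rot_sub ((hu.raySmooth ht).rot i).smooth ((hv.raySmooth ht).rot i).smooth]
    rw [e]
    convert! h1 using 1
    funext s
    simp [hd, radial_sphere]
  -- Joint continuity of the Laplacian in (t, σ) is read off from the time derivative, which it
  -- equals by the heat equation and which is continuous by joint smoothness.
  have hlapc : ContinuousOn (fun p : ℝ × S2 => rotLap (d p.1) p.2) (Set.Ioi 0 ×ˢ Set.univ) := by
    have h1 : ContinuousOn (fun p : ℝ × E3 => fderiv ℝ (fun p : ℝ × E3 => d p.1 p.2) p (1, 0))
        (Set.Ioi 0 ×ˢ {0}ᶜ) :=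
      ((hjoint.fderiv_of_isOpen ho (m := 0) (by simp)).continuousOn).clm_apply continuousOn_const
    refine (continuousOn_sphere_time h1).congr fun p hp => ?_
    have hmem : (p.1, (p.2 : E3)) ∈ Set.Ioi (0 : ℝ) ×ˢ ({0}ᶜ : Set E3) :=
      ⟨hp.1, sphere_ne_zero p.2⟩
    have h2 := ((hjoint.contDiffAt (ho.mem_nhds hmem)).differentiableAt (by simp)).hasFDerivAt
    have h3 : HasDerivAt (fun s : ℝ => (s, (p.2 : E3))) (1, 0) p.1 :=
      (hasDerivAt_id _).prodMk (hasDerivAt_const _ _)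
    have h4 := h2.comp_hasDerivAt p.1 h3
    exact (hder hp.1 p.2).unique h4
  set E : ℝ → ℝ := fun t => ∫ σ : S2, Real.sqrt (1 + d t σ ^ 2) ∂surface with hE
  have hcd : ∀ {t}, 0 < t → Continuous fun σ : S2 => d t σ :=
    fun ht => (hds ht).smooth.continuous_sphere
  have hcs : ∀ {t}, 0 < t → Continuous fun σ : S2 => Real.sqrt (1 + d t σ ^ 2) := fun ht =>
    ((hcd ht).pow 2 |>.const_add 1).sqrt
  have hEd : ∀ t, 0 < t → HasDerivAt E
      (∫ σ : S2, d t σ / Real.sqrt (1 + d t σ ^ 2) * rotLap (d t) σ ∂surface) t := by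
    intro t ht
    have hK : IsCompact (Set.Icc (t / 2) (2 * t) ×ˢ (Set.univ : Set S2)) :=
      isCompact_Icc.prod isCompact_univ
    obtain ⟨C, hC⟩ := hK.exists_bound_of_continuousOn (hlapc.mono (Set.prod_mono
      (fun s hs => lt_of_lt_of_le (by positivity) hs.1) subset_rfl))
    have hn : Set.Icc (t / 2) (2 * t) ∈ 𝓝 t := Icc_mem_nhds (by linarith) (by linarith)
    refine (hasDerivAt_integral_of_dominated_loc_of_deriv_le (bound := fun _ => C)
      (F := fun t (σ : S2) => Real.sqrt (1 + d t σ ^ 2))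
      (F' := fun t (σ : S2) => d t σ / Real.sqrt (1 + d t σ ^ 2) * rotLap (d t) σ)
      hn ?_ ?_ ?_ ?_ ?_ ?_).2
    · filter_upwards [hn] with s hs
      exact (hcs (lt_of_lt_of_le (by positivity) hs.1)).aestronglyMeasurable
    · exact integrable_surface (hcs ht)
    · exact (((hcd ht).div (hcs ht) fun σ => (Real.sqrt_pos.2 (by positivity)).ne').mul
        (hds ht).rotLap.smooth.continuous_sphere).aestronglyMeasurable
    · refine Eventually.of_forall fun σ s hs => ?_
      have := hC (s, σ) ⟨hs, trivial⟩
      refine le_trans ?_ this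
      rw [norm_mul]
      refine mul_le_of_le_one_left (norm_nonneg _) ?_
      have hp : 0 < Real.sqrt (1 + d s σ ^ 2) := Real.sqrt_pos.2 (by positivity)
      rw [norm_div, Real.norm_of_nonneg hp.le, div_le_one hp, Real.norm_eq_abs]
      exact Real.abs_le_sqrt (by linarith)
    · exact integrable_const _
    · refine Eventually.of_forall fun σ s hs => ?_
      have hs0 : 0 < s := lt_of_lt_of_le (by positivity) hs.1
      exact HasDerivAt.comp (h₂ := fun s : ℝ => Real.sqrt (1 + s ^ 2)) s
        (hasDerivAt_sqrt_one_add_sq (d s σ)) (hder hs0 σ)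
  have hanti : AntitoneOn E (Set.Ioi 0) := by
    refine antitoneOn_of_deriv_nonpos (convex_Ioi 0)
      (fun s hs => (hEd s hs).continuousAt.continuousWithinAt) ?_ ?_
    · rw [interior_Ioi]
      exact fun s hs => (hEd s hs).differentiableAt.differentiableWithinAt
    · rw [interior_Ioi]
      intro s hs
      rw [(hEd s hs).deriv]
      exact integral_mul_rotLap_nonpos (hds hs)
  have hid : ∀ s, 0 < s → Integrable (fun σ : S2 => d s σ) surface :=
    fun s hs => integrable_surface (hcd hs)
  have hL1 : Tendsto (fun s => ∫ σ : S2, |d s σ| ∂surface) (𝓝[>] 0) (𝓝 0) := by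
    have h1 := hu.initial.add hv.initial
    rw [add_zero] at h1
    have h2 : ∀ᶠ s in 𝓝[>] (0 : ℝ), ∫⁻ σ : S2, ‖d s σ‖ₑ ∂surface ≤
        ∫⁻ σ, ‖u s σ - g σ‖ₑ ∂surface + ∫⁻ σ, ‖v s σ - g σ‖ₑ ∂surface := by
      filter_upwards [self_mem_nhdsWithin] with s hs
      have hm : AEMeasurable (fun σ => ‖u s σ - g σ‖ₑ) surface := by
        have hc := (hu.raySmooth hs).smooth.continuous_sphere
        simp_rw [radial_sphere] at hc
        exact (hc.aestronglyMeasurable.sub hu.integrable.1).enorm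
      rw [← lintegral_add_left' hm]
      refine lintegral_mono fun σ => ?_
      have : d s σ = (u s σ - g σ) - (v s σ - g σ) := by simp [hd, radial_sphere]
      rw [this]
      exact enorm_sub_le
    have h3 : Tendsto (fun s => ∫⁻ σ : S2, ‖d s σ‖ₑ ∂surface) (𝓝[>] 0) (𝓝 0) :=
      tendsto_of_tendsto_of_tendsto_of_le_of_le' tendsto_const_nhds h1
        (Eventually.of_forall fun _ => zero_le) h2
    have h4 := (ENNReal.tendsto_toReal ENNReal.zero_ne_top).comp h3
    refine Tendsto.congr' ?_ h4
    filter_upwards [self_mem_nhdsWithin] with s hs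
    simp only [Function.comp]
    rw [← integral_norm_eq_lintegral_enorm (hid s hs).1]
    rfl
  -- The integral at time t is at most the one at any earlier s, and √(1+d²) − 1 ≤ |d| bounds the
  -- latter by the L¹ norm, which tends to 0 with s.
  have hEt : ∫ σ : S2, (Real.sqrt (1 + d t σ ^ 2) - 1) ∂surface ≤ 0 := by
    refine ge_of_tendsto hL1 ?_
    filter_upwards [Ioo_mem_nhdsGT ht] with s hs
    have h1 := hanti hs.1 ht hs.2.le
    have h2 : ∫ σ : S2, (Real.sqrt (1 + d t σ ^ 2) - 1) ∂surface ≤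
        ∫ σ : S2, (Real.sqrt (1 + d s σ ^ 2) - 1) ∂surface := by
      rw [integral_sub (integrable_surface (hcs ht)) (integrable_const _),
        integral_sub (integrable_surface (hcs hs.1)) (integrable_const _)]
      exact sub_le_sub_right h1 _
    refine h2.trans (integral_mono ((integrable_surface (hcs hs.1)).sub (integrable_const _))
      (hid s hs.1).abs fun σ => ?_)
    simp only
    rw [sub_le_iff_le_add, Real.sqrt_le_left (by positivity)]
    nlinarith [sq_abs (d s σ), abs_nonneg (d s σ)]
  have hnn : ∀ σ : S2, 0 ≤ Real.sqrt (1 + d t σ ^ 2) - 1 := fun σ => by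
    rw [sub_nonneg, Real.one_le_sqrt]; nlinarith [sq_nonneg (d t σ)]
  have hz := (integral_eq_zero_iff_of_nonneg (μ := surface) hnn
    ((integrable_surface (hcs ht)).sub (integrable_const _))).1
    (le_antisymm hEt (integral_nonneg hnn))
  filter_upwards [hz] with σ hσ
  simp only [Pi.zero_apply] at hσ
  have h1 : Real.sqrt (1 + d t σ ^ 2) = 1 := by linarith
  rw [Real.sqrt_eq_one] at h1
  have h2 : d t σ = 0 := by
    have : d t σ ^ 2 = 0 := by linarith
    exact pow_eq_zero_iff (two_ne_zero) |>.1 this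
  simp only [hd, radial_sphere] at h2
  linarith

end KacBoltzmann
end

noncomputable section

namespace KacBoltzmann

/-! ### Shifted Legendre polynomials -/

/-- The coefficients of the shifted Legendre polynomials. -/
def legC (l k : ℕ) : ℝ := (-1) ^ (l + k) * (l.choose k) * ((l + k).choose k)

/-- The eigenvalues `l (l + 1)`. -/
def eigVal (l : ℕ) : ℝ := l * (l + 1)

theorem eigVal_nonneg (l : ℕ) : 0 ≤ eigVal l := by unfold eigVal; positivity

theorem legC_of_lt {l k : ℕ} (h : l < k) : legC l k = 0 := by
  simp [legC, Nat.choose_eq_zero_of_lt h]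

/-- This is the Legendre equation read coefficient by coefficient: the operator sends ξᵏ to k²ξᵏ⁻¹ −
k(k+1)ξᵏ. -/
theorem legC_succ (l k : ℕ) :
    ((k : ℝ) + 1) ^ 2 * legC l (k + 1) = (k * (k + 1) - eigVal l) * legC l k := by
  have h1 : (l.choose (k + 1) : ℝ) * (k + 1) = l.choose k * ((l : ℝ) - k) := by
    rcases le_or_gt k l with h | h
    · have := Nat.choose_succ_right_eq l k
      rw [← Nat.cast_sub h]; exact_mod_cast this
    · simp [Nat.choose_eq_zero_of_lt h, Nat.choose_eq_zero_of_lt (Nat.lt_succ_of_lt h)]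
  have h2 : ((l + k : ℝ) + 1) * (l + k).choose k = (l + (k + 1)).choose (k + 1) * (k + 1) := by
    have := Nat.add_one_mul_choose_eq (l + k) k
    exact_mod_cast this
  unfold legC eigVal
  rw [← add_assoc l k 1, pow_succ (-1 : ℝ)]
  rw [← add_assoc l k 1] at h2
  linear_combination (-(-1 : ℝ) ^ (l + k) * ((l + k + 1).choose (k + 1)) * (k + 1)) * h1 +
    ((-1 : ℝ) ^ (l + k) * (l.choose k) * (l - k)) * h2

theorem abs_legC_le (l k : ℕ) : |legC l k| ≤ 8 ^ l := by
  rcases lt_or_ge l k with h | h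
  · rw [legC_of_lt h]; simp
  have h1 : (l.choose k : ℝ) ≤ 2 ^ l := by exact_mod_cast Nat.choose_le_two_pow l k
  have h2 : ((l + k).choose k : ℝ) ≤ 2 ^ (2 * l) := by
    have h3 := Nat.choose_le_two_pow (l + k) k
    have h4 : 2 ^ (l + k) ≤ 2 ^ (2 * l) := Nat.pow_le_pow_right (by norm_num) (by omega)
    exact_mod_cast h3.trans h4
  calc |legC l k| = (l.choose k : ℝ) * ((l + k).choose k) := by
        simp [legC, abs_mul]
    _ ≤ 2 ^ l * 2 ^ (2 * l) := by gcongr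
    _ = 8 ^ l := by rw [pow_mul, ← mul_pow]; norm_num

/-- The coefficients of `x ^ n` in the basis of shifted Legendre polynomials. -/
def expC (n l : ℕ) : ℝ :=
  (2 * l + 1) * (n.factorial : ℝ) ^ 2 / ((n - l).factorial * (n + l + 1).factorial)

/-- Applying the Legendre operator to the expansion of the monomial of degree n+1 and comparing
coefficients of each eigenpolynomial gives this recursion in n. -/
theorem expC_succ {n l : ℕ} (h : l ≤ n) :
    expC (n + 1) l * (((n : ℝ) + 1) * (n + 2) - eigVal l) = ((n : ℝ) + 1) ^ 2 * expC n l := by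
  have e1 : n + 1 - l = (n - l) + 1 := by omega
  have e2 : n + 1 + l + 1 = (n + l + 1) + 1 := by omega
  unfold expC eigVal
  rw [e1, e2, Nat.factorial_succ (n - l), Nat.factorial_succ (n + l + 1), Nat.factorial_succ n]
  have e3 : (((n - l : ℕ) : ℝ)) = n - l := Nat.cast_sub h
  push_cast
  rw [e3]
  have f1 : (0 : ℝ) < (n - l).factorial := by exact_mod_cast Nat.factorial_pos _
  have f2 : (0 : ℝ) < (n + l + 1).factorial := by exact_mod_cast Nat.factorial_pos _
  have f3 : (0 : ℝ) < n - l + 1 := by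
    have : (l : ℝ) ≤ n := by exact_mod_cast h
    linarith
  field_simp
  ring

/-- The expansion of the monomials in the shifted Legendre polynomials. -/
theorem sum_expC_mul_legC (n k : ℕ) :
    ∑ l ∈ Finset.range (n + 1), expC n l * legC l k = if n = k then 1 else 0 := by
  have hgt : ∀ n k, n < k → ∑ l ∈ Finset.range (n + 1), expC n l * legC l k = 0 := by
    intro n k h
    refine Finset.sum_eq_zero fun l hl => ?_
    rw [legC_of_lt (by rw [Finset.mem_range] at hl; omega), mul_zero]
  have hdiag : ∀ n, ∑ l ∈ Finset.range (n + 1), expC n l * legC l n = 1 := by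
    intro n
    rw [Finset.sum_eq_single n]
    · have h := Nat.add_choose_mul_factorial_mul_factorial n n
      have h' : ((n + n).choose n : ℝ) * n.factorial * n.factorial = (n + n).factorial := by
        exact_mod_cast h
      simp only [expC, legC, Nat.sub_self, Nat.factorial_zero, Nat.choose_self, Nat.factorial_succ]
      rw [← two_mul, pow_mul]
      have f1 : (0 : ℝ) < (2 * n).factorial := by exact_mod_cast Nat.factorial_pos _
      rw [← two_mul] at h'
      push_cast
      field_simp
      simp only [one_pow]
      linear_combination h'
    · intro l hl hne
      rw [legC_of_lt (by rw [Finset.mem_range] at hl; omega), mul_zero]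
    · simp
  induction n generalizing k with
  | zero =>
    rcases Nat.eq_zero_or_pos k with h | h
    · subst h; simpa using hdiag 0
    · rw [if_neg (by omega)]; exact hgt 0 k h
  | succ n ih =>
    -- The recursions of `expC` in n and of `legC` in k combine into a relation between the sums at
    -- k and k+1. The top index n+1 drops out by the eigenvalue equation.
    have hrec : ∀ k, ((n + 1 : ℝ) * (n + 2) - k * (k + 1)) *
        (∑ l ∈ Finset.range (n + 2), expC (n + 1) l * legC l k) +
        ((k : ℝ) + 1) ^ 2 * (∑ l ∈ Finset.range (n + 2), expC (n + 1) l * legC l (k + 1)) =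
        ((n : ℝ) + 1) ^ 2 * if n = k then 1 else 0 := by
      intro k
      rw [← ih k, Finset.mul_sum, Finset.mul_sum, ← Finset.sum_add_distrib, Finset.sum_range_succ,
        Finset.mul_sum]
      have hlast : ((n + 1 : ℝ) * (n + 2) - k * (k + 1)) * (expC (n + 1) (n + 1) * legC (n + 1) k) +
          ((k : ℝ) + 1) ^ 2 * (expC (n + 1) (n + 1) * legC (n + 1) (k + 1)) = 0 := by
        have := legC_succ (n + 1) k
        simp only [eigVal] at this
        push_cast at this
        linear_combination expC (n + 1) (n + 1) * this
      rw [hlast, add_zero]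
      refine Finset.sum_congr rfl fun l hl => ?_
      have hl' : l ≤ n := by rw [Finset.mem_range] at hl; omega
      linear_combination legC l k * expC_succ hl' + expC (n + 1) l * legC_succ l k
    -- Descending from k = n, the relation determines the sum at k, because (n+1)(n+2) − k(k+1) does
    -- not vanish for k ≤ n.
    have hlow : ∀ j k, k + j = n → ∑ l ∈ Finset.range (n + 2), expC (n + 1) l * legC l k = 0 := by
      intro j
      induction j with
      | zero =>
        intro k hk
        have hk' : k = n := by omega
        subst hk'
        have h := hrec k
        have hd := hdiag (k + 1)
        rw [hd, if_pos rfl] at h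
        have hne : ((k + 1 : ℝ) * (k + 2) - k * (k + 1)) ≠ 0 := by
          have : (0 : ℝ) < (k + 1 : ℝ) * (k + 2) - k * (k + 1) := by ring_nf; positivity
          exact this.ne'
        exact (mul_eq_zero.1 (by linarith : _ * _ = (0 : ℝ))).resolve_left hne
      | succ j ihj =>
        intro k hk
        have h := hrec k
        rw [ihj (k + 1) (by omega), if_neg (by omega), mul_zero, mul_zero, add_zero] at h
        have hkn : (k : ℝ) + 1 ≤ n := by exact_mod_cast (by omega : k + 1 ≤ n)
        have hk0 : (0 : ℝ) ≤ k := Nat.cast_nonneg k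
        have hne : ((n + 1 : ℝ) * (n + 2) - k * (k + 1)) ≠ 0 := by
          have : (0 : ℝ) < (n + 1 : ℝ) * (n + 2) - k * (k + 1) := by nlinarith
          exact this.ne'
        exact (mul_eq_zero.1 h).resolve_left hne
    rcases lt_trichotomy k (n + 1) with h | h | h
    · rw [if_neg (by omega)]; exact hlow (n - k) k (by omega)
    · subst h; rw [if_pos rfl]; exact hdiag (n + 1)
    · rw [if_neg (by omega)]; exact hgt (n + 1) k h

/-- The heat flow started from `x ^ n`: the coefficient of `x ^ k` at time `t`. -/
def deathProb (n k : ℕ) (t : ℝ) : ℝ :=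
  ∑ l ∈ Finset.range (n + 1), expC n l * Real.exp (-eigVal l * t) * legC l k

theorem hasDerivAt_deathProb (n k : ℕ) (t : ℝ) :
    HasDerivAt (deathProb n k)
      (((k : ℝ) + 1) ^ 2 * deathProb n (k + 1) t - k * (k + 1) * deathProb n k t) t := by
  have h : ∀ l ∈ Finset.range (n + 1), HasDerivAt
      (fun t => expC n l * Real.exp (-eigVal l * t) * legC l k)
      (expC n l * (Real.exp (-eigVal l * t) * -eigVal l) * legC l k) t := by
    intro l _
    have h1 : HasDerivAt (fun t : ℝ => -eigVal l * t) (-eigVal l) t := by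
      simpa using (hasDerivAt_id t).const_mul (-eigVal l)
    exact (h1.exp.const_mul _).mul_const _
  have h2 := HasDerivAt.fun_sum h
  convert! h2 using 1
  simp only [deathProb, Finset.mul_sum, ← Finset.sum_sub_distrib]
  refine Finset.sum_congr rfl fun l _ => ?_
  linear_combination expC n l * Real.exp (-eigVal l * t) * legC_succ l k

/-- The coefficients solve the system of a death process. Descending in k from k > n, where they
vanish, each equation has a non-negative source. The initial values are Kronecker deltas by
`sum_expC_mul_legC`. -/
theorem deathProb_nonneg (n k : ℕ) {t : ℝ} (ht : 0 ≤ t) : 0 ≤ deathProb n k t := by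
  have hbig : ∀ k t, n < k → deathProb n k t = 0 := by
    intro k t hk
    refine Finset.sum_eq_zero fun l hl => ?_
    rw [legC_of_lt (by rw [Finset.mem_range] at hl; omega), mul_zero]
  have key : ∀ j k, n + 1 ≤ k + j → ∀ t, 0 ≤ t → 0 ≤ deathProb n k t := by
    intro j
    induction j with
    | zero => intro k hk t _; rw [hbig k t (by omega)]
    | succ j ih =>
      intro k hk t ht
      -- The integrating factor removes the loss term −k(k+1), leaving the source (k+1)² times the
      -- next coefficient.
      have hd : ∀ s, HasDerivAt (fun s => Real.exp (k * (k + 1) * s) * deathProb n k s)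
          (Real.exp (k * (k + 1) * s) * (((k : ℝ) + 1) ^ 2 * deathProb n (k + 1) s)) s := by
        intro s
        have h1 : HasDerivAt (fun s : ℝ => (k * (k + 1) : ℝ) * s) (k * (k + 1)) s := by
          simpa using (hasDerivAt_id s).const_mul (k * (k + 1) : ℝ)
        have h2 := h1.exp.mul (hasDerivAt_deathProb n k s)
        convert! h2 using 1
        ring
      have hmono : MonotoneOn (fun s => Real.exp (k * (k + 1) * s) * deathProb n k s)
          (Set.Ici 0) := by
        refine monotoneOn_of_deriv_nonneg (convex_Ici 0)
          (fun s _ => (hd s).continuousAt.continuousWithinAt)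
          (fun s _ => (hd s).differentiableAt.differentiableWithinAt) fun s hs => ?_
        rw [interior_Ici] at hs
        rw [(hd s).deriv]
        have := ih (k + 1) (by omega) s (le_of_lt hs)
        positivity
      have h0 := hmono (Set.mem_Ici.2 le_rfl) (Set.mem_Ici.2 ht) ht
      have h00 : 0 ≤ deathProb n k 0 := by
        have := sum_expC_mul_legC n k
        simp only [deathProb, mul_zero, Real.exp_zero, mul_one]
        rw [this]; split_ifs <;> norm_num
      simp only [mul_zero, Real.exp_zero, one_mul] at h0
      exact nonneg_of_mul_nonneg_right (h00.trans h0) (Real.exp_pos _)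
  exact key (n + 1) k (by omega) t ht

theorem expC_nonneg (n l : ℕ) : 0 ≤ expC n l := by unfold expC; positivity

/-- The ratio of the normalized coefficients to `2 l + 1`. -/
theorem succ_mul_expC {n l : ℕ} (h : l ≤ n) :
    ((n : ℝ) + 1) * expC n l =
      (2 * l + 1) * ∏ i ∈ Finset.range l, (((n : ℝ) - i) / (n + i + 2)) := by
  induction l with
  | zero =>
    simp only [expC, Nat.factorial_succ, Nat.sub_zero, Finset.range_zero, Finset.prod_empty]
    have f1 : (0 : ℝ) < n.factorial := by exact_mod_cast Nat.factorial_pos _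
    push_cast
    field_simp
  | succ l ih =>
    have ih := ih (by omega)
    rw [Finset.prod_range_succ, ← mul_assoc]
    have e1 : n - l = (n - (l + 1)) + 1 := by omega
    have hr : expC n (l + 1) * (2 * l + 1) * (n + l + 2) = expC n l * (2 * (l + 1 : ℕ) + 1) * (n - l) := by
      have e2 : n + (l + 1) + 1 = (n + l + 1) + 1 := by omega
      unfold expC
      rw [e1, e2, Nat.factorial_succ (n - (l + 1)), Nat.factorial_succ (n + l + 1)]
      have e3 : (((n - (l + 1) : ℕ) : ℝ)) = n - (l + 1) := by
        rw [Nat.cast_sub h]; push_cast; ring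
      push_cast
      rw [e3]
      have f1 : (0 : ℝ) < (n - (l + 1)).factorial := by exact_mod_cast Nat.factorial_pos _
      have f2 : (0 : ℝ) < (n + l + 1).factorial := by exact_mod_cast Nat.factorial_pos _
      have f3 : (0 : ℝ) < n - (l + 1) + 1 := by
        have : (l : ℝ) + 1 ≤ n := by exact_mod_cast h
        linarith
      field_simp
      ring
    have p1 : (0 : ℝ) < 2 * l + 1 := by positivity
    have p2 : (0 : ℝ) < n + l + 2 := by positivity
    rw [mul_div_assoc', eq_div_iff p2.ne']
    apply mul_right_cancel₀ p1.ne'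
    linear_combination ((n : ℝ) + 1) * hr + ((2 * (l + 1 : ℕ) + 1) * ((n : ℝ) - l)) * ih

theorem succ_mul_expC_le {n l : ℕ} (h : l ≤ n) : ((n : ℝ) + 1) * expC n l ≤ 2 * l + 1 := by
  rw [succ_mul_expC h]
  refine mul_le_of_le_one_right (by positivity) (Finset.prod_le_one (fun i hi => ?_) fun i hi => ?_)
  · have : (i : ℝ) ≤ n := by
      rw [Finset.mem_range] at hi; exact_mod_cast (by omega : i ≤ n)
    exact div_nonneg (by linarith) (by positivity)
  · rw [div_le_one (by positivity)]
    have : (0 : ℝ) ≤ i := Nat.cast_nonneg i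
    linarith

/-- The functions (n+1)ξⁿ concentrate at ξ = 1, where every Legendre polynomial equals one, so their
coefficients tend to those of a point mass. -/
theorem tendsto_succ_mul_expC (l : ℕ) :
    Tendsto (fun n : ℕ => ((n : ℝ) + 1) * expC n l) atTop (𝓝 (2 * l + 1)) := by
  have h1 : Tendsto (fun n : ℕ => (2 * (l : ℝ) + 1) *
      ∏ i ∈ Finset.range l, (((n : ℝ) - i) / (n + i + 2))) atTop (𝓝 ((2 * l + 1) * 1)) := by
    refine Tendsto.const_mul _ ?_
    have : (1 : ℝ) = ∏ i ∈ Finset.range l, (1 : ℝ) := by simp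
    rw [this]
    refine tendsto_finsetProd _ fun i _ => ?_
    have h2 : Tendsto (fun n : ℕ => 1 - (2 * i + 2 : ℝ) / (n + i + 2)) atTop (𝓝 (1 - 0)) := by
      refine tendsto_const_nhds.sub (Tendsto.div_atTop tendsto_const_nhds ?_)
      exact tendsto_atTop_add_const_right _ _ (tendsto_atTop_add_const_right _ _
        tendsto_natCast_atTop_atTop)
    rw [sub_zero] at h2
    refine h2.congr fun n => ?_
    have : (0 : ℝ) < n + i + 2 := by positivity
    field_simp
    ring
  rw [mul_one] at h1
  refine h1.congr' ?_
  filter_upwards [eventually_ge_atTop l] with n hn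
  rw [succ_mul_expC hn]

end KacBoltzmann
end

noncomputable section

namespace KacBoltzmann

/-! ### Heat series `∑ e^{-l(l+1)t} P_l(ξ)` -/

/-- Consecutive ratios are |B|e^{−2t(l+1)}, so the quadratic exponent beats every geometric growth.
Very crude bounds on polynomial coefficients are therefore enough. -/
theorem summable_pow_mul_exp (B : ℝ) {t : ℝ} (ht : 0 < t) :
    Summable fun l : ℕ => B ^ l * Real.exp (-eigVal l * t) := by
  by_cases hB : B = 0
  · subst hB
    refine summable_of_ne_finset_zero (s := {0}) fun l hl => ?_
    rw [Finset.mem_singleton] at hl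
    rw [zero_pow hl, zero_mul]
  refine summable_of_ratio_test_tendsto_lt_one (l := 0) one_pos (Eventually.of_forall fun l =>
    mul_ne_zero (pow_ne_zero _ hB) (Real.exp_pos _).ne') ?_
  have h : ∀ l : ℕ, ‖B ^ (l + 1) * Real.exp (-eigVal (l + 1) * t)‖ /
      ‖B ^ l * Real.exp (-eigVal l * t)‖ = |B| * Real.exp (-(2 * t * (l + 1))) := by
    intro l
    have e : Real.exp (-eigVal (l + 1) * t) =
        Real.exp (-eigVal l * t) * Real.exp (-(2 * t * (l + 1))) := by
      rw [← Real.exp_add]; congr 1; simp only [eigVal]; push_cast; ring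
    rw [e, pow_succ]
    simp only [norm_mul, norm_pow, Real.norm_eq_abs, Real.abs_exp]
    have : |B| ≠ 0 := abs_ne_zero.2 hB
    field_simp
  simp_rw [h]
  have h2 : Tendsto (fun l : ℕ => Real.exp (-(2 * t * ((l : ℝ) + 1)))) atTop (𝓝 0) := by
    refine Real.tendsto_exp_neg_atTop_nhds_zero.comp ?_
    exact (tendsto_atTop_add_const_right _ _ tendsto_natCast_atTop_atTop).const_mul_atTop
      (by positivity)
  simpa using h2.const_mul |B|

/-- Sequences of polynomials with `deg P_l ≤ l` and coefficients of at most exponential growth. -/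
def PolyGrowth (P : ℕ → Polynomial ℝ) : Prop :=
  ∃ C B : ℝ, 0 ≤ C ∧ 1 ≤ B ∧ ∀ l, (P l).natDegree ≤ l ∧ ∀ k, |(P l).coeff k| ≤ C * B ^ l

theorem PolyGrowth.eval_le {P : ℕ → Polynomial ℝ} (hP : PolyGrowth P) (R : ℝ) :
    ∃ C B : ℝ, 0 ≤ C ∧ 1 ≤ B ∧ ∀ l ξ, |ξ| ≤ R → |(P l).eval ξ| ≤ C * B ^ l := by
  obtain ⟨C, B, hC, hB, h⟩ := hP
  refine ⟨C, 2 * B * max 1 R, hC, ?_, fun l ξ hξ => ?_⟩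
  · nlinarith [le_max_left 1 R]
  have hR : (1 : ℝ) ≤ max 1 R := le_max_left _ _
  have hξR : |ξ| ≤ max 1 R := hξ.trans (le_max_right _ _)
  rw [Polynomial.eval_eq_sum_range' (Nat.lt_succ_of_le (h l).1)]
  calc |∑ k ∈ Finset.range (l + 1), (P l).coeff k * ξ ^ k|
      ≤ ∑ k ∈ Finset.range (l + 1), |(P l).coeff k * ξ ^ k| := Finset.abs_sum_le_sum_abs _ _
    _ ≤ ∑ k ∈ Finset.range (l + 1), C * B ^ l * max 1 R ^ l := by
        refine Finset.sum_le_sum fun k hk => ?_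
        rw [abs_mul, abs_pow]
        have hkl : k ≤ l := by rw [Finset.mem_range] at hk; omega
        have : |ξ| ^ k ≤ max 1 R ^ l :=
          (pow_le_pow_left₀ (abs_nonneg _) hξR k).trans (pow_le_pow_right₀ hR hkl)
        exact mul_le_mul ((h l).2 k) this (by positivity) (by positivity)
    _ = (l + 1) * (C * B ^ l * max 1 R ^ l) := by simp
    _ ≤ 2 ^ l * (C * B ^ l * max 1 R ^ l) := by
        gcongr
        exact_mod_cast Nat.lt_two_pow_self
    _ = C * (2 * B * max 1 R) ^ l := by rw [mul_pow, mul_pow]; ring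

theorem PolyGrowth.derivative {P : ℕ → Polynomial ℝ} (hP : PolyGrowth P) :
    PolyGrowth fun l => (P l).derivative := by
  obtain ⟨C, B, hC, hB, h⟩ := hP
  refine ⟨C, 2 * B, hC, by linarith, fun l => ⟨(Polynomial.natDegree_derivative_le _).trans
    ((Nat.sub_le _ _).trans (h l).1), fun k => ?_⟩⟩
  rw [Polynomial.coeff_derivative]
  rcases le_or_gt l k with hk | hk
  · rw [Polynomial.coeff_eq_zero_of_natDegree_lt (lt_of_le_of_lt (h l).1 (Nat.lt_succ_of_le hk)),
      zero_mul, abs_zero]; positivity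
  · rw [abs_mul, mul_pow]
    have h1 : |((k : ℝ) + 1)| ≤ 2 ^ l := by
      rw [abs_of_nonneg (by positivity)]
      exact_mod_cast (Nat.succ_le_of_lt hk).trans Nat.lt_two_pow_self.le
    calc |(P l).coeff (k + 1)| * |(k : ℝ) + 1| ≤ (C * B ^ l) * 2 ^ l :=
          mul_le_mul ((h l).2 _) h1 (abs_nonneg _) (by positivity)
      _ = C * (2 ^ l * B ^ l) := by ring

theorem eigVal_le_pow (l : ℕ) : eigVal l ≤ 4 ^ l := by
  have h1 : (l : ℝ) ≤ 2 ^ l := by exact_mod_cast Nat.lt_two_pow_self.le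
  have h2 : (l : ℝ) + 1 ≤ 2 ^ l := by exact_mod_cast Nat.lt_two_pow_self
  calc eigVal l ≤ 2 ^ l * 2 ^ l := mul_le_mul h1 h2 (by positivity) (by positivity)
    _ = 4 ^ l := by rw [← mul_pow]; norm_num

theorem PolyGrowth.eigVal_smul {P : ℕ → Polynomial ℝ} (hP : PolyGrowth P) :
    PolyGrowth fun l => (-eigVal l) • P l := by
  obtain ⟨C, B, hC, hB, h⟩ := hP
  refine ⟨C, 4 * B, hC, by linarith, fun l => ⟨(Polynomial.natDegree_smul_le _ _).trans (h l).1,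
    fun k => ?_⟩⟩
  rw [Polynomial.coeff_smul, smul_eq_mul, abs_mul, abs_neg, abs_of_nonneg (eigVal_nonneg l),
    mul_pow]
  calc eigVal l * |(P l).coeff k| ≤ 4 ^ l * (C * B ^ l) :=
        mul_le_mul (eigVal_le_pow l) ((h l).2 k) (abs_nonneg _) (by positivity)
    _ = C * (4 ^ l * B ^ l) := by ring

/-- The series `∑ e^{-l(l+1)t} P_l(ξ)`. -/
def heatSeries (P : ℕ → Polynomial ℝ) (p : ℝ × ℝ) : ℝ :=
  ∑' l, Real.exp (-eigVal l * p.1) * (P l).eval p.2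

theorem PolyGrowth.term_le {P : ℕ → Polynomial ℝ} (hP : PolyGrowth P) {t₀ : ℝ} (ht₀ : 0 < t₀)
    (R : ℝ) : ∃ v : ℕ → ℝ, Summable v ∧ ∀ l t ξ, t₀ ≤ t → |ξ| ≤ R →
      |Real.exp (-eigVal l * t) * (P l).eval ξ| ≤ v l := by
  obtain ⟨C, B, hC, hB, h⟩ := hP.eval_le R
  refine ⟨fun l => C * (B ^ l * Real.exp (-eigVal l * t₀)),
    (summable_pow_mul_exp B ht₀).mul_left C, fun l t ξ ht hξ => ?_⟩
  rw [abs_mul, Real.abs_exp]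
  have h1 : Real.exp (-eigVal l * t) ≤ Real.exp (-eigVal l * t₀) := by
    rw [Real.exp_le_exp]; nlinarith [eigVal_nonneg l]
  calc Real.exp (-eigVal l * t) * |(P l).eval ξ| ≤ Real.exp (-eigVal l * t₀) * (C * B ^ l) :=
        mul_le_mul h1 (h l ξ hξ) (abs_nonneg _) (Real.exp_pos _).le
    _ = _ := by ring

theorem PolyGrowth.summable {P : ℕ → Polynomial ℝ} (hP : PolyGrowth P) {t : ℝ} (ht : 0 < t)
    (ξ : ℝ) : Summable fun l => Real.exp (-eigVal l * t) * (P l).eval ξ := by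
  obtain ⟨v, hv, h⟩ := hP.term_le ht |ξ|
  exact Summable.of_norm_bounded hv fun l => h l t ξ le_rfl le_rfl

theorem PolyGrowth.hasFDerivAt {P : ℕ → Polynomial ℝ} (hP : PolyGrowth P) {p : ℝ × ℝ}
    (hp : 0 < p.1) : HasFDerivAt (heatSeries P)
      (heatSeries (fun l => (-eigVal l) • P l) p • ContinuousLinearMap.fst ℝ ℝ ℝ +
        heatSeries (fun l => (P l).derivative) p • ContinuousLinearMap.snd ℝ ℝ ℝ) p := by
  obtain ⟨v, hv, h1⟩ := hP.eigVal_smul.term_le (half_pos hp) (|p.2| + 1)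
  obtain ⟨w, hw, h2⟩ := hP.derivative.term_le (half_pos hp) (|p.2| + 1)
  set s : Set (ℝ × ℝ) := Set.Ioi (p.1 / 2) ×ˢ Set.Ioo (-(|p.2| + 1)) (|p.2| + 1) with hs
  have hso : IsOpen s := isOpen_Ioi.prod isOpen_Ioo
  have hsc : IsPreconnected s := ((convex_Ioi _).prod (convex_Ioo _ _)).isPreconnected
  have hps : p ∈ s := by
    refine ⟨?_, ?_, ?_⟩
    · simp only [Set.mem_Ioi]; linarith
    · linarith [neg_abs_le p.2]
    · linarith [le_abs_self p.2]
  set f' : ℕ → ℝ × ℝ → (ℝ × ℝ →L[ℝ] ℝ) := fun l q =>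
    (Real.exp (-eigVal l * q.1) * ((-eigVal l) • P l).eval q.2) • ContinuousLinearMap.fst ℝ ℝ ℝ +
    (Real.exp (-eigVal l * q.1) * (P l).derivative.eval q.2) • ContinuousLinearMap.snd ℝ ℝ ℝ
    with hf'
  have key := hasFDerivAt_tsum_of_isPreconnected (𝕜 := ℝ)
    (f := fun l (q : ℝ × ℝ) => Real.exp (-eigVal l * q.1) * (P l).eval q.2)
    (f' := f') (hv.add hw) hso hsc ?_ ?_ hps (hP.summable hp p.2) hps
  · convert! key using 1
    have e1 := (hP.eigVal_smul.summable hp p.2)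
    have e2 := (hP.derivative.summable hp p.2)
    have hs1 := e1.hasSum.smul_const (ContinuousLinearMap.fst ℝ ℝ ℝ)
    have hs2 := e2.hasSum.smul_const (ContinuousLinearMap.snd ℝ ℝ ℝ)
    exact (hs1.add hs2).tsum_eq.symm
  · intro l q hq
    have d1 : HasFDerivAt (fun q : ℝ × ℝ => Real.exp (-eigVal l * q.1))
        (Real.exp (-eigVal l * q.1) • (-eigVal l) • ContinuousLinearMap.fst ℝ ℝ ℝ) q :=
      (hasFDerivAt_fst.const_mul (-eigVal l)).exp
    have d2 : HasFDerivAt (fun q : ℝ × ℝ => (P l).eval q.2)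
        ((P l).derivative.eval q.2 • ContinuousLinearMap.snd ℝ ℝ ℝ) q :=
      ((P l).hasDerivAt q.2).comp_hasFDerivAt q hasFDerivAt_snd
    have d3 := d1.mul d2
    convert! d3 using 1
    ext <;> simp [hf'] <;> ring
  · intro l q hq
    have hq2 : |q.2| ≤ |p.2| + 1 := abs_le.2 ⟨hq.2.1.le, hq.2.2.le⟩
    refine (norm_add_le _ _).trans (add_le_add ?_ ?_)
    · rw [norm_smul, Real.norm_eq_abs]
      refine (mul_le_of_le_one_right (abs_nonneg _) (ContinuousLinearMap.norm_fst_le ..)).trans ?_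
      exact h1 l q.1 q.2 (le_of_lt hq.1) hq2
    · rw [norm_smul, Real.norm_eq_abs]
      refine (mul_le_of_le_one_right (abs_nonneg _) (ContinuousLinearMap.norm_snd_le ..)).trans ?_
      exact h2 l q.1 q.2 (le_of_lt hq.1) hq2

/-- Both partial derivatives of such a series are series of the same kind, because the growth
condition is stable under differentiation and under multiplication by eigenvalues. Induction on the
order then gives smoothness. -/
theorem PolyGrowth.contDiffOn {P : ℕ → Polynomial ℝ} (hP : PolyGrowth P) :
    ContDiffOn ℝ (⊤ : ℕ∞) (heatSeries P) (Set.Ioi 0 ×ˢ Set.univ) := by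
  have ho : IsOpen (Set.Ioi (0 : ℝ) ×ˢ (Set.univ : Set ℝ)) := isOpen_Ioi.prod isOpen_univ
  have key : ∀ n : ℕ, ∀ {P : ℕ → Polynomial ℝ}, PolyGrowth P →
      ContDiffOn ℝ n (heatSeries P) (Set.Ioi 0 ×ˢ Set.univ) := by
    intro n
    induction n with
    | zero =>
      intro P hP
      rw [Nat.cast_zero, contDiffOn_zero]
      exact fun p hp => (hP.hasFDerivAt hp.1).continuousAt.continuousWithinAt
    | succ n ih =>
      intro P hP
      have : ((n + 1 : ℕ) : WithTop ℕ∞) = (n : WithTop ℕ∞) + 1 := by norm_cast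
      rw [this, contDiffOn_succ_iff_fderiv_of_isOpen ho]
      refine ⟨fun p hp => (hP.hasFDerivAt hp.1).differentiableAt.differentiableWithinAt,
        by simp, ?_⟩
      refine ContDiffOn.congr ?_ fun p hp => (hP.hasFDerivAt hp.1).fderiv
      exact ((ih hP.eigVal_smul).smul contDiffOn_const).add
        ((ih hP.derivative).smul contDiffOn_const)
  rw [contDiffOn_infty]
  exact fun n => key n hP

/-- The normalized shifted Legendre polynomials `(2 l + 1) P_l`. -/
def legPoly (l : ℕ) : Polynomial ℝ :=
  ∑ k ∈ Finset.range (l + 1), Polynomial.monomial k ((2 * l + 1) * legC l k)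

theorem coeff_legPoly (l k : ℕ) : (legPoly l).coeff k = (2 * l + 1) * legC l k := by
  simp only [legPoly, Polynomial.finsetSum_coeff, Polynomial.coeff_monomial]
  rw [Finset.sum_ite_eq']
  split_ifs with h
  · rfl
  · rw [legC_of_lt (by rw [Finset.mem_range] at h; omega), mul_zero]

theorem natDegree_legPoly_le (l : ℕ) : (legPoly l).natDegree ≤ l := by
  rw [Polynomial.natDegree_le_iff_coeff_eq_zero]
  intro k hk
  rw [coeff_legPoly, legC_of_lt hk, mul_zero]

theorem two_mul_add_one_le (l : ℕ) : (2 * (l : ℝ) + 1) ≤ 4 ^ l := by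
  have h2 : (l : ℝ) + 1 ≤ 2 ^ l := by exact_mod_cast Nat.lt_two_pow_self
  have h3 : (4 : ℝ) ^ l = 2 ^ l * 2 ^ l := by rw [← mul_pow]; norm_num
  have h0 : (0 : ℝ) ≤ l := Nat.cast_nonneg l
  rw [h3]; nlinarith

theorem polyGrowth_legPoly : PolyGrowth legPoly := by
  refine ⟨1, 32, by norm_num, by norm_num, fun l => ⟨natDegree_legPoly_le l, fun k => ?_⟩⟩
  rw [coeff_legPoly, abs_mul, abs_of_nonneg (by positivity : (0 : ℝ) ≤ 2 * l + 1), one_mul]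
  calc (2 * (l : ℝ) + 1) * |legC l k| ≤ 4 ^ l * 8 ^ l :=
        mul_le_mul (two_mul_add_one_le l) (abs_legC_le l k) (abs_nonneg _) (by positivity)
    _ = 32 ^ l := by rw [← mul_pow]; norm_num

/-- The Legendre operator `ξ(1-ξ) P'' + (1-2ξ) P'`. -/
def legOp (P : Polynomial ℝ) : Polynomial ℝ :=
  (Polynomial.X - Polynomial.X ^ 2) * P.derivative.derivative +
    (1 - 2 * Polynomial.X) * P.derivative

theorem legOp_legPoly (l : ℕ) : legOp (legPoly l) = (-eigVal l) • legPoly l := by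
  ext k
  have h := legC_succ l k
  have e : legOp (legPoly l) = (legPoly l).derivative.derivative * Polynomial.X -
      (legPoly l).derivative.derivative * Polynomial.X * Polynomial.X +
      (legPoly l).derivative - (2 : ℝ) • ((legPoly l).derivative * Polynomial.X) := by
    rw [legOp, Polynomial.smul_eq_C_mul]
    simp only [map_ofNat]
    ring
  rw [e]
  simp only [Polynomial.coeff_add, Polynomial.coeff_sub, Polynomial.coeff_smul, smul_eq_mul]
  rcases k with _ | _ | k
  · simp [Polynomial.coeff_derivative, coeff_legPoly] at h ⊢
    linear_combination (2 * (l : ℝ) + 1) * h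
  · rw [Polynomial.coeff_mul_X, Polynomial.coeff_mul_X, Polynomial.coeff_mul_X]
    simp [Polynomial.coeff_derivative, coeff_legPoly] at h ⊢
    linear_combination (2 * (l : ℝ) + 1) * h
  · rw [Polynomial.coeff_mul_X, Polynomial.coeff_mul_X, Polynomial.coeff_mul_X,
      Polynomial.coeff_mul_X]
    simp only [Polynomial.coeff_derivative, coeff_legPoly] at h ⊢
    push_cast at h ⊢
    linear_combination (2 * (l : ℝ) + 1) * h

end KacBoltzmann
end

noncomputable section

namespace KacBoltzmann

/-! ### The zonal heat kernel -/

/-- The zonal heat kernel, as a function of time and of `ξ = (1 + x · y) / 2`, normalized to have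
mean one. -/
def heatKer (t ξ : ℝ) : ℝ := heatSeries legPoly (t, ξ)

/-- The derivative of the heat kernel in `ξ`. -/
def heatKer' (t ξ : ℝ) : ℝ := heatSeries (fun l => (legPoly l).derivative) (t, ξ)

/-- The second derivative of the heat kernel in `ξ`. -/
def heatKer'' (t ξ : ℝ) : ℝ := heatSeries (fun l => (legPoly l).derivative.derivative) (t, ξ)

/-- The derivative of the heat kernel in time. -/
def heatKerDot (t ξ : ℝ) : ℝ := heatSeries (fun l => (-eigVal l) • legPoly l) (t, ξ)

theorem PolyGrowth.hasDerivAt_snd {P : ℕ → Polynomial ℝ} (hP : PolyGrowth P) {t : ℝ} (ht : 0 < t)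
    (ξ : ℝ) : HasDerivAt (fun ξ => heatSeries P (t, ξ))
      (heatSeries (fun l => (P l).derivative) (t, ξ)) ξ := by
  have h := (hP.hasFDerivAt (p := (t, ξ)) ht).comp_hasDerivAt ξ
    ((hasDerivAt_const ξ t).prodMk (hasDerivAt_id ξ))
  simpa [Function.comp_def] using h

theorem PolyGrowth.hasDerivAt_fst {P : ℕ → Polynomial ℝ} (hP : PolyGrowth P) {t : ℝ} (ht : 0 < t)
    (ξ : ℝ) : HasDerivAt (fun t => heatSeries P (t, ξ))
      (heatSeries (fun l => (-eigVal l) • P l) (t, ξ)) t := by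
  have h := (hP.hasFDerivAt (p := (t, ξ)) ht).comp_hasDerivAt t
    ((hasDerivAt_id t).prodMk (hasDerivAt_const t ξ))
  simpa [Function.comp_def] using h

theorem hasDerivAt_heatKer {t : ℝ} (ht : 0 < t) (ξ : ℝ) :
    HasDerivAt (heatKer t) (heatKer' t ξ) ξ := polyGrowth_legPoly.hasDerivAt_snd ht ξ

theorem hasDerivAt_heatKer' {t : ℝ} (ht : 0 < t) (ξ : ℝ) :
    HasDerivAt (heatKer' t) (heatKer'' t ξ) ξ := polyGrowth_legPoly.derivative.hasDerivAt_snd ht ξ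

theorem hasDerivAt_heatKer_time {t : ℝ} (ht : 0 < t) (ξ : ℝ) :
    HasDerivAt (fun t => heatKer t ξ) (heatKerDot t ξ) t := polyGrowth_legPoly.hasDerivAt_fst ht ξ

theorem heatKerDot_eq {t : ℝ} (ht : 0 < t) (ξ : ℝ) :
    heatKerDot t ξ = (ξ - ξ ^ 2) * heatKer'' t ξ + (1 - 2 * ξ) * heatKer' t ξ := by
  have h1 := (polyGrowth_legPoly.derivative.derivative.summable ht ξ).hasSum.mul_left (ξ - ξ ^ 2)
  have h2 := (polyGrowth_legPoly.derivative.summable ht ξ).hasSum.mul_left (1 - 2 * ξ)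
  refine (polyGrowth_legPoly.eigVal_smul.summable ht ξ).hasSum.unique ?_
  convert! h1.add h2 using 1
  funext l
  rw [← legOp_legPoly]
  simp [legOp]
  ring

theorem contDiffOn_heatKer : ContDiffOn ℝ (⊤ : ℕ∞) (fun p : ℝ × ℝ => heatKer p.1 p.2)
    (Set.Ioi 0 ×ˢ Set.univ) := polyGrowth_legPoly.contDiffOn

theorem contDiffOn_heatKer' : ContDiffOn ℝ (⊤ : ℕ∞) (fun p : ℝ × ℝ => heatKer' p.1 p.2)
    (Set.Ioi 0 ×ˢ Set.univ) := polyGrowth_legPoly.derivative.contDiffOn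

theorem contDiffOn_heatKerDot : ContDiffOn ℝ (⊤ : ℕ∞) (fun p : ℝ × ℝ => heatKerDot p.1 p.2)
    (Set.Ioi 0 ×ˢ Set.univ) := polyGrowth_legPoly.eigVal_smul.contDiffOn

/-! ### Taylor coefficients of the heat kernel -/

/-- The constant polynomials given by the `k`-th coefficients of the Legendre polynomials. -/
def coefPoly (k l : ℕ) : Polynomial ℝ := Polynomial.C ((2 * l + 1) * legC l k)

theorem polyGrowth_coefPoly (k : ℕ) : PolyGrowth (coefPoly k) := by
  obtain ⟨C, B, hC, hB, h⟩ := polyGrowth_legPoly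
  refine ⟨C, B, hC, hB, fun l => ⟨by rw [coefPoly, Polynomial.natDegree_C]; exact Nat.zero_le _, fun j => ?_⟩⟩
  simp only [coefPoly, Polynomial.coeff_C]
  split_ifs
  · rw [← coeff_legPoly]; exact (h l).2 k
  · rw [abs_zero]; positivity

/-- The coefficient of `ξ ^ k` in the heat kernel. -/
def heatCoef (k : ℕ) (t : ℝ) : ℝ := heatSeries (coefPoly k) (t, 0)

theorem heatCoef_eq (k : ℕ) (t : ℝ) :
    heatCoef k t = ∑' l : ℕ, Real.exp (-eigVal l * t) * ((2 * l + 1) * legC l k) := by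
  simp [heatCoef, heatSeries, coefPoly]

theorem hasSum_heatCoef (k : ℕ) {t : ℝ} (ht : 0 < t) :
    HasSum (fun l : ℕ => Real.exp (-eigVal l * t) * ((2 * l + 1) * legC l k)) (heatCoef k t) := by
  have := ((polyGrowth_coefPoly k).summable ht 0).hasSum
  simpa [coefPoly, heatCoef, heatSeries] using this

/-- The Taylor coefficients of the kernel obey the same equations as the death process, since both
come from `legC_succ`. -/
theorem hasDerivAt_heatCoef (k : ℕ) {t : ℝ} (ht : 0 < t) :
    HasDerivAt (heatCoef k)
      (((k : ℝ) + 1) ^ 2 * heatCoef (k + 1) t - k * (k + 1) * heatCoef k t) t := by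
  have h := (polyGrowth_coefPoly k).hasDerivAt_fst ht 0
  convert! h using 1
  have h1 := ((hasSum_heatCoef (k + 1) ht).mul_left (((k : ℝ) + 1) ^ 2)).sub
    ((hasSum_heatCoef k ht).mul_left ((k : ℝ) * (k + 1)))
  rw [← h1.tsum_eq, heatSeries]
  refine tsum_congr fun l => ?_
  simp only [coefPoly, Polynomial.eval_smul, Polynomial.eval_C, smul_eq_mul]
  linear_combination (Real.exp (-eigVal l * t) * (2 * l + 1)) * legC_succ l k

/-- The coefficient is the limit of n+1 times the coefficient of the flow started from ξⁿ, which is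
non-negative. The limit passes through the series by domination, from the bound 2l+1 on the
normalized `expC`. -/
theorem heatCoef_nonneg (k : ℕ) {t : ℝ} (ht : 0 < t) : 0 ≤ heatCoef k t := by
  obtain ⟨v, hv, h⟩ := (polyGrowth_coefPoly k).term_le ht 0
  have hlim : Tendsto (fun n : ℕ => ∑' l, if l ≤ n then ((n : ℝ) + 1) * expC n l *
      Real.exp (-eigVal l * t) * legC l k else 0) atTop
      (𝓝 (∑' l : ℕ, Real.exp (-eigVal l * t) * ((2 * l + 1) * legC l k))) := by
    refine tendsto_tsum_of_dominated_convergence hv (fun l => ?_)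
      (Eventually.of_forall fun n l => ?_)
    · have h1 := ((tendsto_succ_mul_expC l).mul_const (Real.exp (-eigVal l * t))).mul_const
        (legC l k)
      have h2 : Tendsto (fun n : ℕ => ((n : ℝ) + 1) * expC n l * Real.exp (-eigVal l * t) *
          legC l k) atTop (𝓝 (Real.exp (-eigVal l * t) * ((2 * l + 1) * legC l k))) := by
        convert h1 using 2; ring
      refine h2.congr' ?_
      filter_upwards [eventually_ge_atTop l] with n hn
      rw [if_pos hn]
    · split_ifs with hln
      · have h3 := h l t 0 le_rfl (by simp)
        simp only [coefPoly, Polynomial.eval_C] at h3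
        refine le_trans ?_ h3
        rw [Real.norm_eq_abs, abs_mul, abs_mul, abs_mul _ (_ * legC l k), abs_mul _ (legC l k),
          Real.abs_exp, abs_of_nonneg (mul_nonneg (by positivity) (expC_nonneg n l)),
          abs_of_nonneg (by positivity : (0 : ℝ) ≤ 2 * l + 1)]
        have h4 := succ_mul_expC_le hln
        calc ((n : ℝ) + 1) * expC n l * Real.exp (-eigVal l * t) * |legC l k|
            ≤ (2 * l + 1) * Real.exp (-eigVal l * t) * |legC l k| := by gcongr
          _ = _ := by ring
      · rw [norm_zero]
        exact (abs_nonneg _).trans (h l t 0 le_rfl (by simp))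
  rw [heatCoef_eq]
  refine ge_of_tendsto hlim (Eventually.of_forall fun n => ?_)
  have : ∑' l, (if l ≤ n then ((n : ℝ) + 1) * expC n l * Real.exp (-eigVal l * t) * legC l k
      else 0) = ((n : ℝ) + 1) * deathProb n k t := by
    rw [tsum_eq_sum (s := Finset.range (n + 1)), deathProb, Finset.mul_sum]
    · refine Finset.sum_congr rfl fun l hl => ?_
      rw [if_pos (by rw [Finset.mem_range] at hl; omega)]; ring
    · intro l hl
      rw [if_neg (by rw [Finset.mem_range] at hl; omega)]
  rw [this]
  exact mul_nonneg (by positivity) (deathProb_nonneg n k ht.le)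

/-- The double series over degree and power converges absolutely on 0 ≤ ξ ≤ 1, so it may be summed
by powers instead of by eigenvalues. -/
theorem hasSum_heatKer {t : ℝ} (ht : 0 < t) {ξ : ℝ} (h0 : 0 ≤ ξ) (h1 : ξ ≤ 1) :
    HasSum (fun k => heatCoef k t * ξ ^ k) (heatKer t ξ) := by
  set f : ℕ → ℕ → ℝ := fun l k => Real.exp (-eigVal l * t) * ((2 * l + 1) * legC l k) * ξ ^ k
    with hf
  have hfz : ∀ l k, k ∉ Finset.range (l + 1) → f l k = 0 := by
    intro l k hk
    simp only [hf]
    rw [legC_of_lt (by rw [Finset.mem_range] at hk; omega), mul_zero, mul_zero, zero_mul]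
  have hfb : ∀ l k, ‖f l k‖ ≤ 32 ^ l * Real.exp (-eigVal l * t) := by
    intro l k
    simp only [hf, norm_mul, norm_pow, Real.norm_eq_abs, Real.abs_exp]
    rw [abs_of_nonneg h0, abs_of_nonneg (by positivity : (0 : ℝ) ≤ 2 * l + 1)]
    have h3 : (2 * (l : ℝ) + 1) * |legC l k| ≤ 32 ^ l := by
      calc (2 * (l : ℝ) + 1) * |legC l k| ≤ 4 ^ l * 8 ^ l :=
            mul_le_mul (two_mul_add_one_le l) (abs_legC_le l k) (abs_nonneg _) (by positivity)
        _ = 32 ^ l := by rw [← mul_pow]; norm_num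
    calc Real.exp (-eigVal l * t) * ((2 * l + 1) * |legC l k|) * ξ ^ k
        ≤ Real.exp (-eigVal l * t) * 32 ^ l * 1 := by
          gcongr
          exact pow_le_one₀ h0 h1
      _ = _ := by ring
  have hinner : ∀ l, HasSum (f l) (Real.exp (-eigVal l * t) * (legPoly l).eval ξ) := by
    intro l
    have : Real.exp (-eigVal l * t) * (legPoly l).eval ξ = ∑ k ∈ Finset.range (l + 1), f l k := by
      rw [Polynomial.eval_eq_sum_range' (Nat.lt_succ_of_le (natDegree_legPoly_le l)),
        Finset.mul_sum]
      refine Finset.sum_congr rfl fun k _ => ?_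
      rw [coeff_legPoly]; simp only [hf]; ring
    rw [this]
    exact hasSum_sum_of_ne_finset_zero (hfz l)
  have hsum : Summable (Function.uncurry f) := by
    refine Summable.of_norm ?_
    rw [summable_prod_of_nonneg (fun _ => norm_nonneg _)]
    refine ⟨fun l => summable_of_ne_finset_zero (s := Finset.range (l + 1)) fun k hk => ?_, ?_⟩
    · simp [Function.uncurry, hfz l k hk]
    · refine Summable.of_nonneg_of_le (fun l => tsum_nonneg fun k => norm_nonneg _) (fun l => ?_)
        (summable_pow_mul_exp (2 * 32) ht)
      rw [tsum_eq_sum (s := Finset.range (l + 1)) fun k hk => by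
        simp [Function.uncurry, hfz l k hk]]
      calc ∑ k ∈ Finset.range (l + 1), ‖Function.uncurry f (l, k)‖
          ≤ ∑ k ∈ Finset.range (l + 1), 32 ^ l * Real.exp (-eigVal l * t) :=
            Finset.sum_le_sum fun k _ => hfb l k
        _ = (l + 1) * (32 ^ l * Real.exp (-eigVal l * t)) := by simp
        _ ≤ 2 ^ l * (32 ^ l * Real.exp (-eigVal l * t)) := by
            gcongr
            exact_mod_cast Nat.lt_two_pow_self
        _ = _ := by rw [mul_pow]; ring
  have h2 : ∀ k, HasSum (fun l => f l k) (heatCoef k t * ξ ^ k) := fun k =>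
    (hasSum_heatCoef k ht).mul_right (ξ ^ k)
  have hA := hsum.hasSum.prod_fiberwise (f := Function.uncurry f) hinner
  have hsum' : Summable (Function.uncurry fun k l => f l k) := hsum.prod_symm
  have hB := hsum'.hasSum.prod_fiberwise (f := Function.uncurry fun k l => f l k) h2
  have hAB : ∑' p, Function.uncurry f p = ∑' p, Function.uncurry (fun k l => f l k) p :=
    ((Equiv.prodComm ℕ ℕ).tsum_eq (Function.uncurry f)).symm
  rw [← hAB, ← hA.tsum_eq] at hB
  exact hB

theorem heatCoef_zero_le {t : ℝ} (ht : 0 < t) {ξ : ℝ} (h0 : 0 ≤ ξ) (h1 : ξ ≤ 1) :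
    heatCoef 0 t ≤ heatKer t ξ := by
  have h := (hasSum_heatKer ht h0 h1)
  have := le_hasSum h 0 fun k _ => mul_nonneg (heatCoef_nonneg k ht) (pow_nonneg h0 k)
  simpa using this

theorem heatKer_nonneg {t : ℝ} (ht : 0 < t) {ξ : ℝ} (h0 : 0 ≤ ξ) (h1 : ξ ≤ 1) :
    0 ≤ heatKer t ξ := (heatCoef_nonneg 0 ht).trans (heatCoef_zero_le ht h0 h1)

/-- If the heat kernel is not positive at some time, it vanishes at an earlier time. -/
theorem heatCoef_zero_pos_or {t : ℝ} (ht : 0 < t) :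
    0 < heatCoef 0 t ∨ ∃ s, 0 < s ∧ ∀ ξ, 0 ≤ ξ → ξ ≤ 1 → heatKer s ξ = 0 := by
  by_contra! hcon
  obtain ⟨h1, h2⟩ := hcon
  -- The derivative of the zeroth coefficient is the first coefficient, hence non-negative.
  have hmono : MonotoneOn (heatCoef 0) (Set.Ioi 0) := by
    refine monotoneOn_of_deriv_nonneg (convex_Ioi 0)
      (fun s hs => (hasDerivAt_heatCoef 0 hs).continuousAt.continuousWithinAt)
      (fun s hs => ?_) fun s hs => ?_
    · rw [interior_Ioi] at hs
      exact (hasDerivAt_heatCoef 0 hs).differentiableAt.differentiableWithinAt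
    · rw [interior_Ioi] at hs
      rw [(hasDerivAt_heatCoef 0 hs).deriv]
      have := heatCoef_nonneg 1 hs
      simpa using this
  -- If the zeroth coefficient vanishes on an interval, so does its derivative. The equations then
  -- force each next coefficient to vanish there as well.
  have hz : ∀ k, ∀ s ∈ Set.Ioo 0 t, heatCoef k s = 0 := by
    intro k
    induction k with
    | zero =>
      intro s hs
      exact le_antisymm ((hmono hs.1 ht hs.2.le).trans h1) (heatCoef_nonneg 0 hs.1)
    | succ k ih =>
      intro s hs
      have hev : heatCoef k =ᶠ[𝓝 s] fun _ => 0 := by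
        filter_upwards [isOpen_Ioo.mem_nhds hs] with r hr using ih r hr
      have hd := (hasDerivAt_heatCoef k hs.1).unique
        ((hasDerivAt_const s (0 : ℝ)).congr_of_eventuallyEq hev)
      rw [ih s hs, mul_zero, sub_zero] at hd
      have : ((k : ℝ) + 1) ^ 2 ≠ 0 := by positivity
      exact (mul_eq_zero.1 hd).resolve_left this
  obtain ⟨ξ, hξ0, hξ1, hne⟩ := h2 (t / 2) (by positivity)
  have h := hasSum_heatKer (half_pos ht) hξ0 hξ1
  have hs : t / 2 ∈ Set.Ioo 0 t := ⟨by positivity, by linarith⟩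
  simp only [hz _ _ hs, zero_mul] at h
  exact hne (h.unique hasSum_zero)

/-! ### Zonal functions -/

/-- The variable `(1 + x · y) / 2`. -/
def zonal (x y : E3) : ℝ := (1 + inner ℝ x y) / 2

theorem zonal_comm (x y : E3) : zonal x y = zonal y x := by simp [zonal, real_inner_comm]

theorem contDiff_zonal : ContDiff ℝ (⊤ : ℕ∞) (fun p : E3 × E3 => zonal p.1 p.2) := by
  unfold zonal
  exact (contDiff_const.add (contDiff_fst.inner ℝ contDiff_snd)).div_const 2

theorem continuous_zonal : Continuous (fun p : E3 × E3 => zonal p.1 p.2) := contDiff_zonal.continuous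

theorem hasFDerivAt_zonal (x y : E3) : HasFDerivAt (fun x => zonal x y)
    ((1 / 2 : ℝ) • innerSL ℝ y) x := by
  have h : HasFDerivAt (fun x => inner ℝ y x) (innerSL ℝ y) x := (innerSL ℝ y).hasFDerivAt
  have h2 := (h.const_add 1).const_mul (1 / 2 : ℝ)
  refine h2.congr_of_eventuallyEq (Eventually.of_forall fun x => ?_)
  simp [zonal, real_inner_comm]; ring

theorem rot_zonal {φ : ℝ → ℝ} {φ' : ℝ} (i : Fin 3) {x y : E3}
    (hφ : HasDerivAt φ φ' (zonal x y)) :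
    rot i (fun x => φ (zonal x y)) x = φ' * (inner ℝ y (rotGen i x) / 2) := by
  have := hφ.comp_hasFDerivAt x (hasFDerivAt_zonal x y)
  simp only [rot]
  rw [show (fun x => φ (zonal x y)) = φ ∘ fun x => zonal x y from rfl, this.fderiv]
  simp only [smul_apply, smul_eq_mul, innerSL_apply_apply]
  ring

theorem zonal_mem {x y : E3} (hx : ‖x‖ = 1) (hy : ‖y‖ = 1) : 0 ≤ zonal x y ∧ zonal x y ≤ 1 := by
  have := abs_real_inner_le_norm x y
  rw [hx, hy, mul_one, abs_le] at this
  constructor <;> simp only [zonal] <;> linarith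

theorem sum_inner_rotGen_sq (x y : E3) (hx : ‖x‖ = 1) (hy : ‖y‖ = 1) :
    ∑ i, (inner ℝ y (rotGen i x) / 2) ^ 2 = zonal x y - zonal x y ^ 2 := by
  have hx' := EuclideanSpace.norm_sq_eq x
  have hy' := EuclideanSpace.norm_sq_eq y
  rw [hx] at hx'; rw [hy] at hy'
  simp [Fin.sum_univ_three] at hx' hy'
  simp [zonal, rotGen_apply, PiLp.inner_apply, Fin.sum_univ_three]
  linear_combination (-(1 : ℝ) / 4) * hx' + (-(1 : ℝ) / 4 * (x 0 ^ 2 + x 1 ^ 2 + x 2 ^ 2)) * hy'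

theorem sum_inner_rotGen_rotGen (x y : E3) :
    ∑ i, inner ℝ y (rotGen i (rotGen i x)) / 2 = 1 - 2 * zonal x y := by
  simp [zonal, rotGen_apply, PiLp.inner_apply, Fin.sum_univ_three]
  ring

/-- The Laplacian of a zonal function. -/
theorem rotLap_zonal {φ φ' φ'' : ℝ → ℝ} (h1 : ∀ s, HasDerivAt φ (φ' s) s)
    (h2 : ∀ s, HasDerivAt φ' (φ'' s) s) {x y : E3} (hx : ‖x‖ = 1) (hy : ‖y‖ = 1) :
    rotLap (fun x => φ (zonal x y)) x =
      (zonal x y - zonal x y ^ 2) * φ'' (zonal x y) + (1 - 2 * zonal x y) * φ' (zonal x y) := by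
  have hr : ∀ i, rot i (rot i (fun x => φ (zonal x y))) x =
      φ'' (zonal x y) * (inner ℝ y (rotGen i x) / 2) ^ 2 +
      φ' (zonal x y) * (inner ℝ y (rotGen i (rotGen i x)) / 2) := by
    intro i
    have e : rot i (fun x => φ (zonal x y)) =
        fun x => φ' (zonal x y) * (inner ℝ y (rotGen i x) / 2) :=
      funext fun x => rot_zonal i (h1 _)
    have d1 := (h2 (zonal x y)).comp_hasFDerivAt x (hasFDerivAt_zonal x y)
    have d2 : HasFDerivAt (fun x => inner ℝ y (rotGen i x) / 2)
        ((1 / 2 : ℝ) • (innerSL ℝ y).comp (rotGen i)) x := by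
      have h := (((innerSL ℝ y).comp (rotGen i)).hasFDerivAt (x := x)).const_mul (1 / 2 : ℝ)
      refine h.congr_of_eventuallyEq (Eventually.of_forall fun x => ?_)
      simp; ring
    have d3 := d1.mul d2
    rw [e, rot]
    have d4 : HasFDerivAt (fun x => φ' (zonal x y) * (inner ℝ y (rotGen i x) / 2)) _ x := d3
    rw [d4.fderiv]
    simp
    ring
  simp only [rotLap, hr]
  rw [Finset.sum_add_distrib, ← Finset.mul_sum, ← Finset.mul_sum, sum_inner_rotGen_sq x y hx hy,
    sum_inner_rotGen_rotGen]
  ring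

end KacBoltzmann
end

noncomputable section

namespace KacBoltzmann

/-! ### Moments of the heat kernel -/

theorem rotLap_comp_unitDir {F : E3 → ℝ} (hF : SmoothAway F) {x : E3} (hx : x ≠ 0) :
    rotLap (fun x => F (unitDir x)) x = rotLap F (unitDir x) := by
  simp only [rotLap]
  refine Finset.sum_congr rfl fun i _ => ?_
  rw [rot_congr (fun y hy => rot_comp_unitDir hF i hy), rot_comp_unitDir (hF.rot i) i hx]

theorem contDiff_eval_zonal (p : Polynomial ℝ) (x : E3) :
    ContDiff ℝ (⊤ : ℕ∞) (fun y => p.eval (zonal y x)) :=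
  (p.contDiff_aeval (𝕜 := ℝ) _).comp (contDiff_zonal.comp (contDiff_id.prodMk contDiff_const))

theorem rotLap_eval_zonal (p : Polynomial ℝ) {x y : E3} (hx : ‖x‖ = 1) (hy : ‖y‖ = 1) :
    rotLap (fun y => p.eval (zonal y x)) y = (legOp p).eval (zonal y x) := by
  rw [rotLap_zonal (φ := fun s => p.eval s) p.hasDerivAt p.derivative.hasDerivAt hy hx]
  simp [legOp]

/-- Zonal functions intertwine the Legendre operator with the Laplacian on the sphere, so symmetry
of the Laplacian transfers to polynomials. All moments below follow from this, without parametrizing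
the sphere. -/
theorem integral_legOp_mul (p r : Polynomial ℝ) {x : E3} (hx : ‖x‖ = 1) :
    ∫ σ : S2, (legOp p).eval (zonal σ x) * r.eval (zonal σ x) ∂surface =
      ∫ σ : S2, p.eval (zonal σ x) * (legOp r).eval (zonal σ x) ∂surface := by
  have hs : ∀ p : Polynomial ℝ, SmoothAway (fun y => p.eval (zonal y x)) :=
    fun p => (contDiff_eval_zonal p x).contDiffOn
  have h := integral_mul_rotLap_comm (hs p).comp_unitDir (hs r).comp_unitDir
  simp_rw [rotLap_comp_unitDir (hs _) (sphere_ne_zero _), unitDir_sphere,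
    rotLap_eval_zonal _ hx (sphere_norm _)] at h
  exact h.symm

theorem integral_legOp (p : Polynomial ℝ) {x : E3} (hx : ‖x‖ = 1) :
    ∫ σ : S2, (legOp p).eval (zonal σ x) ∂surface = 0 := by
  have := integral_legOp_mul p 1 hx
  simpa [legOp] using this

/-- The area of the sphere. -/
def area : ℝ := surface.real Set.univ

theorem area_pos : 0 < area := by
  rw [area, measureReal_def]
  refine ENNReal.toReal_pos ?_ (measure_ne_top _ _)
  rw [Ne, Measure.measure_univ_eq_zero]
  exact surface_ne_zero

theorem continuous_eval_zonal (p : Polynomial ℝ) (x : E3) :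
    Continuous fun σ : S2 => p.eval (zonal σ x) :=
  (contDiff_eval_zonal p x).continuous.comp continuous_subtype_val

theorem integral_legPoly {l : ℕ} (hl : l ≠ 0) {x : E3} (hx : ‖x‖ = 1) :
    ∫ σ : S2, (legPoly l).eval (zonal σ x) ∂surface = 0 := by
  have h := integral_legOp (legPoly l) hx
  rw [legOp_legPoly] at h
  simp only [Polynomial.eval_smul, smul_eq_mul] at h
  rw [integral_const_mul] at h
  have : eigVal l ≠ 0 := by
    have : (0 : ℝ) < l := by exact_mod_cast Nat.pos_of_ne_zero hl
    unfold eigVal; positivity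
  exact (mul_eq_zero.1 h).resolve_left (neg_ne_zero.2 this)

theorem legPoly_zero : legPoly 0 = 1 := by
  simp [legPoly, legC]

theorem legPoly_one : legPoly 1 = 6 * Polynomial.X - 3 := by
  ext k
  rw [coeff_legPoly]
  rcases k with _ | _ | k
  · simp [legC]; norm_num
  · simp [legC, Polynomial.coeff_X, Polynomial.coeff_ofNat_succ]; norm_num
  · rw [legC_of_lt (by omega)]
    simp [Polynomial.coeff_X, Polynomial.coeff_ofNat_succ]

/-- The function 1 − ξ lies in the span of the modes with eigenvalues 0 and 2. Symmetry makes the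
integral a solution of (λ − 2)I = 0 with λ > 2. -/
theorem integral_legPoly_mul {l : ℕ} (hl : 2 ≤ l) {x : E3} (hx : ‖x‖ = 1) :
    ∫ σ : S2, (legPoly l).eval (zonal σ x) * (1 - zonal σ x) ∂surface = 0 := by
  have h := integral_legOp_mul (legPoly l) (1 - Polynomial.X) hx
  have e : legOp (1 - Polynomial.X : Polynomial ℝ) = 1 - 2 * (1 - Polynomial.X) := by
    simp [legOp]; ring
  rw [e, legOp_legPoly] at h
  have hc := continuous_eval_zonal (legPoly l) x
  have hc2 := continuous_eval_zonal (1 - Polynomial.X) x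
  simp only [Polynomial.eval_smul, smul_eq_mul, Polynomial.eval_sub, Polynomial.eval_one,
    Polynomial.eval_X, Polynomial.eval_mul, Polynomial.eval_ofNat] at h hc2
  have h1 : ∫ σ : S2, (legPoly l).eval (zonal σ x) * (1 - 2 * (1 - zonal σ x)) ∂surface =
      ∫ σ : S2, (legPoly l).eval (zonal σ x) ∂surface -
      2 * ∫ σ : S2, (legPoly l).eval (zonal σ x) * (1 - zonal σ x) ∂surface := by
    have hi : Integrable (fun σ : S2 => (legPoly l).eval (zonal σ x) * (1 - zonal σ x)) surface :=
      integrable_surface (hc.mul hc2)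
    rw [← integral_const_mul, ← integral_sub (integrable_surface hc) (hi.const_mul 2)]
    exact integral_congr_ae (Eventually.of_forall fun σ => by ring)
  rw [h1, integral_legPoly (by omega) hx] at h
  simp_rw [mul_assoc] at h
  rw [integral_const_mul] at h
  have hl' : (2 : ℝ) ≤ l := by exact_mod_cast hl
  have hne : eigVal l - 2 ≠ 0 := by
    have : 0 < eigVal l - 2 := by unfold eigVal; nlinarith
    exact this.ne'
  exact (mul_eq_zero.1 (by linarith :
    (eigVal l - 2) * ∫ σ : S2, (legPoly l).eval (zonal σ x) * (1 - zonal σ x) ∂surface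
      = 0)).resolve_left hne

theorem integral_zonal {x : E3} (hx : ‖x‖ = 1) :
    ∫ σ : S2, zonal σ x ∂surface = area / 2 ∧ ∫ σ : S2, zonal σ x ^ 2 ∂surface = area / 3 := by
  have c1 := continuous_eval_zonal Polynomial.X x
  have c2 := continuous_eval_zonal (Polynomial.X ^ 2) x
  simp only [Polynomial.eval_X, Polynomial.eval_pow] at c1 c2
  have h1 := integral_legOp Polynomial.X hx
  have h2 := integral_legOp (Polynomial.X ^ 2) hx
  have e1 : legOp (Polynomial.X : Polynomial ℝ) = 1 - 2 * Polynomial.X := by simp [legOp]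
  have e2 : legOp (Polynomial.X ^ 2 : Polynomial ℝ) = 4 * Polynomial.X - 6 * Polynomial.X ^ 2 := by
    simp [legOp]; ring
  rw [e1] at h1; rw [e2] at h2
  simp only [Polynomial.eval_sub, Polynomial.eval_one, Polynomial.eval_mul, Polynomial.eval_ofNat,
    Polynomial.eval_X, Polynomial.eval_pow] at h1 h2
  rw [integral_sub (integrable_const _) ((integrable_surface c1).const_mul 2), integral_const_mul,
    integral_const, smul_eq_mul, mul_one] at h1
  rw [integral_sub ((integrable_surface c1).const_mul 4) ((integrable_surface c2).const_mul 6),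
    integral_const_mul, integral_const_mul] at h2
  have : surface.real Set.univ = area := rfl
  constructor <;> linarith

theorem hasSum_integral_heatKer_mul {t : ℝ} (ht : 0 < t) {x : E3} (hx : ‖x‖ = 1)
    {w : S2 → ℝ} (hw : Continuous w) :
    HasSum (fun l => ∫ σ : S2, Real.exp (-eigVal l * t) * (legPoly l).eval (zonal σ x) * w σ ∂surface)
      (∫ σ : S2, heatKer t (zonal σ x) * w σ ∂surface) := by
  obtain ⟨v, hv, hb⟩ := polyGrowth_legPoly.term_le ht 1
  obtain ⟨C, hC⟩ := isCompact_univ.exists_bound_of_continuousOn (hw.continuousOn (s := Set.univ))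
  have hb' : ∀ l (σ : S2), ‖Real.exp (-eigVal l * t) * (legPoly l).eval (zonal σ x) * w σ‖ ≤
      v l * C := by
    intro l σ
    obtain ⟨h0, h1⟩ := zonal_mem (sphere_norm σ) hx
    rw [norm_mul]
    exact mul_le_mul (hb l t _ le_rfl (abs_le.2 ⟨by linarith, h1⟩)) (hC σ trivial) (norm_nonneg _)
      ((abs_nonneg _).trans (hb l t _ le_rfl (abs_le.2 ⟨by linarith, h1⟩)))
  have hc : ∀ l, Continuous fun σ : S2 =>
      Real.exp (-eigVal l * t) * (legPoly l).eval (zonal σ x) * w σ := fun l =>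
    (continuous_const.mul (continuous_eval_zonal _ x)).mul hw
  refine hasSum_integral_of_dominated_convergence (fun l _ => v l * C)
    (fun l => (hc l).aestronglyMeasurable) (fun l => Eventually.of_forall (hb' l))
    (Eventually.of_forall fun _ => hv.mul_right C) (integrable_const _)
    (Eventually.of_forall fun σ => ?_)
  exact (polyGrowth_legPoly.summable ht _).hasSum.mul_right (w σ)

theorem integral_heatKer {t : ℝ} (ht : 0 < t) {x : E3} (hx : ‖x‖ = 1) :
    ∫ σ : S2, heatKer t (zonal σ x) ∂surface = area := by
  have h := hasSum_integral_heatKer_mul ht hx (w := fun _ => 1) continuous_const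
  simp only [mul_one] at h
  refine h.unique ?_
  have : area = ∫ σ : S2, Real.exp (-eigVal 0 * t) * (legPoly 0).eval (zonal σ x) ∂surface := by
    simp [legPoly_zero, eigVal, area]
  rw [this]
  refine hasSum_single 0 fun l hl => ?_
  rw [integral_const_mul, integral_legPoly hl hx, mul_zero]

/-- Only the modes l = 0 and l = 1 contribute. As 1 − ξ is a quarter of the squared distance, this
is the second moment that makes the kernel concentrate on the diagonal as t → 0. -/
theorem integral_heatKer_mul_one_sub {t : ℝ} (ht : 0 < t) {x : E3} (hx : ‖x‖ = 1) :
    ∫ σ : S2, heatKer t (zonal σ x) * (1 - zonal σ x) ∂surface =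
      area / 2 * (1 - Real.exp (-2 * t)) := by
  have c1 := continuous_eval_zonal Polynomial.X x
  have c2 := continuous_eval_zonal (Polynomial.X ^ 2) x
  simp only [Polynomial.eval_X, Polynomial.eval_pow] at c1 c2
  have h := hasSum_integral_heatKer_mul ht hx (w := fun σ => 1 - zonal σ x)
    (continuous_const.sub c1)
  refine h.unique ?_
  obtain ⟨i1, i2⟩ := integral_zonal hx
  have hA : surface.real Set.univ = area := rfl
  have e0 : ∫ σ : S2, Real.exp (-eigVal 0 * t) * (legPoly 0).eval (zonal σ x) * (1 - zonal σ x)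
      ∂surface = area / 2 := by
    simp only [legPoly_zero, eigVal, Polynomial.eval_one, mul_one]
    simp only [Nat.cast_zero, zero_mul, neg_zero, Real.exp_zero, one_mul]
    rw [integral_sub (integrable_const _) (integrable_surface c1), i1, integral_const]
    simp only [smul_eq_mul, mul_one, hA]; ring
  have e1 : ∫ σ : S2, Real.exp (-eigVal 1 * t) * (legPoly 1).eval (zonal σ x) * (1 - zonal σ x)
      ∂surface = -(area / 2) * Real.exp (-2 * t) := by
    simp_rw [mul_assoc]
    rw [integral_const_mul]
    have : ∫ σ : S2, (legPoly 1).eval (zonal σ x) * (1 - zonal σ x) ∂surface =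
        ∫ σ : S2, (9 * zonal σ x - (6 * zonal σ x ^ 2 + 3)) ∂surface := by
      refine integral_congr_ae (Eventually.of_forall fun σ => ?_)
      simp only [legPoly_one, Polynomial.eval_sub, Polynomial.eval_mul, Polynomial.eval_ofNat,
        Polynomial.eval_X]
      ring
    have hi : Integrable (fun σ : S2 => 6 * zonal σ x ^ 2 + 3) surface :=
      ((integrable_surface c2).const_mul 6).add (integrable_const _)
    rw [this, integral_sub ((integrable_surface c1).const_mul 9) hi, integral_const_mul,
      integral_add ((integrable_surface c2).const_mul 6) (integrable_const _), integral_const_mul,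
      i1, i2, integral_const]
    simp only [smul_eq_mul, hA, eigVal]
    push_cast
    norm_num
    ring
  have hs : HasSum (fun l => ∫ σ : S2, Real.exp (-eigVal l * t) *
      (legPoly l).eval (zonal σ x) * (1 - zonal σ x) ∂surface) (∑ l ∈ Finset.range 2,
        ∫ σ : S2, Real.exp (-eigVal l * t) * (legPoly l).eval (zonal σ x) *
          (1 - zonal σ x) ∂surface) := by
    refine hasSum_sum_of_ne_finset_zero fun l hl => ?_
    simp_rw [mul_assoc]
    rw [integral_const_mul, integral_legPoly_mul (by rw [Finset.mem_range] at hl; omega) hx,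
      mul_zero]
  rw [Finset.sum_range_succ, Finset.sum_range_one, e0, e1] at hs
  convert hs using 1
  ring

/-- A vanishing zeroth coefficient would make the whole kernel vanish at an earlier time,
contradicting that its total mass is the positive area of the sphere. -/
theorem heatKer_pos {t : ℝ} (ht : 0 < t) {ξ : ℝ} (h0 : 0 ≤ ξ) (h1 : ξ ≤ 1) : 0 < heatKer t ξ := by
  rcases heatCoef_zero_pos_or ht with h | ⟨s, hs, hz⟩
  · exact h.trans_le (heatCoef_zero_le ht h0 h1)
  · exfalso
    have hx : ‖(EuclideanSpace.single 0 1 : E3)‖ = 1 := by simp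
    have h := integral_heatKer hs hx
    have : ∀ σ : S2, heatKer s (zonal σ (EuclideanSpace.single 0 1)) = 0 := fun σ =>
      hz _ (zonal_mem (sphere_norm σ) hx).1 (zonal_mem (sphere_norm σ) hx).2
    simp_rw [this] at h
    rw [integral_zero] at h
    exact area_pos.ne h

/-! ### Smooth dependence of integrals on parameters -/

section Param

variable {E : Type} [NormedAddCommGroup E] [NormedSpace ℝ E] [ProperSpace E]

/-- The density g is merely integrable, so all regularity comes from the kernel. Its derivative is
bounded on a closed ball times the sphere by compactness. -/
theorem hasFDerivAt_integral_param {G : Type} [NormedAddCommGroup G] [NormedSpace ℝ G]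
    {K : E × E3 → G} {U : Set E} (hU : IsOpen U) (hK : ContDiffOn ℝ 1 K (U ×ˢ Set.univ))
    {g : S2 → ℝ} (hg : Integrable g surface) {p : E} (hp : p ∈ U) :
    HasFDerivAt (fun p => ∫ σ : S2, g σ • K (p, σ) ∂surface)
      (∫ σ : S2, g σ • (fderiv ℝ K (p, (σ : E3))).comp (ContinuousLinearMap.inl ℝ E E3) ∂surface)
      p := by
  have ho : IsOpen (U ×ˢ (Set.univ : Set E3)) := hU.prod isOpen_univ
  have : SecondCountableTopologyEither S2 (E →L[ℝ] G) := secondCountableTopologyEither_of_left _ _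
  have : SecondCountableTopologyEither S2 G := secondCountableTopologyEither_of_left _ _
  obtain ⟨ε, hε, hball⟩ := Metric.isOpen_iff.1 hU p hp
  have hcb : Metric.closedBall p (ε / 2) ⊆ U :=
    (Metric.closedBall_subset_ball (by linarith)).trans hball
  have hKc : ∀ q ∈ U, Continuous fun σ : S2 => K (q, (σ : E3)) := fun q hq =>
    hK.continuousOn.comp_continuous (by fun_prop) fun σ => ⟨hq, trivial⟩
  have hdc : ContinuousOn (fun q : E × S2 => (fderiv ℝ K (q.1, (q.2 : E3))).comp
      (ContinuousLinearMap.inl ℝ E E3)) (U ×ˢ Set.univ) := by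
    have h1 : ContinuousOn (fderiv ℝ K) (U ×ˢ Set.univ) :=
      hK.continuousOn_fderiv_of_isOpen ho le_rfl
    have h2 : ContinuousOn (fun q : E × S2 => fderiv ℝ K (q.1, (q.2 : E3))) (U ×ˢ Set.univ) :=
      h1.comp (by fun_prop) fun q hq => ⟨hq.1, trivial⟩
    exact h2.clm_comp continuousOn_const
  obtain ⟨C, hC⟩ := ((isCompact_closedBall p (ε / 2)).prod
    (isCompact_univ (X := S2))).exists_bound_of_continuousOn
      (hdc.mono (Set.prod_mono hcb subset_rfl))
  have hn : Metric.ball p (ε / 2) ∈ 𝓝 p := Metric.ball_mem_nhds _ (by positivity)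
  refine hasFDerivAt_integral_of_dominated_of_fderiv_le (bound := fun σ => ‖g σ‖ * C)
    (F' := fun q (σ : S2) => g σ • (fderiv ℝ K (q, (σ : E3))).comp
      (ContinuousLinearMap.inl ℝ E E3)) hn ?_ ?_ ?_ ?_ ?_ ?_
  · filter_upwards [hn] with q hq
    exact hg.1.smul (hKc q (hcb (Metric.ball_subset_closedBall hq))).aestronglyMeasurable
  · obtain ⟨C', hC'⟩ := (isCompact_univ (X := S2)).exists_bound_of_continuousOn
      (hKc p hp).continuousOn
    exact hg.smul_bdd (hKc p hp).aestronglyMeasurable (C := C')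
      (Eventually.of_forall fun σ => hC' σ trivial)
  · refine hg.1.smul (Continuous.aestronglyMeasurable ?_)
    exact hdc.comp_continuous (f := fun σ : S2 => (p, σ)) (by fun_prop) fun σ => ⟨hp, trivial⟩
  · refine Eventually.of_forall fun σ q hq => ?_
    rw [norm_smul]
    exact mul_le_mul_of_nonneg_left (hC (q, σ) ⟨Metric.ball_subset_closedBall hq, trivial⟩)
      (norm_nonneg _)
  · exact hg.norm.mul_const C
  · refine Eventually.of_forall fun σ q hq => ?_
    have hmem : (q, (σ : E3)) ∈ U ×ˢ (Set.univ : Set E3) :=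
      ⟨hcb (Metric.ball_subset_closedBall hq), trivial⟩
    have h1 := ((hK.contDiffAt (ho.mem_nhds hmem)).differentiableAt (by simp)).hasFDerivAt
    exact (h1.comp q (hasFDerivAt_prodMk_left q (σ : E3))).const_smul (g σ)

/-- The values lie in an arbitrary normed space so that the induction can be applied to the
derivative, which is a parameter integral of the same form. -/
theorem contDiffOn_integral_param {G : Type} [NormedAddCommGroup G] [NormedSpace ℝ G]
    {K : E × E3 → G} {U : Set E} (hU : IsOpen U) (hK : ContDiffOn ℝ (⊤ : ℕ∞) K (U ×ˢ Set.univ))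
    {g : S2 → ℝ} (hg : Integrable g surface) :
    ContDiffOn ℝ (⊤ : ℕ∞) (fun p => ∫ σ : S2, g σ • K (p, σ) ∂surface) U := by
  have ho : IsOpen (U ×ˢ (Set.univ : Set E3)) := hU.prod isOpen_univ
  have key : ∀ n : ℕ, ∀ {G : Type} [NormedAddCommGroup G] [NormedSpace ℝ G] {K : E × E3 → G},
      ContDiffOn ℝ (⊤ : ℕ∞) K (U ×ˢ Set.univ) →
      ContDiffOn ℝ n (fun p => ∫ σ : S2, g σ • K (p, σ) ∂surface) U := by
    intro n
    induction n with
    | zero =>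
      intro G _ _ K hK
      rw [Nat.cast_zero, contDiffOn_zero]
      exact fun p hp => (hasFDerivAt_integral_param hU (hK.of_le (by simp)) hg
        hp).continuousAt.continuousWithinAt
    | succ n ih =>
      intro G _ _ K hK
      have : ((n + 1 : ℕ) : WithTop ℕ∞) = (n : WithTop ℕ∞) + 1 := by norm_cast
      rw [this, contDiffOn_succ_iff_fderiv_of_isOpen hU]
      have hd := fun p hp => hasFDerivAt_integral_param hU (hK.of_le (by simp)) hg (p := p) hp
      refine ⟨fun p hp => (hd p hp).differentiableAt.differentiableWithinAt, by simp, ?_⟩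
      refine ContDiffOn.congr ?_ fun p hp => (hd p hp).fderiv
      exact ih (K := fun q => (fderiv ℝ K q).comp (ContinuousLinearMap.inl ℝ E E3))
        ((hK.fderiv_of_isOpen ho (by simp)).clm_comp contDiffOn_const)
  rw [contDiffOn_infty]
  exact fun n => key n hK

end Param

theorem rot_integral {K : E3 × E3 → ℝ} (hK : ContDiff ℝ (⊤ : ℕ∞) K) {g : S2 → ℝ}
    (hg : Integrable g surface) (i : Fin 3) (x : E3) :
    rot i (fun x => ∫ σ : S2, g σ * K (x, σ) ∂surface) x =
      ∫ σ : S2, g σ * rot i (fun x => K (x, σ)) x ∂surface := by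
  have h := hasFDerivAt_integral_param isOpen_univ (K := K) (U := Set.univ)
    ((hK.of_le (by simp)).contDiffOn) hg (p := x) trivial
  simp only [smul_eq_mul] at h
  have hdc : Continuous (fun σ : S2 => (fderiv ℝ K (x, (σ : E3))).comp
      (ContinuousLinearMap.inl ℝ E3 E3)) :=
    ((hK.continuous_fderiv (by simp)).comp (by fun_prop)).clm_comp continuous_const
  obtain ⟨C, hC⟩ := (isCompact_univ (X := S2)).exists_bound_of_continuousOn hdc.continuousOn
  have hint : Integrable (fun σ : S2 => g σ • (fderiv ℝ K (x, (σ : E3))).comp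
      (ContinuousLinearMap.inl ℝ E3 E3)) surface :=
    hg.smul_bdd hdc.aestronglyMeasurable (C := C) (Eventually.of_forall fun σ => hC σ trivial)
  rw [rot, h.fderiv, ContinuousLinearMap.integral_apply hint]
  refine integral_congr_ae (Eventually.of_forall fun σ => ?_)
  have h1 := HasFDerivAt.comp (g := K) x
    ((hK.differentiable (by simp) (x, (σ : E3))).hasFDerivAt)
    (hasFDerivAt_prodMk_left (𝕜 := ℝ) x (σ : E3))
  have h2 : fderiv ℝ (fun x => K (x, (σ : E3))) x = _ := h1.fderiv
  simp only [rot, h2, smul_apply, smul_eq_mul]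

end KacBoltzmann
end

noncomputable section

namespace KacBoltzmann

/-! ### The heat semigroup -/

attribute [local irreducible] heatKer heatKer' heatKer'' heatKerDot zonal

/-- The heat flow `U_t g`, extended to `ℝ³` as a function of `x · y`. -/
def heatExt (g : S2 → ℝ) (t : ℝ) (x : E3) : ℝ :=
  area⁻¹ * ∫ σ : S2, g σ * heatKer t (zonal x σ) ∂surface

theorem contDiff_heatKer {t : ℝ} (ht : 0 < t) : ContDiff ℝ (⊤ : ℕ∞) (heatKer t) := by
  rw [← contDiffOn_univ]
  exact contDiffOn_heatKer.comp (f := fun s : ℝ => (t, s))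
    (contDiff_const.prodMk contDiff_id).contDiffOn fun x _ => ⟨ht, trivial⟩

theorem contDiff_heatKer' {t : ℝ} (ht : 0 < t) : ContDiff ℝ (⊤ : ℕ∞) (heatKer' t) := by
  rw [← contDiffOn_univ]
  exact contDiffOn_heatKer'.comp (f := fun s : ℝ => (t, s))
    (contDiff_const.prodMk contDiff_id).contDiffOn fun x _ => ⟨ht, trivial⟩

theorem contDiff_heatKerDot {t : ℝ} (ht : 0 < t) : ContDiff ℝ (⊤ : ℕ∞) (heatKerDot t) := by
  rw [← contDiffOn_univ]
  exact contDiffOn_heatKerDot.comp (f := fun s : ℝ => (t, s))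
    (contDiff_const.prodMk contDiff_id).contDiffOn fun x _ => ⟨ht, trivial⟩

theorem contDiffOn_heatExt {g : S2 → ℝ} (hg : Integrable g surface) :
    ContDiffOn ℝ (⊤ : ℕ∞) (fun p : ℝ × E3 => heatExt g p.1 p.2) (Set.Ioi 0 ×ˢ Set.univ) := by
  have hK : ContDiffOn ℝ (⊤ : ℕ∞) (fun p : (ℝ × E3) × E3 => heatKer p.1.1 (zonal p.1.2 p.2))
      ((Set.Ioi 0 ×ˢ Set.univ) ×ˢ Set.univ) := by
    refine contDiffOn_heatKer.comp
      (f := fun p : (ℝ × E3) × E3 => (p.1.1, zonal p.1.2 p.2)) ?_ fun p hp => ⟨hp.1.1, trivial⟩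
    refine ContDiff.contDiffOn ?_
    exact (contDiff_fst.comp contDiff_fst).prodMk
      (contDiff_zonal.comp ((contDiff_snd.comp contDiff_fst).prodMk contDiff_snd))
  exact contDiffOn_const.mul
    (contDiffOn_integral_param (isOpen_Ioi.prod isOpen_univ) hK hg)

theorem contDiff_heatExt {g : S2 → ℝ} (hg : Integrable g surface) {t : ℝ} (ht : 0 < t) :
    ContDiff ℝ (⊤ : ℕ∞) (heatExt g t) := by
  rw [← contDiffOn_univ]
  exact (contDiffOn_heatExt hg).comp (f := fun s : E3 => (t, s))
    (contDiff_const.prodMk contDiff_id).contDiffOn fun x _ => ⟨ht, trivial⟩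

theorem integrable_mul_continuous {g k : S2 → ℝ} (hg : Integrable g surface) (hk : Continuous k) :
    Integrable (fun σ => g σ * k σ) surface := by
  obtain ⟨C, hC⟩ := (isCompact_univ (X := S2)).exists_bound_of_continuousOn hk.continuousOn
  exact hg.mul_bdd (c := C) hk.aestronglyMeasurable (Eventually.of_forall fun σ => hC σ trivial)

theorem hasDerivAt_heatExt {g : S2 → ℝ} (hg : Integrable g surface) {t : ℝ} (ht : 0 < t) (x : E3) :
    HasDerivAt (fun s => heatExt g s x)
      (area⁻¹ * ∫ σ : S2, g σ * heatKerDot t (zonal x σ) ∂surface) t := by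
  set K : ℝ × E3 → ℝ := fun p => heatKer p.1 (zonal x p.2) with hKdef
  have hK : ContDiffOn ℝ (⊤ : ℕ∞) K (Set.Ioi 0 ×ˢ Set.univ) := by
    refine contDiffOn_heatKer.comp (f := fun p : ℝ × E3 => (p.1, zonal x p.2)) ?_
      fun p hp => ⟨hp.1, trivial⟩
    exact (contDiff_fst.prodMk (contDiff_zonal.comp (contDiff_const.prodMk contDiff_snd))).contDiffOn
  have ho : IsOpen (Set.Ioi (0 : ℝ) ×ˢ (Set.univ : Set E3)) := isOpen_Ioi.prod isOpen_univ
  have h := (hasFDerivAt_integral_param isOpen_Ioi (hK.of_le (by simp)) hg (p := t) ht).hasDerivAt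
  have hdc : Continuous (fun σ : S2 => (fderiv ℝ K (t, (σ : E3))).comp
      (ContinuousLinearMap.inl ℝ ℝ E3)) := by
    refine Continuous.clm_comp ?_ continuous_const
    have := (hK.continuousOn_fderiv_of_isOpen ho (by simp)).comp_continuous
      (f := fun σ : S2 => (t, (σ : E3))) (by fun_prop) fun σ => ⟨ht, trivial⟩
    exact this
  obtain ⟨C, hC⟩ := (isCompact_univ (X := S2)).exists_bound_of_continuousOn hdc.continuousOn
  have hint : Integrable (fun σ : S2 => g σ • (fderiv ℝ K (t, (σ : E3))).comp
      (ContinuousLinearMap.inl ℝ ℝ E3)) surface :=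
    hg.smul_bdd C hdc.aestronglyMeasurable
      (Eventually.of_forall fun σ => hC σ trivial)
  rw [ContinuousLinearMap.integral_apply hint] at h
  have e : ∀ σ : S2, (g σ • (fderiv ℝ K (t, (σ : E3))).comp (ContinuousLinearMap.inl ℝ ℝ E3)) 1 =
      g σ * heatKerDot t (zonal x σ) := by
    intro σ
    rw [smul_apply, smul_eq_mul]
    congr 1
    have hd : HasFDerivAt K (fderiv ℝ K (t, (σ : E3))) (t, (σ : E3)) :=
      ((hK.contDiffAt (ho.mem_nhds (show (t, (σ : E3)) ∈ Set.Ioi (0 : ℝ) ×ˢ Set.univ from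
        ⟨ht, trivial⟩))).differentiableAt (by simp)).hasFDerivAt
    have h2 : HasDerivAt (fun s : ℝ => (s, (σ : E3))) (1, 0) t :=
      (hasDerivAt_id t).prodMk (hasDerivAt_const t _)
    have h3 := hd.comp_hasDerivAt t h2
    have h4 := h3.unique (hasDerivAt_heatKer_time ht (zonal x σ))
    simpa using h4
  simp_rw [e] at h
  simpa [heatExt] using h.const_mul area⁻¹

theorem contDiff_heatKer_zonal {t : ℝ} (ht : 0 < t) :
    ContDiff ℝ (⊤ : ℕ∞) (fun p : E3 × E3 => heatKer t (zonal p.1 p.2)) :=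
  (contDiff_heatKer ht).comp contDiff_zonal

theorem contDiff_rot_heatKer_zonal {t : ℝ} (ht : 0 < t) (i : Fin 3) :
    ContDiff ℝ (⊤ : ℕ∞)
      (fun p : E3 × E3 => heatKer' t (zonal p.1 p.2) * (inner ℝ p.2 (rotGen i p.1) / 2)) := by
  refine ((contDiff_heatKer' ht).comp contDiff_zonal).mul (ContDiff.div_const ?_ _)
  exact contDiff_snd.inner ℝ ((rotGen i).contDiff.comp contDiff_fst)

theorem rot_const_mul {f : E3 → ℝ} (hf : Differentiable ℝ f) (c : ℝ) (i : Fin 3) (x : E3) :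
    rot i (fun x => c * f x) x = c * rot i f x := by
  simp only [rot]
  rw [fderiv_const_mul (hf x)]; simp

theorem contDiff_integral_mul {K : E3 × E3 → ℝ} (hK : ContDiff ℝ (⊤ : ℕ∞) K) {g : S2 → ℝ}
    (hg : Integrable g surface) :
    ContDiff ℝ (⊤ : ℕ∞) (fun x => ∫ σ : S2, g σ * K (x, σ) ∂surface) := by
  rw [← contDiffOn_univ]
  exact contDiffOn_integral_param isOpen_univ hK.contDiffOn hg

theorem rot_heatExt {g : S2 → ℝ} (hg : Integrable g surface) {t : ℝ} (ht : 0 < t) (i : Fin 3)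
    (x : E3) : rot i (heatExt g t) x =
      area⁻¹ * ∫ σ : S2, g σ * (heatKer' t (zonal x σ) * (inner ℝ (σ : E3) (rotGen i x) / 2))
        ∂surface := by
  unfold heatExt
  rw [rot_const_mul ((contDiff_integral_mul (contDiff_heatKer_zonal ht) hg).differentiable
    (by simp)), rot_integral (contDiff_heatKer_zonal ht) hg]
  simp only [rot_zonal i (hasDerivAt_heatKer ht _)]

/-- Differentiation under the integral reduces the claim to the kernel. There the Laplacian of a
zonal function is the Legendre operator, and that operator equals the time derivative. -/
theorem rotLap_heatExt {g : S2 → ℝ} (hg : Integrable g surface) {t : ℝ} (ht : 0 < t)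
    {x : E3} (hx : ‖x‖ = 1) : rotLap (heatExt g t) x =
      area⁻¹ * ∫ σ : S2, g σ * heatKerDot t (zonal x σ) ∂surface := by
  have h1 : ∀ i, rot i (rot i (heatExt g t)) x = area⁻¹ * ∫ σ : S2, g σ *
      rot i (rot i (fun x => heatKer t (zonal x σ))) x ∂surface := by
    intro i
    have e : rot i (heatExt g t) = fun x => area⁻¹ * ∫ σ : S2, g σ *
        (heatKer' t (zonal x σ) * (inner ℝ (σ : E3) (rotGen i x) / 2)) ∂surface :=
      funext fun x => rot_heatExt hg ht i x
    have e2 : ∀ y : E3, rot i (fun x => heatKer t (zonal x y)) = fun x =>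
        heatKer' t (zonal x y) * (inner ℝ y (rotGen i x) / 2) :=
      fun y => funext fun x => rot_zonal i (hasDerivAt_heatKer ht _)
    rw [e, rot_const_mul ((contDiff_integral_mul (contDiff_rot_heatKer_zonal ht i) hg).differentiable
      (by simp)), rot_integral (contDiff_rot_heatKer_zonal ht i) hg]
    simp only [e2]
  have hc : ∀ i, Continuous fun σ : S2 => rot i (rot i (fun x => heatKer t (zonal x σ))) x := by
    intro i
    have e2 : ∀ y : E3, rot i (fun x => heatKer t (zonal x y)) = fun x =>
        heatKer' t (zonal x y) * (inner ℝ y (rotGen i x) / 2) :=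
      fun y => funext fun x => rot_zonal i (hasDerivAt_heatKer ht _)
    simp only [e2]
    have hK := contDiff_rot_heatKer_zonal ht i
    have : ∀ y : E3, rot i (fun x => heatKer' t (zonal x y) * (inner ℝ y (rotGen i x) / 2)) x =
        fderiv ℝ (fun p : E3 × E3 =>
          heatKer' t (zonal p.1 p.2) * (inner ℝ p.2 (rotGen i p.1) / 2)) (x, y) (rotGen i x, 0) := by
      intro y
      have hd := (hK.differentiable (by simp) (x, y)).hasFDerivAt
      have h2 : HasFDerivAt (fun x : E3 => (x, y)) (ContinuousLinearMap.inl ℝ E3 E3) x :=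
        (hasFDerivAt_id x).prodMk (hasFDerivAt_const y x)
      have h3 := hd.comp x h2
      simp only [rot]
      have h4 := h3.fderiv
      simp only [Function.comp_def] at h4
      rw [h4]; simp
    simp only [this]
    exact ((hK.continuous_fderiv (by simp)).comp (by fun_prop)).clm_apply continuous_const
  simp only [rotLap, h1]
  rw [← Finset.mul_sum, ← integral_finsetSum _ fun i _ => integrable_mul_continuous hg (hc i)]
  congr 2
  funext σ
  rw [← Finset.mul_sum, heatKerDot_eq ht, ← rotLap_zonal (hasDerivAt_heatKer ht)
    (hasDerivAt_heatKer' ht) hx (sphere_norm σ)]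
  rfl

theorem continuous_heatKer_zonal {t : ℝ} (ht : 0 < t) :
    Continuous (fun p : S2 × S2 => heatKer t (zonal p.1 p.2)) := by
  have h : Continuous fun p : S2 × S2 => ((p.1 : E3), (p.2 : E3)) := by fun_prop
  exact (contDiff_heatKer_zonal ht).continuous.comp h

theorem continuous_heatKer_zonal_right {t : ℝ} (ht : 0 < t) (x : E3) :
    Continuous (fun y : S2 => heatKer t (zonal x y)) := by
  have h : Continuous fun y : S2 => (x, (y : E3)) := by fun_prop
  exact (contDiff_heatKer_zonal ht).continuous.comp h

theorem lintegral_heatKer {t : ℝ} (ht : 0 < t) (x : S2) :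
    ∫⁻ σ : S2, ENNReal.ofReal (heatKer t (zonal σ x)) ∂surface = ENNReal.ofReal area := by
  rw [← integral_heatKer ht (sphere_norm x), ofReal_integral_eq_lintegral_ofReal]
  · simp_rw [zonal_comm _ (x : E3)]
    exact integrable_surface (continuous_heatKer_zonal_right ht x)
  · exact Eventually.of_forall fun σ =>
      heatKer_nonneg ht (zonal_mem (sphere_norm σ) (sphere_norm x)).1
        (zonal_mem (sphere_norm σ) (sphere_norm x)).2

/-- The heat semigroup is a contraction of `L¹`. -/
theorem lintegral_heatExt_le {g : S2 → ℝ} (hg : Integrable g surface) {t : ℝ} (ht : 0 < t) :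
    ∫⁻ σ : S2, ‖heatExt g t σ‖ₑ ∂surface ≤ ∫⁻ σ, ‖g σ‖ₑ ∂surface := by
  have hA : ENNReal.ofReal area⁻¹ * ENNReal.ofReal area = 1 := by
    rw [← ENNReal.ofReal_mul (inv_nonneg.2 area_pos.le), inv_mul_cancel₀ area_pos.ne']; simp
  have h1 : ∀ x : S2, ‖heatExt g t x‖ₑ ≤ ENNReal.ofReal area⁻¹ *
      ∫⁻ y : S2, ‖g y‖ₑ * ENNReal.ofReal (heatKer t (zonal x y)) ∂surface := by
    intro x
    rw [heatExt, enorm_mul, Real.enorm_of_nonneg (inv_nonneg.2 area_pos.le)]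
    gcongr
    refine (enorm_integral_le_lintegral_enorm _).trans_eq (lintegral_congr fun y => ?_)
    rw [enorm_mul, Real.enorm_of_nonneg (heatKer_nonneg ht
      (zonal_mem (sphere_norm x) (sphere_norm y)).1 (zonal_mem (sphere_norm x) (sphere_norm y)).2)]
  refine (lintegral_mono h1).trans ?_
  rw [lintegral_const_mul' _ _ ENNReal.ofReal_ne_top, lintegral_lintegral_swap]
  · have : ∀ y : S2, ∫⁻ x : S2, ‖g y‖ₑ * ENNReal.ofReal (heatKer t (zonal x y)) ∂surface =
        ‖g y‖ₑ * ENNReal.ofReal area := fun y => by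
      rw [lintegral_const_mul' _ _ enorm_ne_top, lintegral_heatKer ht]
    simp_rw [this]
    rw [lintegral_mul_const' _ _ ENNReal.ofReal_ne_top, mul_comm, mul_assoc, mul_comm _
      (ENNReal.ofReal area⁻¹), hA, mul_one]
  · have h2 : AEMeasurable (fun p : S2 × S2 => ‖g p.2‖ₑ) (surface.prod surface) :=
      hg.1.enorm.comp_snd
    exact h2.mul (continuous_heatKer_zonal ht).measurable.ennreal_ofReal.aemeasurable

theorem one_sub_zonal {x y : E3} (hx : ‖x‖ = 1) (hy : ‖y‖ = 1) :
    dist x y ^ 2 = 4 * (1 - zonal x y) := by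
  rw [dist_eq_norm, @norm_sub_sq ℝ, hx, hy]
  simp [zonal]; ring

/-- The heat flow of a continuous function converges uniformly at time `0`. -/
theorem exists_abs_heatExt_sub_le {φ : S2 → ℝ} (hφ : Continuous φ) {ε : ℝ} (hε : 0 < ε) :
    ∃ C : ℝ, ∀ t : ℝ, 0 < t → ∀ x : S2,
      |heatExt φ t x - φ x| ≤ ε + C * (1 - Real.exp (-2 * t)) := by
  obtain ⟨M, hM⟩ := (isCompact_univ (X := S2)).exists_bound_of_continuousOn hφ.continuousOn
  have hM0 : 0 ≤ M := (norm_nonneg _).trans (hM ⟨EuclideanSpace.single 0 1, by simp⟩ trivial)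
  obtain ⟨δ, hδ, hu⟩ := Metric.uniformContinuous_iff.1
    (CompactSpace.uniformContinuous_of_continuous hφ) ε hε
  -- Away from the diagonal the oscillation is at most 2M ≤ 8M(1 − ξ)/δ², because the squared
  -- distance is 4(1 − ξ). The first moment of 1 − ξ supplies the remaining factor 1/2.
  refine ⟨4 * M / δ ^ 2, fun t ht x => ?_⟩
  have hcK : Continuous fun y : S2 => heatKer t (zonal x y) :=
    continuous_heatKer_zonal_right ht x
  have hcz : Continuous fun y : S2 => zonal x y := by
    have h : Continuous fun y : S2 => ((x : E3), (y : E3)) := by fun_prop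
    exact continuous_zonal.comp h
  have e1 : φ x = area⁻¹ * ∫ y : S2, φ x * heatKer t (zonal x y) ∂surface := by
    rw [integral_const_mul]
    simp_rw [zonal_comm (x : E3)]
    rw [integral_heatKer ht (sphere_norm x)]
    field_simp [area_pos.ne']
  have hb : ∀ y : S2, |φ y * heatKer t (zonal x y) - φ x * heatKer t (zonal x y)| ≤
      ε * heatKer t (zonal y x) + 8 * M / δ ^ 2 * (heatKer t (zonal y x) * (1 - zonal y x)) := by
    intro y
    have hz := zonal_mem (sphere_norm x) (sphere_norm y)
    have hk := heatKer_nonneg ht hz.1 hz.2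
    rw [← sub_mul, abs_mul, abs_of_nonneg hk, zonal_comm (y : E3)]
    have : |φ y - φ x| ≤ ε + 8 * M / δ ^ 2 * (1 - zonal x y) := by
      by_cases hd : dist y x < δ
      · have := (hu hd).le
        rw [Real.dist_eq] at this
        have : 0 ≤ 8 * M / δ ^ 2 * (1 - zonal x y) :=
          mul_nonneg (by positivity) (by linarith [hz.2])
        linarith
      · push Not at hd
        have h2 : |φ y - φ x| ≤ 2 * M := by
          have a := hM x trivial; have b := hM y trivial
          rw [Real.norm_eq_abs] at a b
          exact (abs_sub _ _).trans (by linarith)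
        have h3 : δ ^ 2 ≤ 4 * (1 - zonal x y) := by
          rw [← one_sub_zonal (sphere_norm x) (sphere_norm y), dist_comm]
          exact pow_le_pow_left₀ hδ.le hd 2
        have h4 : 2 * M ≤ 8 * M / δ ^ 2 * (1 - zonal x y) := by
          rw [div_mul_eq_mul_div, le_div_iff₀ (by positivity)]
          nlinarith
        linarith
    calc _ ≤ (ε + 8 * M / δ ^ 2 * (1 - zonal x y)) * heatKer t (zonal x y) := by gcongr
      _ = _ := by ring
  have i1 : Integrable (fun y : S2 => φ y * heatKer t (zonal x y)) surface :=
    integrable_surface (hφ.mul hcK)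
  have i2 : Integrable (fun y : S2 => φ x * heatKer t (zonal x y)) surface :=
    integrable_surface (continuous_const.mul hcK)
  have i3 : Integrable (fun y : S2 => ε * heatKer t (zonal y x)) surface := by
    simp_rw [zonal_comm _ (x : E3)]
    exact integrable_surface (continuous_const.mul hcK)
  have i4 : Integrable (fun y : S2 => 8 * M / δ ^ 2 *
      (heatKer t (zonal y x) * (1 - zonal y x))) surface := by
    simp_rw [zonal_comm _ (x : E3)]
    exact integrable_surface (continuous_const.mul (hcK.mul (continuous_const.sub hcz)))
  conv_lhs => rw [e1, heatExt, ← mul_sub, ← integral_sub i1 i2, abs_mul,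
    abs_of_pos (inv_pos.2 area_pos)]
  have h5 : |∫ y : S2, (φ y * heatKer t (zonal x y) - φ x * heatKer t (zonal x y)) ∂surface| ≤
      ∫ y : S2, (ε * heatKer t (zonal y x) +
        8 * M / δ ^ 2 * (heatKer t (zonal y x) * (1 - zonal y x))) ∂surface := by
    rw [← Real.norm_eq_abs]
    exact norm_integral_le_of_norm_le (by exact i3.add i4) (Eventually.of_forall hb)
  rw [integral_add i3 i4, integral_const_mul, integral_const_mul,
    integral_heatKer ht (sphere_norm x), integral_heatKer_mul_one_sub ht (sphere_norm x)] at h5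
  calc _ ≤ area⁻¹ * (ε * area + 8 * M / δ ^ 2 * (area / 2 * (1 - Real.exp (-2 * t)))) := by
        gcongr; exact inv_nonneg.2 area_pos.le
    _ = _ := by field_simp [area_pos.ne']; ring

theorem heatExt_sub {g g' : S2 → ℝ} (hg : Integrable g surface) (hg' : Integrable g' surface)
    {t : ℝ} (ht : 0 < t) (x : S2) :
    heatExt (fun σ => g σ - g' σ) t x = heatExt g t x - heatExt g' t x := by
  have hcK : Continuous fun y : S2 => heatKer t (zonal x y) :=
    continuous_heatKer_zonal_right ht x
  simp only [heatExt, sub_mul]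
  rw [integral_sub (integrable_mul_continuous hg hcK) (integrable_mul_continuous hg' hcK), mul_sub]

theorem measurable_heatExt {g : S2 → ℝ} (hg : Integrable g surface) {t : ℝ} (ht : 0 < t) :
    Continuous fun σ : S2 => heatExt g t σ :=
  (contDiff_heatExt hg ht).continuous.comp continuous_subtype_val

/-- A continuous φ approximates g in L¹. The contraction property handles the flow of g − φ, uniform
convergence handles φ, and the three errors are ε/4, ε/2 and ε/4. -/
theorem tendsto_heatExt {g : S2 → ℝ} (hg : Integrable g surface) :
    Tendsto (fun t => ∫⁻ σ : S2, ‖heatExt g t σ - g σ‖ₑ ∂surface) (𝓝[>] 0) (𝓝 0) := by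
  rw [ENNReal.tendsto_nhds_zero]
  intro ε hε
  wlog hεt : ε ≠ ⊤ generalizing ε
  · push Not at hεt; subst hεt; exact Eventually.of_forall fun _ => le_top
  obtain ⟨φ, hφ, hφi⟩ := hg.exists_boundedContinuous_lintegral_sub_le (ε := ε / 4)
    (ENNReal.div_pos hε.ne' (by norm_num)).ne'
  set η : ℝ := ε.toReal / (4 * area) with hη
  have hεr : 0 < ε.toReal := ENNReal.toReal_pos hε.ne' hεt
  have hηp : 0 < η := div_pos hεr (by have := area_pos; positivity)
  obtain ⟨C, hC⟩ := exists_abs_heatExt_sub_le φ.continuous hηp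
  have hlim : Tendsto (fun t : ℝ => C * (1 - Real.exp (-2 * t))) (𝓝[>] 0) (𝓝 0) := by
    have : Continuous fun t : ℝ => C * (1 - Real.exp (-2 * t)) := by fun_prop
    have h := this.tendsto 0
    simp only [mul_zero, Real.exp_zero, sub_self] at h
    exact h.mono_left nhdsWithin_le_nhds
  filter_upwards [hlim.eventually (gt_mem_nhds hηp), self_mem_nhdsWithin] with t hCt ht
  have ht : 0 < t := ht
  have hgφ : Integrable (fun σ => g σ - φ σ) surface := hg.sub hφi
  have h1 : ∀ σ : S2, ‖heatExt g t σ - g σ‖ₑ ≤ ‖heatExt (fun σ => g σ - φ σ) t σ‖ₑ +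
      ‖heatExt φ t σ - φ σ‖ₑ + ‖g σ - φ σ‖ₑ := by
    intro σ
    rw [heatExt_sub hg hφi ht]
    have : heatExt g t σ - g σ = (heatExt g t σ - heatExt φ t σ) + (heatExt φ t σ - φ σ) -
      (g σ - φ σ) := by ring
    rw [this]
    exact enorm_sub_le.trans (by gcongr; exact enorm_add_le _ _)
  have m1 : Measurable fun σ : S2 => ‖heatExt (fun σ => g σ - φ σ) t σ‖ₑ :=
    (measurable_heatExt hgφ ht).measurable.enorm
  have m2 : Measurable fun σ : S2 => ‖heatExt φ t σ - φ σ‖ₑ :=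
    ((measurable_heatExt hφi ht).sub φ.continuous).measurable.enorm
  have h2 : ∫⁻ σ : S2, ‖heatExt φ t σ - φ σ‖ₑ ∂surface ≤ ε / 2 := by
    calc _ ≤ ∫⁻ _ : S2, ENNReal.ofReal (2 * η) ∂surface := by
          refine lintegral_mono fun σ => ?_
          rw [← ofReal_norm]
          refine ENNReal.ofReal_le_ofReal ((hC t ht σ).trans (by linarith))
      _ = ENNReal.ofReal (2 * η) * ENNReal.ofReal area := by
          rw [lintegral_const, area, ofReal_measureReal]
      _ = ε / 2 := by
          rw [← ENNReal.ofReal_mul (by positivity), hη]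
          have : 2 * (ε.toReal / (4 * area)) * area = ε.toReal / 2 := by
            field_simp [area_pos.ne']; norm_num
          rw [this, ENNReal.ofReal_div_of_pos (by norm_num), ENNReal.ofReal_toReal hεt]
          simp
  calc _ ≤ ∫⁻ σ : S2, (‖heatExt (fun σ => g σ - φ σ) t σ‖ₑ +
      ‖heatExt φ t σ - φ σ‖ₑ + ‖g σ - φ σ‖ₑ) ∂surface := lintegral_mono h1
    _ = ∫⁻ σ : S2, ‖heatExt (fun σ => g σ - φ σ) t σ‖ₑ ∂surface +
        ∫⁻ σ : S2, ‖heatExt φ t σ - φ σ‖ₑ ∂surface + ∫⁻ σ, ‖g σ - φ σ‖ₑ ∂surface := by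
      rw [lintegral_add_left (by exact m1.add m2), lintegral_add_left m1]
    _ ≤ ε / 4 + ε / 2 + ε / 4 := by
      gcongr
      exact (lintegral_heatExt_le hgφ ht).trans hφ
    _ = ε := by
      rw [add_right_comm]
      have : ε / 4 + ε / 4 = ε / 2 := by
        rw [← two_mul, ← mul_div_assoc, ENNReal.div_eq_div_iff (by norm_num) (by norm_num)
          (by norm_num) (by norm_num)]
        ring
      rw [this, ENNReal.add_halves]

/-- The extension by the inner product is not constant along rays. Composing with the direction map
repairs this without changing rotation derivatives on the sphere. -/
theorem isSphHeatFlow_heatExt {g : S2 → ℝ} (hg : Integrable g surface) :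
    IsSphHeatFlow g (fun t σ => heatExt g t σ) where
  integrable := hg
  smooth := by
    have h := (contDiffOn_heatExt hg).comp (f := fun p : ℝ × E3 => (p.1, unitDir p.2))
      (s := Set.Ioi 0 ×ˢ {0}ᶜ)
      (contDiffOn_fst.prodMk (contDiffOn_unitDir.comp contDiffOn_snd fun p hp => hp.2))
      fun p hp => ⟨hp.1, trivial⟩
    refine h.congr fun p hp => ?_
    rw [radial_of_ne hp.2]; rfl
  heat t ht σ := by
    have hs : SmoothAway (heatExt g t) := (contDiff_heatExt hg ht).contDiffOn
    have e : sphLaplacian (fun σ : S2 => heatExt g t σ) σ = rotLap (heatExt g t) σ := by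
      have h := hs.comp_unitDir.sphLaplacian_eq σ
      rw [rotLap_comp_unitDir hs (sphere_ne_zero σ)] at h
      simp only [unitDir_sphere] at h
      exact h
    rw [e, rotLap_heatExt hg ht (sphere_norm σ)]
    exact hasDerivAt_heatExt hg ht σ
  initial := tendsto_heatExt hg

/-- Any two flows agree almost everywhere on the sphere at each positive time, and the seminorm does
not see null sets, so all candidates in the infimum have the same value. -/
theorem sphK_eq {g : S2 → ℝ} (hg : Integrable g surface) (ω : ℝ → ℝ) :
    sphK ω g = ∫⁻ t in Set.Ioi (0 : ℝ),
      sobolevH2Sq (fun σ => Real.sqrt (heatExt g t σ)) * ENNReal.ofReal (ω t) := by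
  refine le_antisymm (iInf₂_le _ (isSphHeatFlow_heatExt hg)) (le_iInf₂ fun u hu => ?_)
  refine (setLIntegral_congr_fun measurableSet_Ioi fun t ht => ?_).le
  refine congrArg (· * ENNReal.ofReal (ω t)) ?_
  refine sobolevH2Sq_congr ?_
  filter_upwards [(isSphHeatFlow_heatExt hg).unique hu ht] with σ hσ
  rw [hσ]

theorem heatExt_pos {g : S2 → ℝ} (hg : Integrable g surface) (h0 : ∀ σ, 0 ≤ g σ)
    (hne : ¬ g =ᵐ[surface] 0) {t : ℝ} (ht : 0 < t) {x : E3} (hx : ‖x‖ = 1) :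
    0 < heatExt g t x := by
  have hp : ∀ y : S2, 0 < heatKer t (zonal x y) := fun y =>
    heatKer_pos ht (zonal_mem hx (sphere_norm y)).1 (zonal_mem hx (sphere_norm y)).2
  have hcK : Continuous fun y : S2 => heatKer t (zonal x y) :=
    continuous_heatKer_zonal_right ht x
  refine mul_pos (inv_pos.2 area_pos) ?_
  rw [integral_pos_iff_support_of_nonneg (fun y => mul_nonneg (h0 y) (hp y).le)
    (integrable_mul_continuous hg hcK)]
  rw [pos_iff_ne_zero]
  intro h
  refine hne ?_
  rw [EventuallyEq, ae_iff]
  refine measure_mono_null (fun y hy => ?_) h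
  exact mul_ne_zero hy (hp y).ne'

theorem heatExt_of_ae_zero {g : S2 → ℝ} (hg : g =ᵐ[surface] 0) (t : ℝ) (x : E3) :
    heatExt g t x = 0 := by
  rw [heatExt, integral_eq_zero_of_ae, mul_zero]
  filter_upwards [hg] with σ hσ
  simp [hσ]

theorem sobolevH2Sq_zero : sobolevH2Sq (fun _ => 0) = 0 := by
  have h : SmoothAway (fun _ : E3 => (0 : ℝ)) := contDiffOn_const
  rw [h.comp_unitDir.sobolevH2Sq_eq]
  have : ∀ i, rot i (fun _ : E3 => (0 : ℝ)) = fun _ => 0 := fun i => by funext x; simp [rot]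
  simp [rotLap, this]

/-! ### Kernels of the affine forms -/

/-- The integral kernel of the affine form `affSeq k` evaluated along the heat flow. -/
def kerForm (k : ℕ) (t : ℝ) (x y : E3) : ℝ :=
  area⁻¹ * affSeq k (heatKer t (zonal x y))
    (fun i => heatKer' t (zonal x y) * (inner ℝ y (rotGen i x) / 2)) (heatKerDot t (zonal x y))

theorem kerForm_zero (t : ℝ) (x y : E3) : kerForm 0 t x y = 0 := by simp [kerForm, affSeq]

theorem exists_affSeq_eq (k : ℕ) : ∃ (A B : ℝ) (C : Fin 3 → ℝ), ∀ g p q,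
    affSeq k g p q = A * g + ∑ i, C i * p i + B * q := by
  rcases k with _ | k
  · exact ⟨0, 0, 0, fun g p q => by simp [affSeq]⟩
  · simp only [affSeq, affForm]
    split_ifs with h
    · exact ⟨-(slope k).1 ^ 2, (slope k).1, 0, fun g p q => by simp; ring⟩
    · refine ⟨(slope k).1 * ((∑ i, (slope k).2 i ^ 2) / 2) - (slope k).1 ^ 2, (slope k).1,
        fun i => -(slope k).1 * (slope k).2 i, fun g p q => ?_⟩
      simp only [mul_assoc, ← Finset.mul_sum]
      ring

theorem continuousOn_kerForm (k : ℕ) :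
    ContinuousOn (fun p : ℝ × E3 × E3 => kerForm k p.1 p.2.1 p.2.2) (Set.Ioi 0 ×ˢ Set.univ) := by
  obtain ⟨A, B, C, h⟩ := exists_affSeq_eq k
  simp only [kerForm, h]
  have hz : Continuous fun p : ℝ × E3 × E3 => (p.1, zonal p.2.1 p.2.2) :=
    continuous_fst.prodMk (continuous_zonal.comp continuous_snd)
  have hm : Set.MapsTo (fun p : ℝ × E3 × E3 => (p.1, zonal p.2.1 p.2.2))
      (Set.Ioi 0 ×ˢ Set.univ) (Set.Ioi 0 ×ˢ Set.univ) := fun p hp => ⟨hp.1, trivial⟩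
  have c1 : ContinuousOn (fun p : ℝ × E3 × E3 => heatKer p.1 (zonal p.2.1 p.2.2)) _ :=
    contDiffOn_heatKer.continuousOn.comp hz.continuousOn hm
  have c2 : ContinuousOn (fun p : ℝ × E3 × E3 => heatKer' p.1 (zonal p.2.1 p.2.2)) _ :=
    contDiffOn_heatKer'.continuousOn.comp hz.continuousOn hm
  have c3 : ContinuousOn (fun p : ℝ × E3 × E3 => heatKerDot p.1 (zonal p.2.1 p.2.2)) _ :=
    contDiffOn_heatKerDot.continuousOn.comp hz.continuousOn hm
  refine continuousOn_const.mul (((continuousOn_const.mul c1).add ?_).add (continuousOn_const.mul c3))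
  refine continuousOn_finsetSum _ fun i _ => continuousOn_const.mul (c2.mul ?_)
  refine Continuous.continuousOn ?_
  exact (Continuous.inner (by fun_prop) ((rotGen i).continuous.comp (by fun_prop))).div_const _

theorem integral_kerForm {g : S2 → ℝ} (hg : Integrable g surface) {t : ℝ} (ht : 0 < t) (k : ℕ)
    (x : S2) : ∫ y : S2, g y * kerForm k t x y ∂surface =
      affSeq k (heatExt g t x) (fun i => rot i (heatExt g t) x) (rotLap (heatExt g t) x) := by
  obtain ⟨A, B, C, h⟩ := exists_affSeq_eq k
  rw [h, rotLap_heatExt hg ht (sphere_norm x)]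
  simp only [rot_heatExt hg ht, kerForm, h, heatExt]
  have hpair : Continuous fun y : S2 => ((x : E3), (y : E3)) := by fun_prop
  have c1 : Continuous fun y : S2 => heatKer t (zonal x y) :=
    continuous_heatKer_zonal_right ht x
  have c2 : ∀ i, Continuous fun y : S2 =>
      heatKer' t (zonal x y) * (inner ℝ (y : E3) (rotGen i x) / 2) := fun i =>
    (contDiff_rot_heatKer_zonal ht i).continuous.comp hpair
  have c3 : Continuous fun y : S2 => heatKerDot t (zonal x y) :=
    ((contDiff_heatKerDot ht).comp contDiff_zonal).continuous.comp hpair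
  have i1 := (integrable_mul_continuous hg c1).const_mul (area⁻¹ * A)
  have i2 : ∀ i, _ := fun i => (integrable_mul_continuous hg (c2 i)).const_mul (area⁻¹ * C i)
  have i3 := (integrable_mul_continuous hg c3).const_mul (area⁻¹ * B)
  have i2' := integrable_finsetSum Finset.univ fun i _ => i2 i
  have i12 : Integrable (fun y : S2 => area⁻¹ * A * (g y * heatKer t (zonal x y)) +
      ∑ i, area⁻¹ * C i * (g y * (heatKer' t (zonal x y) *
        (inner ℝ (y : E3) (rotGen i x) / 2)))) surface := i1.add i2'
  have e : ∀ y : S2, g y * (area⁻¹ * (A * heatKer t (zonal x y) + ∑ i, C i *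
      (heatKer' t (zonal x y) * (inner ℝ (y : E3) (rotGen i x) / 2)) +
      B * heatKerDot t (zonal x y))) =
      area⁻¹ * A * (g y * heatKer t (zonal x y)) + ∑ i, area⁻¹ * C i * (g y *
        (heatKer' t (zonal x y) * (inner ℝ (y : E3) (rotGen i x) / 2))) +
      area⁻¹ * B * (g y * heatKerDot t (zonal x y)) := by
    intro y
    have : ∑ i, area⁻¹ * C i * (g y *
        (heatKer' t (zonal x y) * (inner ℝ (y : E3) (rotGen i x) / 2))) =
        g y * area⁻¹ * ∑ i, C i *
      (heatKer' t (zonal x y) * (inner ℝ (y : E3) (rotGen i x) / 2)) := by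
      rw [Finset.mul_sum]; exact Finset.sum_congr rfl fun i _ => by ring
    rw [this]; ring
  simp_rw [e]
  rw [integral_add i12 i3, integral_add i1 i2', integral_finsetSum _ fun i _ => i2 i]
  simp_rw [integral_const_mul]
  congr 1
  · congr 1
    · ring
    · exact Finset.sum_congr rfl fun i _ => by ring
  · ring

/-- The functional obtained from `sphK` by replacing the seminorm by the supremum of the affine
forms. -/
def formK (ω : ℝ → ℝ) (g : S2 → ℝ) : ℝ≥0∞ :=
  ∫⁻ t in Set.Ioi (0 : ℝ), (∫⁻ x : S2, ⨆ k, ENNReal.ofReal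
    (∫ y : S2, g y * kerForm k t x y ∂surface) ∂surface) * ENNReal.ofReal (ω t)

/-- Unless g vanishes almost everywhere, the flow is strictly positive. Its square root is then
smooth and positive, as the pointwise comparison requires. The forms are linear, so they pass under
the integral defining the flow. -/
theorem sobolevH2Sq_sqrt_heatExt {g : S2 → ℝ} (hg : Integrable g surface) (h0 : ∀ σ, 0 ≤ g σ)
    {t : ℝ} (ht : 0 < t) :
    sobolevH2Sq (fun σ => Real.sqrt (heatExt g t σ)) ≤ ∫⁻ x : S2, ⨆ k, ENNReal.ofReal
      (∫ y : S2, g y * kerForm k t x y ∂surface) ∂surface ∧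
    ∫⁻ x : S2, ⨆ k, ENNReal.ofReal (∫ y : S2, g y * kerForm k t x y ∂surface) ∂surface ≤
      17 * sobolevH2Sq (fun σ => Real.sqrt (heatExt g t σ)) := by
  by_cases hz : g =ᵐ[surface] 0
  · simp only [heatExt_of_ae_zero hz, Real.sqrt_zero, sobolevH2Sq_zero]
    have : ∀ k (x : S2), ∫ y : S2, g y * kerForm k t x y ∂surface = 0 := fun k x => by
      rw [integral_eq_zero_of_ae]
      filter_upwards [hz] with σ hσ
      simp [hσ]
    simp [this]
  have hs : SmoothAway (heatExt g t) := (contDiff_heatExt hg ht).contDiffOn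
  have hpos : ∀ x, x ≠ 0 → 0 < heatExt g t (unitDir x) := fun x hx =>
    heatExt_pos hg h0 hz ht (norm_unitDir hx)
  have hh : RaySmooth (fun x => Real.sqrt (heatExt g t (unitDir x))) :=
    hs.comp_unitDir.comp (φ := Real.sqrt) fun x hx => Real.contDiffAt_sqrt (hpos x hx).ne'
  have hhp : ∀ x, x ≠ 0 → 0 < Real.sqrt (heatExt g t (unitDir x)) := fun x hx =>
    Real.sqrt_pos.2 (hpos x hx)
  have e : ∀ σ : S2, supForm (fun x => Real.sqrt (heatExt g t (unitDir x)) ^ 2) σ =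
      ⨆ k, ENNReal.ofReal (∫ y : S2, g y * kerForm k t σ y ∂surface) := by
    intro σ
    have hc : ∀ x, x ≠ 0 → Real.sqrt (heatExt g t (unitDir x)) ^ 2 = heatExt g t (unitDir x) :=
      fun x hx => Real.sq_sqrt (hpos x hx).le
    simp only [supForm, integral_kerForm hg ht, rot_congr hc, rotLap_congr hc,
      rotLap_comp_unitDir hs (sphere_ne_zero σ), rot_comp_unitDir hs _ (sphere_ne_zero σ),
      unitDir_sphere, Real.sq_sqrt (heatExt_pos hg h0 hz ht (sphere_norm σ)).le]
  have h1 := lintegral_sq_le_supForm hh hhp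
  have h2 := lintegral_supForm_le hh hhp
  simp_rw [e] at h1 h2
  rw [← hh.sobolevH2Sq_eq] at h1 h2
  simp only [unitDir_sphere] at h1 h2
  exact ⟨h1, h2⟩

theorem sphK_le_formK {g : S2 → ℝ} (hg : Integrable g surface) (h0 : ∀ σ, 0 ≤ g σ) (ω : ℝ → ℝ) :
    sphK ω g ≤ formK ω g := by
  rw [sphK_eq hg]
  refine setLIntegral_mono' measurableSet_Ioi fun t ht => ?_
  gcongr
  exact (sobolevH2Sq_sqrt_heatExt hg h0 ht).1

theorem formK_le_sphK {g : S2 → ℝ} (hg : Integrable g surface) (h0 : ∀ σ, 0 ≤ g σ) (ω : ℝ → ℝ) :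
    formK ω g ≤ 17 * sphK ω g := by
  rw [sphK_eq hg, ← lintegral_const_mul' _ _ (by norm_num)]
  refine setLIntegral_mono' measurableSet_Ioi fun t ht => ?_
  rw [← mul_assoc]
  gcongr
  exact (sobolevH2Sq_sqrt_heatExt hg h0 ht).2

end KacBoltzmann

end

noncomputable section

namespace KacBoltzmann

/-! ### Center of mass and relative velocity -/

theorem lintegral_polar {f : E3 → ℝ≥0∞} (hf : Measurable f) :
    ∫⁻ x, f x = ∫⁻ r in Set.Ioi (0 : ℝ), (∫⁻ σ : S2, f (r • (σ : E3)) ∂surface) *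
      ENNReal.ofReal (r ^ 2) := by
  have h1 : ∫⁻ x, f x = ∫⁻ x : ({(0)}ᶜ : Set E3), f x.1 ∂((volume : Measure E3).comap (↑)) := by
    rw [lintegral_subtype_comap (measurableSet_singleton _).compl, restrict_compl_singleton]
  have hm : Measurable fun p : S2 × Set.Ioi (0 : ℝ) => f ((p.2 : ℝ) • (p.1 : E3)) :=
    hf.comp (by fun_prop)
  have h2 : ∫⁻ x, f x = ∫⁻ p : S2 × Set.Ioi (0 : ℝ), f ((p.2 : ℝ) • (p.1 : E3))
      ∂(surface.prod (Measure.volumeIoiPow 2)) := by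
    rw [h1, ← measurePreserving_polar.lintegral_comp hm]
    refine lintegral_congr fun x => ?_
    have hx : ‖(x : E3)‖ ≠ 0 := norm_ne_zero_iff.2 x.2
    simp [smul_smul, mul_inv_cancel₀ hx]
  have hm2 : Measurable fun r : ℝ => (∫⁻ σ : S2, f (r • (σ : E3)) ∂surface) := by
    refine Measurable.lintegral_prod_right' (f := fun p : ℝ × S2 => f (p.1 • (p.2 : E3))) ?_
    exact hf.comp (by fun_prop)
  have hm3 : Measurable fun r : Set.Ioi (0 : ℝ) => ∫⁻ σ : S2, f ((r : ℝ) • (σ : E3)) ∂surface :=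
    hm2.comp measurable_subtype_coe
  rw [h2, lintegral_prod_symm' _ hm, Measure.volumeIoiPow]
  dsimp only
  rw [lintegral_withDensity_eq_lintegral_mul _ (by fun_prop) hm3]
  simp only [Pi.mul_apply]
  rw [← lintegral_subtype_comap measurableSet_Ioi (fun r : ℝ =>
    (∫⁻ σ : S2, f (r • (σ : E3)) ∂surface) * ENNReal.ofReal (r ^ 2))]
  exact lintegral_congr fun r => mul_comm _ _

/-- With v fixed, w = v − 2y scales volume by 2³. Translating v by y then centres the pair at z. -/
theorem lintegral_relative {f : E3 → E3 → ℝ≥0∞} (hf : Measurable (Function.uncurry f)) :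
    ∫⁻ v, ∫⁻ w, f v w = 8 * ∫⁻ z, ∫⁻ y, f (z + y) (z - y) := by
  have h1 : ∀ v, ∫⁻ w, f v w = 8 * ∫⁻ y, f v (v - (2 : ℝ) • y) := by
    intro v
    have hfv : Measurable (f v) := hf.of_uncurry_left
    have e1 : ∫⁻ w, f v w = ∫⁻ w, f v (v - w) :=
      (lintegral_sub_left_eq_self (fun w => f v w) v).symm
    have e2 := lintegral_map (μ := (volume : Measure E3)) (g := fun y : E3 => (2 : ℝ) • y)
      (f := fun w => f v (v - w)) (by fun_prop) (by fun_prop)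
    rw [e1, ← e2, Measure.map_addHaar_smul _ (by norm_num : (2 : ℝ) ≠ 0), lintegral_smul_measure,
      smul_eq_mul, ← mul_assoc]
    have : (8 : ℝ≥0∞) * ENNReal.ofReal |((2 : ℝ) ^ Module.finrank ℝ E3)⁻¹| = 1 := by
      rw [finrank_euclideanSpace_fin, abs_of_pos (by norm_num), ← ENNReal.ofReal_ofNat,
        ← ENNReal.ofReal_mul (by norm_num)]
      norm_num
    rw [this, one_mul]
  have hm : Measurable fun p : E3 × E3 => f p.1 (p.1 - (2 : ℝ) • p.2) :=
    hf.comp (by fun_prop : Measurable fun p : E3 × E3 => (p.1, p.1 - (2 : ℝ) • p.2))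
  have hm2 : Measurable fun p : E3 × E3 => f (p.1 + p.2) (p.1 - p.2) :=
    hf.comp (by fun_prop : Measurable fun p : E3 × E3 => (p.1 + p.2, p.1 - p.2))
  simp_rw [h1]
  rw [lintegral_const_mul _ (hm.lintegral_prod_right'), lintegral_lintegral_swap hm.aemeasurable,
    lintegral_lintegral_swap (f := fun z y : E3 => f (z + y) (z - y)) hm2.aemeasurable]
  congr 1
  refine lintegral_congr fun y => ?_
  rw [← lintegral_add_right_eq_self (fun x => f x (x - (2 : ℝ) • y)) y]
  refine lintegral_congr fun x => ?_
  congr 1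
  rw [two_smul]; abel

theorem lintegral_config_cons {n : ℕ} {f : Config (n + 1) → ℝ≥0∞} (hf : Measurable f) :
    ∫⁻ v, f v = ∫⁻ x : E3, ∫⁻ w : Config n, f (Fin.cons x w) := by
  have h := (volume_preserving_piFinSuccAbove (fun _ : Fin (n + 1) => E3) 0).symm
  rw [← h.lintegral_comp hf, Measure.volume_eq_prod, lintegral_prod]
  · simp [MeasurableEquiv.piFinSuccAbove, Fin.insertNthEquiv]
  · exact (hf.comp (MeasurableEquiv.measurable _)).aemeasurable

theorem measurable_fin_cons {n : ℕ} :
    Measurable fun p : E3 × Config n => (Fin.cons p.1 p.2 : Config (n + 1)) := by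
  refine measurable_pi_iff.2 fun i => ?_
  refine Fin.cases ?_ (fun j => ?_) i
  · simpa using measurable_fst
  · simp only [Fin.cons_succ]
    exact (measurable_pi_apply j).comp measurable_snd

/-- The measure `8 r² dr` on the half-line. -/
def radiusMeasure : Measure ℝ :=
  (volume.restrict (Set.Ioi 0)).withDensity fun r => ENNReal.ofReal (8 * r ^ 2)

instance : SigmaFinite radiusMeasure :=
  SigmaFinite.withDensity_ofReal _

theorem lintegral_radiusMeasure (f : ℝ → ℝ≥0∞) :
    ∫⁻ r, f r ∂radiusMeasure = ∫⁻ r in Set.Ioi (0 : ℝ), f r * ENNReal.ofReal (8 * r ^ 2) := by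
  rw [radiusMeasure, lintegral_withDensity_eq_lintegral_mul_non_measurable _ (by fun_prop)
    (Eventually.of_forall fun _ => ENNReal.ofReal_lt_top)]
  exact lintegral_congr fun r => mul_comm _ _

/-- The parameters `(z, r, v_3, …, v_N)`. -/
abbrev Param (N : ℕ) : Type := E3 × ℝ × Config (N - 2)

/-- The measure `8 r² dz dr dv_3 … dv_N`. -/
def paramMeasure (N : ℕ) : Measure (Param N) := volume.prod (radiusMeasure.prod volume)

instance (N : ℕ) : SigmaFinite (paramMeasure N) :=
  inferInstanceAs (SigmaFinite (volume.prod (radiusMeasure.prod volume)))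

/-- The configuration with parameters `p` and direction `σ`. -/
def zrsMap (N : ℕ) (q : Param N × S2) : Config N := zrsConfig N q.1.1 q.1.2.1 q.2 q.1.2.2

theorem continuous_zrsMap (N : ℕ) : Continuous (zrsMap N) := by
  refine continuous_pi fun i => ?_
  simp only [zrsMap, zrsConfig]
  split_ifs <;> fun_prop

theorem zrsConfig_eq_cons (M : ℕ) (z : E3) (r : ℝ) (σ : S2) (w : Config M) :
    zrsConfig (M + 2) z r σ w = Fin.cons (z + r • (σ : E3)) (Fin.cons (z - r • (σ : E3)) w) := by
  funext i
  refine Fin.cases ?_ (fun j => Fin.cases ?_ (fun k => ?_) j) i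
  · simp [zrsConfig]
  · simp [zrsConfig]
  · simp only [Fin.cons_succ, zrsConfig]
    simp

theorem lintegral_paramMeasure {N : ℕ} {f : Param N → ℝ≥0∞} (hf : Measurable f) :
    ∫⁻ p, f p ∂paramMeasure N = ∫⁻ z : E3, ∫⁻ r in Set.Ioi (0 : ℝ), ∫⁻ w : Config (N - 2),
      f (z, r, w) * ENNReal.ofReal (8 * r ^ 2) := by
  rw [paramMeasure, lintegral_prod _ hf.aemeasurable]
  refine lintegral_congr fun z => ?_
  rw [lintegral_prod _ (by fun_prop), lintegral_radiusMeasure]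
  refine lintegral_congr fun r => ?_
  rw [lintegral_mul_const _ (by fun_prop)]

/-- Measurability is not assumed: the integrand of `densK` contains an infimum over heat flows. The
iterated integral always dominates the integral over the product, which is the direction needed for
lower bounds. -/
theorem lintegral_paramMeasure_le {N : ℕ} (f : Param N → ℝ≥0∞) :
    ∫⁻ p, f p ∂paramMeasure N ≤ ∫⁻ z : E3, ∫⁻ r in Set.Ioi (0 : ℝ), ∫⁻ w : Config (N - 2),
      f (z, r, w) * ENNReal.ofReal (8 * r ^ 2) := by
  refine (lintegral_prod_le _).trans (lintegral_mono fun z => ?_)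
  refine (lintegral_prod_le _).trans ?_
  rw [lintegral_radiusMeasure]
  refine lintegral_mono fun r => ?_
  rw [lintegral_mul_const' _ _ ENNReal.ofReal_ne_top]

theorem ae_paramMeasure {N : ℕ} {P : Param N → Prop} (h : ∀ᵐ p ∂paramMeasure N, P p) :
    ∀ᵐ z : E3, ∀ᵐ r ∂(volume.restrict (Set.Ioi (0 : ℝ))), ∀ᵐ w : Config (N - 2), P (z, r, w) := by
  have h1 := Measure.ae_ae_of_ae_prod h
  filter_upwards [h1] with z hz
  have h2 := Measure.ae_ae_of_ae_prod hz
  rw [radiusMeasure, ae_withDensity_iff (by fun_prop)] at h2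
  filter_upwards [h2, ae_restrict_mem measurableSet_Ioi] with r hr hr0
  refine hr ?_
  have : (0 : ℝ) < r := hr0
  rw [Ne, ENNReal.ofReal_eq_zero, not_le]
  positivity

/-- The relative coordinates contribute the factor 8 and polar coordinates for y = rσ contribute r².
Together they form the density of `radiusMeasure`. -/
theorem measurePreserving_zrsMap {N : ℕ} (hN : 2 ≤ N) :
    MeasurePreserving (zrsMap N) ((paramMeasure N).prod surface) volume := by
  obtain ⟨M, rfl⟩ : ∃ M, N = M + 2 := ⟨N - 2, by omega⟩
  refine ⟨(continuous_zrsMap _).measurable, Measure.ext_of_lintegral _ fun f hf => ?_⟩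
  have hfz : Measurable fun q : Param (M + 2) × S2 => f (zrsMap (M + 2) q) :=
    hf.comp (continuous_zrsMap _).measurable
  rw [lintegral_map hf (continuous_zrsMap _).measurable, lintegral_prod _ hfz.aemeasurable,
    lintegral_paramMeasure hfz.lintegral_prod_right']
  rw [lintegral_config_cons hf]
  have hf2 : ∀ x, Measurable fun w : Config (M + 1) => f (Fin.cons x w) := fun x =>
    hf.comp (measurable_fin_cons.comp measurable_prodMk_left)
  simp_rw [lintegral_config_cons (hf2 _)]
  have hm3 : Measurable fun q : (E3 × E3) × Config M =>
      f (Fin.cons q.1.1 (Fin.cons q.1.2 q.2 : Config (M + 1))) := by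
    have h1 : Measurable fun q : (E3 × E3) × Config M =>
        (Fin.cons q.1.2 q.2 : Config (M + 1)) :=
      measurable_fin_cons.comp (by fun_prop : Measurable fun q : (E3 × E3) × Config M =>
        (q.1.2, q.2))
    have h2 : Measurable fun q : (E3 × E3) × Config M =>
        (q.1.1, (Fin.cons q.1.2 q.2 : Config (M + 1))) := (by fun_prop : Measurable
          fun q : (E3 × E3) × Config M => q.1.1).prodMk h1
    exact hf.comp (measurable_fin_cons.comp h2)
  rw [lintegral_relative (f := fun x y => ∫⁻ w : Config M, f (Fin.cons x (Fin.cons y w)))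
    (by exact hm3.lintegral_prod_right')]
  rw [← lintegral_const_mul' _ _ (by norm_num)]
  refine lintegral_congr fun z => ?_
  have hm4 : Measurable fun q : E3 × Config M =>
      f (Fin.cons (z + q.1) (Fin.cons (z - q.1) q.2 : Config (M + 1))) :=
    hm3.comp (by fun_prop : Measurable fun q : E3 × Config M => ((z + q.1, z - q.1), q.2))
  rw [lintegral_polar (f := fun y => ∫⁻ w : Config M, f (Fin.cons (z + y) (Fin.cons (z - y) w)))
    hm4.lintegral_prod_right', ← lintegral_const_mul' _ _ (by norm_num)]
  refine lintegral_congr fun r => ?_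
  have hm5 : Measurable fun q : S2 × Config M =>
      f (Fin.cons (z + r • (q.1 : E3)) (Fin.cons (z - r • (q.1 : E3)) q.2 : Config (M + 1))) :=
    hm4.comp (by fun_prop : Measurable fun q : S2 × Config M => (r • (q.1 : E3), q.2))
  rw [lintegral_lintegral_swap hm5.aemeasurable, lintegral_mul_const' _ _ ENNReal.ofReal_ne_top,
    mul_left_comm, ENNReal.ofReal_mul (by norm_num), ENNReal.ofReal_ofNat]
  congr 1
  refine lintegral_congr fun w => lintegral_congr fun σ => ?_
  rw [zrsMap, zrsConfig_eq_cons]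

end KacBoltzmann

end

noncomputable section

namespace KacBoltzmann

/-! ### Approximation tools -/

theorem ofReal_integral_le {α : Type*} [MeasurableSpace α] {μ : Measure α} (f : α → ℝ) :
    ENNReal.ofReal (∫ x, f x ∂μ) ≤ ∫⁻ x, ENNReal.ofReal (f x) ∂μ := by
  by_cases hf : Integrable f μ
  · rw [integral_eq_lintegral_pos_part_sub_lintegral_neg_part hf]
    refine (ENNReal.ofReal_le_ofReal (sub_le_self _ ENNReal.toReal_nonneg)).trans ?_
    exact ENNReal.ofReal_toReal_le
  · simp [integral_undef hf]

/-- The indicator is approximated by a bounded continuous function in L¹ of the finite measure |d|μ.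
Clamping to [0,1] only brings the function closer to the indicator. -/
theorem exists_continuous_approx_indicator {X : Type*} [MetricSpace X] [MeasurableSpace X]
    [BorelSpace X] {μ : Measure X} {d : X → ℝ} (hdm : Measurable d) (hd : Integrable d μ) {A : Set X}
    (hA : MeasurableSet A) {ε : ℝ} (hε : 0 < ε) :
    ∃ b : X → ℝ, Continuous b ∧ (∀ x, 0 ≤ b x) ∧ (∀ x, b x ≤ 1) ∧
      ∫ x, A.indicator d x ∂μ ≤ ∫ x, b x * d x ∂μ + ε := by
  set ν := μ.withDensity fun x => ‖d x‖ₑ with hν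
  have : IsFiniteMeasure ν := isFiniteMeasure_withDensity hd.2.ne
  have hi : Integrable (A.indicator fun _ => (1 : ℝ)) ν := (integrable_const 1).indicator hA
  obtain ⟨f, hf, -⟩ := hi.exists_boundedContinuous_lintegral_sub_le (ε := ENNReal.ofReal ε)
    (by simpa using hε)
  have hbc : Continuous fun x => max 0 (min 1 (f x)) := by fun_prop
  refine ⟨fun x => max 0 (min 1 (f x)), hbc, fun x => le_max_left _ _,
    fun x => max_le zero_le_one (min_le_left _ _), ?_⟩
  have hb : ∀ x, ‖A.indicator (fun _ => (1 : ℝ)) x - max 0 (min 1 (f x))‖ₑ ≤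
      ‖A.indicator (fun _ => (1 : ℝ)) x - f x‖ₑ := by
    intro x
    rw [← ofReal_norm, ← ofReal_norm]
    refine ENNReal.ofReal_le_ofReal ?_
    simp only [Real.norm_eq_abs]
    by_cases hx : x ∈ A
    · simp only [hx, Set.indicator_of_mem]
      rcases le_total 1 (f x) with h | h
      · rw [min_eq_left h]; simp
      · rw [min_eq_right h, abs_of_nonneg (sub_nonneg.2 h),
          abs_of_nonneg (sub_nonneg.2 (max_le zero_le_one h))]
        linarith [le_max_right 0 (f x)]
    · simp only [hx, not_false_eq_true, Set.indicator_of_notMem, zero_sub, abs_neg]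
      rw [abs_of_nonneg (le_max_left _ _)]
      exact max_le (abs_nonneg _) ((min_le_right _ _).trans (le_abs_self _))
  have hm : Measurable fun x => ‖A.indicator (fun _ => (1 : ℝ)) x - max 0 (min 1 (f x))‖ₑ :=
    ((measurable_const.indicator hA).sub hbc.measurable).enorm
  have h1 : ∫⁻ x, ‖(A.indicator (fun _ => (1 : ℝ)) x - max 0 (min 1 (f x))) * d x‖ₑ ∂μ ≤
      ENNReal.ofReal ε := by
    refine le_trans (le_of_eq ?_) ((lintegral_mono hb).trans hf)
    rw [hν, lintegral_withDensity_eq_lintegral_mul _ hdm.enorm hm]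
    refine lintegral_congr fun x => ?_
    rw [enorm_mul, mul_comm]; rfl
  have i1 : Integrable (A.indicator d) μ := hd.indicator hA
  have i2 : Integrable (fun x => max 0 (min 1 (f x)) * d x) μ := by
    refine hd.bdd_mul (c := 1) hbc.aestronglyMeasurable (Eventually.of_forall fun x => ?_)
    rw [Real.norm_of_nonneg (le_max_left _ _)]
    exact max_le zero_le_one (min_le_left _ _)
  have h2 : ‖∫ x, (A.indicator d x - max 0 (min 1 (f x)) * d x) ∂μ‖ₑ ≤ ENNReal.ofReal ε := by
    refine (enorm_integral_le_lintegral_enorm _).trans (le_trans (le_of_eq ?_) h1)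
    refine lintegral_congr fun x => ?_
    congr 1
    by_cases hx : x ∈ A <;> simp [hx, sub_mul]
  rw [integral_sub i1 i2, ← ofReal_norm, ENNReal.ofReal_le_ofReal_iff hε.le,
    Real.norm_eq_abs] at h2
  linarith [le_abs_self (∫ x, A.indicator d x ∂μ - ∫ x, max 0 (min 1 (f x)) * d x ∂μ)]

/-- The integral of a finite maximum is approximated by continuous convex combinations. -/
theorem exists_continuous_partition {X : Type*} [MetricSpace X] [MeasurableSpace X]
    [BorelSpace X] {μ : Measure X} {h : ℕ → X → ℝ} (hm : ∀ k, Measurable (h k))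
    (hi : ∀ k, Integrable (h k) μ) (K : ℕ) {ε : ℝ} (hε : 0 < ε) :
    ∃ a : ℕ → X → ℝ, (∀ k, Continuous (a k)) ∧ (∀ k x, 0 ≤ a k x) ∧
      (∀ x, ∑ k ∈ Finset.range (K + 1), a k x = 1) ∧
      ∫ x, partialSups h K x ∂μ ≤ ∫ x, ∑ k ∈ Finset.range (K + 1), a k x * h k x ∂μ + ε := by
  induction K generalizing ε with
  | zero =>
    refine ⟨fun _ _ => 1, fun _ => continuous_const, fun _ _ => zero_le_one, by simp, ?_⟩
    simp [hε.le]
  | succ K ih =>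
    obtain ⟨a, hac, ha0, ha1, hale⟩ := ih (half_pos hε)
    have hsle : ∀ k x, k ≤ K → h k x ≤ partialSups h K x := fun k x hk =>
      le_partialSups_of_le h hk x
    have ha1' : ∀ k ∈ Finset.range (K + 1), ∀ x, a k x ≤ 1 := fun k hk x => by
      rw [← ha1 x]; exact Finset.single_le_sum (f := fun k => a k x) (fun i _ => ha0 i x) hk
    set θ : X → ℝ := fun x => ∑ k ∈ Finset.range (K + 1), a k x * h k x with hθ
    have hθm : Measurable θ :=
      Finset.measurable_fun_sum _ fun k _ => (hac k).measurable.mul (hm k)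
    have hθi : Integrable θ μ := by
      refine integrable_finsetSum _ fun k hk => ?_
      refine (hi k).bdd_mul (c := 1) (hac k).aestronglyMeasurable (Eventually.of_forall fun x => ?_)
      rw [Real.norm_of_nonneg (ha0 k x)]
      exact ha1' k hk x
    have hSi : ∀ n, Integrable (partialSups h n) μ := by
      intro n
      induction n with
      | zero => simpa using hi 0
      | succ n ihn => rw [partialSups_add_one]; exact ihn.sup (hi _)
    have hθle : ∀ x, θ x ≤ partialSups h K x := by
      intro x
      calc θ x ≤ ∑ k ∈ Finset.range (K + 1), a k x * partialSups h K x := by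
            refine Finset.sum_le_sum fun k hk => ?_
            exact mul_le_mul_of_nonneg_left (hsle k x (by simpa [Nat.lt_succ_iff] using hk)) (ha0 k x)
        _ = _ := by rw [← Finset.sum_mul, ha1, one_mul]
    have hdm : Measurable fun x => h (K + 1) x - θ x := (hm _).sub hθm
    have hdi : Integrable (fun x => h (K + 1) x - θ x) μ := (hi _).sub hθi
    -- On this set the new function beats the current combination θ. The new combination is θ +
    -- b(h_{K+1} − θ), with b a continuous replacement of the indicator of A.
    set A : Set X := {x | 0 < h (K + 1) x - θ x} with hAdef
    have hA : MeasurableSet A := measurableSet_lt measurable_const hdm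
    obtain ⟨b, hbc, hb0, hb1, hble⟩ :=
      exists_continuous_approx_indicator hdm hdi hA (half_pos hε)
    refine ⟨fun k x => if k = K + 1 then b x else (1 - b x) * a k x, fun k => ?_, fun k x => ?_,
      fun x => ?_, ?_⟩
    · by_cases hk : k = K + 1
      · simpa [hk] using hbc
      · simp only [hk, if_false]
        exact (continuous_const.sub hbc).mul (hac k)
    · dsimp only
      split_ifs
      · exact hb0 x
      · exact mul_nonneg (by linarith [hb1 x]) (ha0 k x)
    · dsimp only
      rw [Finset.sum_range_succ, if_pos rfl, Finset.sum_congr rfl (g := fun k => (1 - b x) * a k x),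
        ← Finset.mul_sum, ha1]
      · ring
      · intro k hk
        rw [if_neg (by have := Finset.mem_range.1 hk; omega)]
    · have e : ∀ x, ∑ k ∈ Finset.range (K + 1 + 1),
          (if k = K + 1 then b x else (1 - b x) * a k x) * h k x =
          θ x + b x * (h (K + 1) x - θ x) := by
        intro x
        rw [Finset.sum_range_succ, if_pos rfl,
          Finset.sum_congr rfl (g := fun k => (1 - b x) * (a k x * h k x)), ← Finset.mul_sum]
        · simp only [hθ]; ring
        · intro k hk
          rw [if_neg (by have := Finset.mem_range.1 hk; omega)]; ring
      have ib : Integrable (fun x => b x * (h (K + 1) x - θ x)) μ := by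
        refine hdi.bdd_mul (c := 1) hbc.aestronglyMeasurable (Eventually.of_forall fun x => ?_)
        rw [Real.norm_of_nonneg (hb0 x)]; exact hb1 x
      have iA : Integrable (A.indicator fun x => h (K + 1) x - θ x) μ := hdi.indicator hA
      simp_rw [e]
      rw [integral_add hθi ib]
      -- On A one uses θ ≤ max_{k ≤ K} h_k; off A the new function does not exceed θ. No comparison
      -- with the exact maximizer is needed.
      have hmax : ∀ x, partialSups h (K + 1) x ≤ partialSups h K x +
          A.indicator (fun x => h (K + 1) x - θ x) x := by
        intro x
        rw [partialSups_add_one, Pi.sup_apply]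
        refine sup_le ?_ ?_
        · have : 0 ≤ A.indicator (fun x => h (K + 1) x - θ x) x :=
            Set.indicator_nonneg (fun y hy => le_of_lt hy) x
          linarith
        · by_cases hx : x ∈ A
          · rw [Set.indicator_of_mem hx]; linarith [hθle x]
          · rw [Set.indicator_of_notMem hx]
            have : h (K + 1) x - θ x ≤ 0 := not_lt.1 hx
            linarith [hθle x]
      have h3 : ∫ x, partialSups h (K + 1) x ∂μ ≤ ∫ x, (partialSups h K x +
          A.indicator (fun x => h (K + 1) x - θ x) x) ∂μ :=
        integral_mono (hSi _) (by exact (hSi K).add iA) hmax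
      rw [integral_add (hSi K) iA] at h3
      linarith

/-- A non-negative lower semicontinuous function on the half-line is a limit of bounded continuous
functions that lie below it and vanish near the origin. -/
theorem exists_continuous_approx_below {β : ℝ → ℝ} (hβ : LowerSemicontinuous β)
    (hβ0 : ∀ r, 0 ≤ β r) :
    ∃ b : ℕ → ℝ → ℝ, (∀ n, Continuous (b n)) ∧ (∀ n r, 0 ≤ b n r) ∧ (∀ n r, b n r ≤ β r) ∧
      (∀ n r, b n r ≤ n) ∧ (∀ (n : ℕ) r, r ≤ 1 / (n + 1 : ℝ) → b n r = 0) ∧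
      ∀ r, 0 < r → Tendsto (fun n => b n r) atTop (𝓝 (β r)) := by
  -- The infimal convolution of min(β, n) with n|·| is n-Lipschitz and lies below β. Lower
  -- semicontinuity gives its convergence to β.
  set γ : ℕ → ℝ → ℝ := fun n r => ⨅ s : ℝ, (min (β s) n + n * dist r s) with hγ
  have hnn : ∀ (n : ℕ) r s, 0 ≤ min (β s) n + n * dist r s := fun n r s =>
    add_nonneg (le_min (hβ0 s) n.cast_nonneg) (by positivity)
  have hbdd : ∀ (n : ℕ) r, BddBelow (Set.range fun s : ℝ => min (β s) n + n * dist r s) :=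
    fun n r => ⟨0, by rintro _ ⟨s, rfl⟩; exact hnn n r s⟩
  have hγ0 : ∀ n r, 0 ≤ γ n r := fun n r => Real.iInf_nonneg fun s => hnn n r s
  have hγle : ∀ (n : ℕ) r, γ n r ≤ min (β r) n := fun n r => by
    have := ciInf_le (hbdd n r) r
    simpa using this
  have hγc : ∀ n, Continuous (γ n) := by
    intro n
    refine (LipschitzWith.of_le_add_mul (n : NNReal) fun x y => ?_).continuous
    rw [← sub_le_iff_le_add]
    refine le_ciInf fun s => ?_
    rw [sub_le_iff_le_add]
    refine (ciInf_le (hbdd n x) s).trans ?_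
    have := dist_triangle x y s
    have hn : (0 : ℝ) ≤ n := n.cast_nonneg
    simp only [NNReal.coe_natCast]
    nlinarith
  have hγt : ∀ r, Tendsto (fun n => γ n r) atTop (𝓝 (β r)) := by
    intro r
    refine tendsto_order.2 ⟨fun c hc => ?_, fun c hc => Eventually.of_forall fun n =>
      ((hγle n r).trans (min_le_left _ _)).trans_lt hc⟩
    obtain ⟨c', hcc', hc'⟩ := exists_between hc
    obtain ⟨δ, hδ, hball⟩ := Metric.eventually_nhds_iff.1 (hβ r c' hc')
    obtain ⟨n0, hn0⟩ := exists_nat_ge (max c' (c' / δ))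
    filter_upwards [eventually_ge_atTop n0] with n hn
    refine hcc'.trans_le (le_ciInf fun s => ?_)
    have hnr : max c' (c' / δ) ≤ n := hn0.trans (by exact_mod_cast hn)
    have h1 := (le_max_left _ _).trans hnr
    have h2 := (le_max_right _ _).trans hnr
    rw [div_le_iff₀ hδ] at h2
    have hn' : (0 : ℝ) ≤ n := n.cast_nonneg
    by_cases hs : dist s r < δ
    · have := le_min (hball hs).le h1
      have : 0 ≤ n * dist r s := by positivity
      linarith
    · push Not at hs
      rw [dist_comm] at hs
      have h3 := mul_le_mul_of_nonneg_left hs hn'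
      have := le_min (hβ0 s) hn'
      linarith
  -- This ramp vanishes for r ≤ 1/(n+1), where the direction of the relative velocity becomes
  -- singular, and equals one for r ≥ 2/(n+1).
  set ζ : ℕ → ℝ → ℝ := fun n r => max 0 (min 1 ((n + 1 : ℝ) * r - 1)) with hζ
  have hζ0 : ∀ n r, 0 ≤ ζ n r := fun n r => le_max_left _ _
  have hζ1 : ∀ n r, ζ n r ≤ 1 := fun n r => max_le zero_le_one (min_le_left _ _)
  refine ⟨fun n r => γ n r * ζ n r, fun n => (hγc n).mul (by fun_prop),
    fun n r => mul_nonneg (hγ0 n r) (hζ0 n r), fun n r => ?_, fun n r => ?_, fun n r hr => ?_,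
    fun r hr => ?_⟩
  · exact (mul_le_of_le_one_right (hγ0 n r) (hζ1 n r)).trans ((hγle n r).trans (min_le_left _ _))
  · exact (mul_le_of_le_one_right (hγ0 n r) (hζ1 n r)).trans ((hγle n r).trans (min_le_right _ _))
  · have hn : (0 : ℝ) < n + 1 := by positivity
    rw [le_div_iff₀ hn] at hr
    have : ζ n r = 0 := max_eq_left ((min_le_right _ _).trans (by linarith))
    simp only [this, mul_zero]
  · have : Tendsto (fun n : ℕ => ζ n r) atTop (𝓝 1) := by
      refine tendsto_const_nhds.congr' ?_
      obtain ⟨n0, hn0⟩ := exists_nat_ge (2 / r)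
      filter_upwards [eventually_ge_atTop n0] with n hn
      have h1 : 2 / r ≤ n := hn0.trans (by exact_mod_cast hn)
      rw [div_le_iff₀ hr] at h1
      simp only [hζ]
      rw [min_eq_left (by nlinarith), max_eq_right zero_le_one]
    simpa using (hγt r).mul this

end KacBoltzmann

end

noncomputable section

namespace KacBoltzmann

/-! ### Test functions -/

/-- A function on configurations whose pairing with any density on a sphere is controlled by the
functional of that density. -/
def IsAdmissible (ω β : ℝ → ℝ) (N : ℕ) (Ψ : Config N → ℝ) : Prop :=
  ∀ p : Param N, 0 < p.2.1 → ∀ g : S2 → ℝ, Integrable g surface → (∀ σ, 0 ≤ g σ) →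
    ENNReal.ofReal (∫ σ, Ψ (zrsMap N (p, σ)) * g σ ∂surface) ≤
      ENNReal.ofReal (β p.2.1) * formK ω g

theorem ae_paramMeasure_pos (N : ℕ) : ∀ᵐ p ∂paramMeasure N, 0 < p.2.1 := by
  have h1 : ∀ᵐ r ∂radiusMeasure, 0 < r :=
    (withDensity_absolutelyContinuous _ _).ae_le (ae_restrict_mem measurableSet_Ioi)
  have h2 : ∀ᵐ p ∂(radiusMeasure.prod (volume : Measure (Config (N - 2)))), 0 < p.1 :=
    Measure.quasiMeasurePreserving_fst.ae h1
  exact Measure.quasiMeasurePreserving_snd.ae h2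

section

variable {N : ℕ} {F : Config N → ℝ}

theorem integrable_comp_zrsMap (hN : 2 ≤ N) (hF : Integrable F volume) :
    Integrable (fun q => F (zrsMap N q)) ((paramMeasure N).prod surface) := by
  have h := measurePreserving_zrsMap hN
  rw [← h.map_eq] at hF
  exact hF.comp_measurable h.measurable

theorem ae_integrable_slice (hN : 2 ≤ N) (hF : Integrable F volume) :
    ∀ᵐ p ∂paramMeasure N, Integrable (fun σ => F (zrsMap N (p, σ))) surface :=
  (integrable_comp_zrsMap hN hF).prod_right_ae

theorem integral_eq_integral_param (hN : 2 ≤ N) (hF : Integrable F volume) :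
    ∫ v, F v = ∫ p, ∫ σ, F (zrsMap N (p, σ)) ∂surface ∂paramMeasure N := by
  have h := measurePreserving_zrsMap hN
  rw [← integral_prod _ (integrable_comp_zrsMap hN hF), ← h.map_eq, integral_map]
  · exact h.measurable.aemeasurable
  · rw [h.map_eq]; exact hF.1

/-- On almost every sphere, admissibility compares the pairing with `formK`, and `formK` costs the
factor 17 against `sphK`. Integration over the parameters does the rest. -/
theorem ofReal_integral_mul_le_densK (hN : 2 ≤ N) {ω β : ℝ → ℝ} {Ψ : Config N → ℝ}
    (hΨm : Measurable Ψ) {C : ℝ} (hΨb : ∀ v, |Ψ v| ≤ C) (hΨ : IsAdmissible ω β N Ψ)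
    (hF : Integrable F volume) (hF0 : ∀ v, 0 ≤ F v) :
    ENNReal.ofReal (∫ v, Ψ v * F v) ≤ 17 * densK ω β N F := by
  have hi : Integrable (fun v => Ψ v * F v) volume :=
    hF.bdd_mul (c := C) hΨm.aestronglyMeasurable (Eventually.of_forall hΨb)
  rw [integral_eq_integral_param hN hi]
  refine (ofReal_integral_le _).trans ?_
  have h1 : ∫⁻ p, ENNReal.ofReal (∫ σ, Ψ (zrsMap N (p, σ)) * F (zrsMap N (p, σ)) ∂surface)
      ∂paramMeasure N ≤
      ∫⁻ p, 17 * (ENNReal.ofReal (β p.2.1) * sphK ω (fun σ => F (zrsMap N (p, σ))))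
        ∂paramMeasure N := by
    refine lintegral_mono_ae ?_
    filter_upwards [ae_paramMeasure_pos N, ae_integrable_slice hN hF] with p hp hpi
    refine (hΨ p hp _ hpi fun σ => hF0 _).trans ?_
    rw [mul_left_comm]
    gcongr
    exact formK_le_sphK hpi (fun σ => hF0 _) ω
  refine h1.trans ?_
  rw [lintegral_const_mul' _ _ (by norm_num)]
  gcongr
  exact lintegral_paramMeasure_le _

end

/-- The measure `dt dσ` on `(0, ∞) × 𝕊²`. -/
def timeSphere : Measure (ℝ × S2) := (volume.restrict (Set.Ioi (0 : ℝ))).prod surface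

instance : SigmaFinite timeSphere :=
  inferInstanceAs (SigmaFinite ((volume.restrict (Set.Ioi (0 : ℝ))).prod surface))

/-- The kernels of the affine forms, extended by `0` to non-positive times. -/
def ker (k : ℕ) (q : (ℝ × S2) × E3) : ℝ := if 0 < q.1.1 then kerForm k q.1.1 q.1.2 q.2 else 0

theorem measurable_ker (k : ℕ) : Measurable (ker k) := by
  have h1 : ContinuousOn (fun q : (ℝ × S2) × E3 => kerForm k q.1.1 q.1.2 q.2) {q | 0 < q.1.1} :=
    (continuousOn_kerForm k).comp (f := fun q : (ℝ × S2) × E3 => (q.1.1, (q.1.2 : E3), q.2))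
      (by fun_prop) fun q hq => ⟨hq, trivial⟩
  exact h1.measurable_piecewise (g := fun _ => 0) continuousOn_const
    (measurableSet_lt measurable_const (by fun_prop))

/-- The kernels with time restricted to a compact interval. -/
def kerCut (n k : ℕ) (q : (ℝ × S2) × E3) : ℝ :=
  kerForm k (min (max q.1.1 (1 / (n + 1))) (n + 1)) q.1.2 q.2

theorem continuous_kerCut (n k : ℕ) : Continuous (kerCut n k) := by
  refine (continuousOn_kerForm k).comp_continuous
    (f := fun q : (ℝ × S2) × E3 => (min (max q.1.1 (1 / (n + 1 : ℝ))) (n + 1), (q.1.2 : E3), q.2))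
    (by fun_prop) fun q => ⟨?_, trivial⟩
  have h1 : (0 : ℝ) < 1 / (n + 1) := by positivity
  have h2 : (0 : ℝ) < n + 1 := by positivity
  exact lt_min (lt_max_of_lt_right h1) h2

/-- The bound is needed on the whole unit ball and not only on the sphere, because `dirCut` shortens
small vectors. -/
theorem exists_bound_kerCut (n k : ℕ) : ∃ C, ∀ q : (ℝ × S2) × E3, ‖q.2‖ ≤ 1 → |kerCut n k q| ≤ C := by
  have hK : IsCompact (Set.Icc (1 / (n + 1 : ℝ)) (n + 1) ×ˢ
      (Metric.closedBall (0 : E3) 1 ×ˢ Metric.closedBall (0 : E3) 1)) :=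
    isCompact_Icc.prod ((isCompact_closedBall _ _).prod (isCompact_closedBall _ _))
  obtain ⟨C, hC⟩ := hK.exists_bound_of_continuousOn ((continuousOn_kerForm k).mono fun q hq =>
    ⟨lt_of_lt_of_le (by positivity : (0 : ℝ) < 1 / (n + 1)) hq.1.1, trivial⟩)
  refine ⟨C, fun q hq => hC (_, (q.1.2 : E3), q.2) ⟨⟨le_min (le_max_right _ _) ?_, min_le_right _ _⟩,
    ?_, ?_⟩⟩
  · have : (1 : ℝ) ≤ n + 1 := by linarith [n.cast_nonneg (α := ℝ)]
    exact ((div_le_one (by positivity)).2 this).trans this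
  · simp
  · simpa using hq

theorem kerCut_eq {n k : ℕ} {q : (ℝ × S2) × E3} (hq : q.1.1 ∈ Set.Icc (1 / (n + 1 : ℝ)) (n + 1)) :
    kerCut n k q = ker k q := by
  have : 0 < q.1.1 := lt_of_lt_of_le (by positivity : (0 : ℝ) < 1 / (n + 1)) hq.1
  rw [kerCut, ker, if_pos this, max_eq_left hq.1, min_eq_left hq.2]

/-- The truncated weight. -/
def weightCut (ω : ℝ → ℝ) (n : ℕ) (t : ℝ) : ℝ :=
  (Set.Icc (1 / (n + 1 : ℝ)) (n + 1)).indicator (fun t => min (ω t) n) t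

section

variable {ω : ℝ → ℝ}

theorem weightCut_nonneg (hω0 : ∀ t, 0 ≤ t → 0 ≤ ω t) (n : ℕ) (t : ℝ) : 0 ≤ weightCut ω n t := by
  refine Set.indicator_nonneg (fun t ht => le_min (hω0 t ?_) n.cast_nonneg) t
  exact (by positivity : (0 : ℝ) ≤ 1 / (n + 1)).trans ht.1

theorem weightCut_of_notMem {n : ℕ} {t : ℝ} (ht : t ∉ Set.Icc (1 / (n + 1 : ℝ)) (n + 1)) :
    weightCut ω n t = 0 := Set.indicator_of_notMem ht _

theorem weightCut_le_of_mem {n : ℕ} {t : ℝ} (ht : t ∈ Set.Icc (1 / (n + 1 : ℝ)) (n + 1)) :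
    weightCut ω n t ≤ ω t := by
  rw [weightCut, Set.indicator_of_mem ht]; exact min_le_left _ _

theorem measurable_weightCut (hω : Measurable ω) (n : ℕ) : Measurable (weightCut ω n) :=
  (hω.min measurable_const).indicator measurableSet_Icc

theorem integrable_weightCut (hω0 : ∀ t, 0 ≤ t → 0 ≤ ω t) (hω : Measurable ω) (n : ℕ) :
    Integrable (fun s : ℝ × S2 => weightCut ω n s.1) timeSphere := by
  have h1 : Integrable (weightCut ω n) (volume.restrict (Set.Ioi (0 : ℝ))) := by
    refine Integrable.mono' (g := (Set.Icc (1 / (n + 1 : ℝ)) (n + 1)).indicator fun _ => (n : ℝ))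
      ?_ (measurable_weightCut hω n).aestronglyMeasurable (Eventually.of_forall fun t => ?_)
    · exact ((integrable_indicator_iff measurableSet_Icc).2
        (integrableOn_const (by simp))).integrableOn
    · rw [Real.norm_of_nonneg (weightCut_nonneg hω0 n t)]
      exact Set.indicator_le_indicator (min_le_right _ _)
  have := h1.mul_prod (integrable_const (1 : ℝ) (μ := surface))
  simpa [timeSphere] using this

theorem tendsto_weightCut {t : ℝ} (ht : 0 < t) :
    Tendsto (fun n => weightCut ω n t) atTop (𝓝 (ω t)) := by
  refine tendsto_const_nhds.congr' ?_
  obtain ⟨n0, hn0⟩ := exists_nat_ge (max (max t (1 / t)) (ω t))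
  filter_upwards [eventually_ge_atTop n0] with n hn
  have h : max (max t (1 / t)) (ω t) ≤ n := hn0.trans (by exact_mod_cast hn)
  have h1 := (le_max_right _ _).trans h
  have h2 := (le_max_left _ _).trans ((le_max_left _ _).trans h)
  have h3 := (le_max_right _ _).trans ((le_max_left _ _).trans h)
  rw [weightCut, Set.indicator_of_mem, min_eq_left h1]
  refine ⟨?_, by linarith⟩
  rw [div_le_iff₀ (by positivity)]
  rw [div_le_iff₀ ht] at h3
  nlinarith

end

theorem formK_eq_timeSphere {g : S2 → ℝ} (hg : Measurable g) {ω : ℝ → ℝ} (hω : Measurable ω) :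
    formK ω g = ∫⁻ s, (⨆ k, ENNReal.ofReal (∫ y : S2, g y * ker k (s, (y : E3)) ∂surface)) *
      ENNReal.ofReal (ω s.1) ∂timeSphere := by
  have hm : ∀ k, Measurable fun s : ℝ × S2 => ∫ y : S2, g y * ker k (s, (y : E3)) ∂surface := by
    intro k
    have : Measurable fun q : (ℝ × S2) × S2 => g q.2 * ker k (q.1, (q.2 : E3)) :=
      (hg.comp measurable_snd).mul ((measurable_ker k).comp (by fun_prop))
    exact this.stronglyMeasurable.integral_prod_right'.measurable
  have hm2 : Measurable fun s : ℝ × S2 =>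
      (⨆ k, ENNReal.ofReal (∫ y : S2, g y * ker k (s, (y : E3)) ∂surface)) :=
    Measurable.iSup fun k => (hm k).ennreal_ofReal
  have hm3 : Measurable fun s : ℝ × S2 => ENNReal.ofReal (ω s.1) :=
    (hω.comp measurable_fst).ennreal_ofReal
  rw [timeSphere, lintegral_prod _ (by exact (hm2.mul hm3).aemeasurable), formK]
  refine setLIntegral_congr_fun measurableSet_Ioi fun t ht => ?_
  have ht : 0 < t := ht
  dsimp only
  rw [lintegral_mul_const' _ _ ENNReal.ofReal_ne_top]
  simp only [ker, ht, if_true]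

/-- Here g need not be Borel measurable, since admissibility quantifies over all integrable g. Only
the inequality between the product integral and the iterated one is available, and it suffices. -/
theorem lintegral_timeSphere_le_formK (g : S2 → ℝ) (ω : ℝ → ℝ) :
    ∫⁻ s, (⨆ k, ENNReal.ofReal (∫ y : S2, g y * ker k (s, (y : E3)) ∂surface)) *
      ENNReal.ofReal (ω s.1) ∂timeSphere ≤ formK ω g := by
  refine (lintegral_prod_le _).trans (le_of_eq ?_)
  refine setLIntegral_congr_fun measurableSet_Ioi fun t ht => ?_
  have ht : 0 < t := ht
  dsimp only
  rw [lintegral_mul_const' _ _ ENNReal.ofReal_ne_top]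
  simp only [ker, ht, if_true]

section

variable {N : ℕ}

/-- The parameters of a configuration. -/
def configParam (hN : 2 ≤ N) (v : Config N) : Param N :=
  ((1 / 2 : ℝ) • (v ⟨0, by omega⟩ + v ⟨1, by omega⟩), ‖v ⟨0, by omega⟩ - v ⟨1, by omega⟩‖ / 2,
    fun i => v ⟨i + 2, by omega⟩)

/-- The direction of a vector, cut off near the origin. -/
def dirCut (n : ℕ) (x : E3) : E3 := (max ‖x‖ (2 / (n + 1)))⁻¹ • x

theorem continuous_dirCut (n : ℕ) : Continuous (dirCut n) := by
  have h : ∀ x : E3, max ‖x‖ (2 / (n + 1)) ≠ 0 := fun x =>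
    (lt_max_of_lt_right (by positivity)).ne'
  exact (Continuous.inv₀ (by fun_prop) h).smul continuous_id

theorem norm_dirCut_le (n : ℕ) (x : E3) : ‖dirCut n x‖ ≤ 1 := by
  have h : 0 < max ‖x‖ (2 / (n + 1)) := lt_max_of_lt_right (by positivity)
  rw [dirCut, norm_smul, norm_inv, Real.norm_of_nonneg h.le, inv_mul_le_iff₀ h, mul_one]
  exact le_max_left _ _

theorem continuous_configParam (hN : 2 ≤ N) : Continuous (configParam hN) := by
  unfold configParam
  fun_prop

theorem zrsMap_zero (hN : 2 ≤ N) (p : Param N) (σ : S2) :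
    zrsMap N (p, σ) ⟨0, by omega⟩ = p.1 + p.2.1 • (σ : E3) := by simp [zrsMap, zrsConfig]

theorem zrsMap_one (hN : 2 ≤ N) (p : Param N) (σ : S2) :
    zrsMap N (p, σ) ⟨1, by omega⟩ = p.1 - p.2.1 • (σ : E3) := by simp [zrsMap, zrsConfig]

theorem zrsMap_relative (hN : 2 ≤ N) (p : Param N) (σ : S2) :
    zrsMap N (p, σ) ⟨0, by omega⟩ - zrsMap N (p, σ) ⟨1, by omega⟩ = (2 * p.2.1) • (σ : E3) := by
  rw [zrsMap_zero hN, zrsMap_one hN, mul_smul, two_smul]; abel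

theorem configParam_zrsMap (hN : 2 ≤ N) {p : Param N} (hp : 0 < p.2.1) (σ : S2) :
    configParam hN (zrsMap N (p, σ)) = p := by
  refine Prod.ext ?_ (Prod.ext ?_ ?_)
  · simp only [configParam]
    rw [zrsMap_zero hN, zrsMap_one hN, add_add_sub_cancel, ← two_smul ℝ p.1, smul_smul]
    norm_num
  · simp only [configParam]
    rw [zrsMap_relative hN, norm_smul, sphere_norm, Real.norm_of_nonneg (by linarith)]
    ring
  · funext i
    simp [configParam, zrsMap, zrsConfig]

/-- The relative velocity has length 2r, so the cutoff level 2/(n+1) is inactive exactly in the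
range r > 1/(n+1) where b may be non-zero. -/
theorem dirCut_zrsMap (hN : 2 ≤ N) {n : ℕ} {p : Param N} (hp : 1 / (n + 1 : ℝ) < p.2.1) (σ : S2) :
    dirCut n (zrsMap N (p, σ) ⟨0, by omega⟩ - zrsMap N (p, σ) ⟨1, by omega⟩) = σ := by
  have hp0 : 0 < p.2.1 := lt_trans (by positivity) hp
  rw [zrsMap_relative hN, dirCut, norm_smul, sphere_norm, Real.norm_of_nonneg (by linarith), mul_one,
    max_eq_left, smul_smul, inv_mul_cancel₀ (by positivity), one_smul]
  have : (2 : ℝ) / (n + 1) = 2 * (1 / (n + 1)) := by ring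
  rw [this]; linarith

/-- The test function with kernel `θ` and weights `b` and `c`. -/
def testFun (hN : 2 ≤ N) (n : ℕ) (b c : ℝ → ℝ) (θ : Param N × (ℝ × S2) × E3 → ℝ)
    (v : Config N) : ℝ :=
  b (configParam hN v).2.1 * ∫ s, c s.1 * θ (configParam hN v, s,
    dirCut n (v ⟨0, by omega⟩ - v ⟨1, by omega⟩)) ∂timeSphere

variable {b c : ℝ → ℝ} {θ : Param N × (ℝ × S2) × E3 → ℝ} {D : ℝ}

theorem continuous_testFun (hN : 2 ≤ N) (n : ℕ) (hb : Continuous b)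
    (hc : Integrable (fun s : ℝ × S2 => c s.1) timeSphere) (hθ : Continuous θ)
    (hD : ∀ p s y, ‖y‖ ≤ 1 → |θ (p, s, y)| ≤ D) : Continuous (testFun hN n b c θ) := by
  have hp := continuous_configParam hN
  have hd : Continuous fun v : Config N => dirCut n (v ⟨0, by omega⟩ - v ⟨1, by omega⟩) :=
    (continuous_dirCut n).comp (by fun_prop)
  refine (hb.comp (by fun_prop)).mul ?_
  refine continuous_of_dominated (bound := fun s => |c s.1| * D) (fun v => ?_)
    (fun v => Eventually.of_forall fun s => ?_) (hc.abs.mul_const D)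
    (Eventually.of_forall fun s => ?_)
  · exact hc.1.mul (hθ.comp (by fun_prop)).aestronglyMeasurable
  · rw [norm_mul, Real.norm_eq_abs, Real.norm_eq_abs]
    exact mul_le_mul_of_nonneg_left (hD _ _ _ (norm_dirCut_le _ _)) (abs_nonneg _)
  · exact continuous_const.mul (hθ.comp (hp.prodMk (continuous_const.prodMk hd)))

theorem abs_testFun_le (hN : 2 ≤ N) (n : ℕ) {B : ℝ} (hb : ∀ r, |b r| ≤ B)
    (hc : Integrable (fun s : ℝ × S2 => c s.1) timeSphere)
    (hD : ∀ p s y, ‖y‖ ≤ 1 → |θ (p, s, y)| ≤ D) (v : Config N) :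
    |testFun hN n b c θ v| ≤ B * ∫ s, |c s.1| * D ∂timeSphere := by
  rw [testFun, abs_mul]
  refine mul_le_mul (hb _) ?_ (abs_nonneg _) ((abs_nonneg _).trans (hb 0))
  rw [← Real.norm_eq_abs]
  refine norm_integral_le_of_norm_le (hc.abs.mul_const D) (Eventually.of_forall fun s => ?_)
  rw [norm_mul, Real.norm_eq_abs, Real.norm_eq_abs]
  exact mul_le_mul_of_nonneg_left (hD _ _ _ (norm_dirCut_le _ _)) (abs_nonneg _)

/-- On a sphere the cutoffs are invisible: either b vanishes or the truncated direction is the true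
one. Fubini then exchanges the sphere with time and space. -/
theorem integral_testFun (hN : 2 ≤ N) {n : ℕ} (hb0 : ∀ r, r ≤ 1 / (n + 1 : ℝ) → b r = 0)
    (hc : Integrable (fun s : ℝ × S2 => c s.1) timeSphere) (hθ : Continuous θ)
    (hD : ∀ p s y, ‖y‖ ≤ 1 → |θ (p, s, y)| ≤ D) {p : Param N} (hp : 0 < p.2.1) {g : S2 → ℝ}
    (hg : Integrable g surface) :
    ∫ y, testFun hN n b c θ (zrsMap N (p, y)) * g y ∂surface =
      ∫ s, b p.2.1 * (c s.1 * ∫ y : S2, g y * θ (p, s, (y : E3)) ∂surface) ∂timeSphere := by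
  have h1 : ∀ y : S2, testFun hN n b c θ (zrsMap N (p, y)) * g y =
      b p.2.1 * ∫ s, g y * c s.1 * θ (p, s, (y : E3)) ∂timeSphere := by
    intro y
    rw [testFun, configParam_zrsMap hN hp]
    by_cases hr : p.2.1 ≤ 1 / (n + 1 : ℝ)
    · simp [hb0 _ hr]
    · rw [dirCut_zrsMap hN (not_le.1 hr), mul_assoc, mul_comm _ (g y), ← integral_const_mul]
      simp only [mul_assoc]
  simp_rw [h1]
  rw [integral_const_mul, integral_const_mul]
  congr 1
  rw [integral_integral_swap]
  · refine integral_congr_ae (Eventually.of_forall fun s => ?_)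
    dsimp only
    rw [← integral_const_mul]
    refine integral_congr_ae (Eventually.of_forall fun y => ?_)
    dsimp only; ring
  · have h2 := hg.mul_prod hc
    refine h2.mul_bdd (c := D) ?_ (Eventually.of_forall fun q => ?_)
    · exact (hθ.comp (by fun_prop : Continuous fun q : S2 × (ℝ × S2) =>
        (p, q.2, (q.1 : E3)))).aestronglyMeasurable
    · exact hD _ _ _ (sphere_norm q.1).le

end

theorem ofReal_sum_le_iSup {K : ℕ} {a x : ℕ → ℝ} (ha : ∀ k, 0 ≤ a k)
    (ha1 : ∑ k ∈ Finset.range K, a k = 1) :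
    ENNReal.ofReal (∑ k ∈ Finset.range K, a k * x k) ≤ ⨆ k, ENNReal.ofReal (x k) := by
  by_cases h : (⨆ k, ENNReal.ofReal (x k)) = ⊤
  · rw [h]; exact le_top
  · refine ENNReal.ofReal_le_of_le_toReal ?_
    have hx : ∀ k, x k ≤ (⨆ k, ENNReal.ofReal (x k)).toReal := fun k =>
      (ENNReal.ofReal_le_iff_le_toReal h).1 (le_iSup (fun k => ENNReal.ofReal (x k)) k)
    calc _ ≤ ∑ k ∈ Finset.range K, a k * (⨆ k, ENNReal.ofReal (x k)).toReal :=
          Finset.sum_le_sum fun k _ => mul_le_mul_of_nonneg_left (hx k) (ha k)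
      _ = _ := by rw [← Finset.sum_mul, ha1, one_mul]

section

variable {N : ℕ} {a : ℕ → Param N × (ℝ × S2) → ℝ}

/-- A convex combination of the cut off kernels. -/
def mixKer (n : ℕ) (a : ℕ → Param N × (ℝ × S2) → ℝ) (q : Param N × (ℝ × S2) × E3) : ℝ :=
  ∑ k ∈ Finset.range (n + 1), a k (q.1, q.2.1) * kerCut n k q.2

theorem continuous_mixKer (n : ℕ) (hac : ∀ k, Continuous (a k)) : Continuous (mixKer n a) :=
  continuous_finsetSum _ fun k _ => ((hac k).comp (by fun_prop)).mul
    ((continuous_kerCut n k).comp (by fun_prop))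

theorem exists_bound_mixKer (n : ℕ) (ha0 : ∀ k x, 0 ≤ a k x)
    (ha1 : ∀ x, ∑ k ∈ Finset.range (n + 1), a k x = 1) :
    ∃ D, ∀ p s y, ‖y‖ ≤ 1 → |mixKer n a (p, s, y)| ≤ D := by
  choose C hC using exists_bound_kerCut n
  refine ⟨∑ k ∈ Finset.range (n + 1), C k, fun p s y hy => ?_⟩
  refine (Finset.abs_sum_le_sum_abs _ _).trans (Finset.sum_le_sum fun k hk => ?_)
  rw [abs_mul, abs_of_nonneg (ha0 _ _)]
  have h1 : a k (p, s) ≤ 1 := by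
    rw [← ha1 (p, s)]; exact Finset.single_le_sum (f := fun k => a k (p, s)) (fun i _ => ha0 i _) hk
  exact (mul_le_of_le_one_left (abs_nonneg _) h1).trans (hC k (s, y) hy)

theorem weightCut_mul_integral_mixKer (ω : ℝ → ℝ) (n : ℕ) {g : S2 → ℝ} (hg : Integrable g surface)
    (p : Param N) (s : ℝ × S2) :
    weightCut ω n s.1 * ∫ y : S2, g y * mixKer n a (p, s, (y : E3)) ∂surface =
      weightCut ω n s.1 * ∑ k ∈ Finset.range (n + 1),
        a k (p, s) * ∫ y : S2, g y * ker k (s, (y : E3)) ∂surface := by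
  by_cases hs : s.1 ∈ Set.Icc (1 / (n + 1 : ℝ)) (n + 1)
  · congr 1
    have e : ∀ y : S2, g y * mixKer n a (p, s, (y : E3)) =
        ∑ k ∈ Finset.range (n + 1), a k (p, s) * (g y * kerCut n k (s, (y : E3))) := by
      intro y
      rw [mixKer, Finset.mul_sum]
      exact Finset.sum_congr rfl fun k _ => by ring
    simp_rw [e]
    rw [integral_finsetSum]
    · refine Finset.sum_congr rfl fun k _ => ?_
      rw [integral_const_mul]
      simp_rw [kerCut_eq (q := (s, _)) hs]
    · intro k _
      have hk : Continuous fun y : S2 => kerCut n k (s, (y : E3)) :=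
        (continuous_kerCut n k).comp (by fun_prop)
      exact (integrable_mul_continuous hg hk).const_mul _
  · rw [weightCut_of_notMem hs]; simp

/-- A convex combination of the linear forms is at most their supremum, and both weights are below
the original ones. Where the clamped kernels differ from the true kernels, the truncated time weight
vanishes. -/
theorem isAdmissible_testFun (hN : 2 ≤ N) {ω β b : ℝ → ℝ} (hω : Measurable ω)
    (hω0 : ∀ t, 0 ≤ t → 0 ≤ ω t) {n : ℕ} (hb : ∀ r, 0 ≤ b r) (hbβ : ∀ r, b r ≤ β r)
    (hb0 : ∀ r, r ≤ 1 / (n + 1 : ℝ) → b r = 0) (hac : ∀ k, Continuous (a k))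
    (ha0 : ∀ k x, 0 ≤ a k x) (ha1 : ∀ x, ∑ k ∈ Finset.range (n + 1), a k x = 1) :
    IsAdmissible ω β N (testFun hN n b (weightCut ω n) (mixKer n a)) := by
  intro p hp g hg hg0
  obtain ⟨D, hD⟩ := exists_bound_mixKer n ha0 ha1
  rw [integral_testFun hN hb0 (integrable_weightCut hω0 hω n) (continuous_mixKer n hac) hD hp hg,
    integral_const_mul, ENNReal.ofReal_mul (hb _)]
  gcongr
  · exact hbβ _
  refine (ofReal_integral_le _).trans (le_trans (lintegral_mono fun s => ?_)
    (lintegral_timeSphere_le_formK g ω))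
  simp only
  rw [weightCut_mul_integral_mixKer ω n hg, ENNReal.ofReal_mul (weightCut_nonneg hω0 _ _), mul_comm]
  by_cases hs : s.1 ∈ Set.Icc (1 / (n + 1 : ℝ)) (n + 1)
  · gcongr
    · exact ofReal_sum_le_iSup (fun k => ha0 k _) (ha1 _)
    · exact weightCut_le_of_mem hs
  · rw [weightCut_of_notMem hs]; simp

end

end KacBoltzmann

end

/-! ### Duality: the functional of a density as a supremum over test functions -/

noncomputable section

namespace KacBoltzmann

/-- Bounded continuous admissible functions. -/
def IsTest (ω β : ℝ → ℝ) (N : ℕ) (Ψ : C(Config N, ℝ)) : Prop :=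
  (∃ C, ∀ v, |Ψ v| ≤ C) ∧ IsAdmissible ω β N Ψ

section

variable {N : ℕ} {F : Config N → ℝ} {ω β : ℝ → ℝ}

/-- The affine form of index `k` along the heat flow of the slices of `F`. -/
def sliceForm (F : Config N → ℝ) (k : ℕ) (q : Param N × (ℝ × S2)) : ℝ :=
  ∫ y : S2, F (zrsMap N (q.1, y)) * ker k (q.2, (y : E3)) ∂surface

theorem measurable_sliceForm (hFm : Measurable F) (k : ℕ) : Measurable (sliceForm F k) := by
  have : Measurable fun q : (Param N × (ℝ × S2)) × S2 =>
      F (zrsMap N (q.1.1, q.2)) * ker k (q.1.2, (q.2 : E3)) :=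
    (hFm.comp ((continuous_zrsMap N).measurable.comp (by fun_prop))).mul
      ((measurable_ker k).comp (by fun_prop))
  exact this.stronglyMeasurable.integral_prod_right'.measurable

theorem sliceForm_zero (q : Param N × (ℝ × S2)) : sliceForm F 0 q = 0 := by
  simp [sliceForm, ker, kerForm_zero]

/-- Passing to the form functional first gives a measurable majorant of the integrand, to which
Tonelli applies even though `densK` is an iterated integral. -/
theorem densK_le_lintegral (hN : 2 ≤ N) (hω : Measurable ω) (hβ : Measurable β)
    (hFm : Measurable F) (hF : Integrable F volume) (hF0 : ∀ v, 0 ≤ F v) :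
    densK ω β N F ≤ ∫⁻ q, ENNReal.ofReal (β q.1.2.1) * ((⨆ k, ENNReal.ofReal (sliceForm F k q)) *
      ENNReal.ofReal (ω q.2.1)) ∂((paramMeasure N).prod timeSphere) := by
  have hm : Measurable fun q : Param N × (ℝ × S2) => ENNReal.ofReal (β q.1.2.1) *
      ((⨆ k, ENNReal.ofReal (sliceForm F k q)) * ENNReal.ofReal (ω q.2.1)) := by
    refine Measurable.mul (hβ.comp (by fun_prop)).ennreal_ofReal (Measurable.mul ?_ ?_)
    · exact Measurable.iSup fun k => (measurable_sliceForm hFm k).ennreal_ofReal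
    · exact (hω.comp (by fun_prop)).ennreal_ofReal
  rw [lintegral_prod _ hm.aemeasurable, lintegral_paramMeasure hm.lintegral_prod_right']
  refine lintegral_mono_ae ?_
  filter_upwards [ae_paramMeasure (ae_integrable_slice hN hF)] with z hz
  refine lintegral_mono_ae ?_
  filter_upwards [hz] with r hr
  refine lintegral_mono_ae ?_
  filter_upwards [hr] with w hw
  gcongr
  rw [lintegral_const_mul' _ _ ENNReal.ofReal_ne_top]
  gcongr
  have hgm : Measurable fun σ : S2 => F (zrsMap N ((z, r, w), σ)) :=
    hFm.comp ((continuous_zrsMap N).measurable.comp measurable_prodMk_left)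
  refine (sphK_le_formK hw (fun σ => hF0 _) ω).trans ?_
  rw [formK_eq_timeSphere hgm hω]
  rfl

theorem integrable_cut_sliceForm (hN : 2 ≤ N) (hω : Measurable ω) (hω0 : ∀ t, 0 ≤ t → 0 ≤ ω t)
    (hFm : Measurable F) (hF : Integrable F volume) (hF0 : ∀ v, 0 ≤ F v) {b : ℝ → ℝ}
    (hbc : Continuous b) {B : ℝ} (hb : ∀ r, |b r| ≤ B) (n k : ℕ) :
    Integrable (fun q : Param N × (ℝ × S2) =>
      b q.1.2.1 * (weightCut ω n q.2.1 * sliceForm F k q)) ((paramMeasure N).prod timeSphere) := by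
  obtain ⟨C, hC⟩ := exists_bound_kerCut n k
  have h1 := ((integrable_comp_zrsMap hN hF).integral_prod_left.mul_prod
    (integrable_weightCut hω0 hω n)).mul_const C
  have h2 : Integrable (fun q : Param N × (ℝ × S2) => weightCut ω n q.2.1 * sliceForm F k q)
      ((paramMeasure N).prod timeSphere) := by
    refine h1.mono' ?_ ?_
    · exact (((measurable_weightCut hω n).comp (by fun_prop)).mul
        (measurable_sliceForm hFm k)).aestronglyMeasurable
    · filter_upwards [Measure.quasiMeasurePreserving_fst.ae (ae_integrable_slice hN hF)] with q hq
      rw [norm_mul, Real.norm_of_nonneg (weightCut_nonneg hω0 _ _)]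
      by_cases hs : q.2.1 ∈ Set.Icc (1 / (n + 1 : ℝ)) (n + 1)
      · have : ‖sliceForm F k q‖ ≤ (∫ y : S2, F (zrsMap N (q.1, y)) ∂surface) * C := by
          rw [← integral_mul_const]
          refine norm_integral_le_of_norm_le (hq.mul_const C) (Eventually.of_forall fun y => ?_)
          rw [norm_mul, Real.norm_of_nonneg (hF0 _), ← kerCut_eq (q := (q.2, (y : E3))) hs]
          exact mul_le_mul_of_nonneg_left (hC _ (sphere_norm y).le) (hF0 _)
        calc _ ≤ weightCut ω n q.2.1 * ((∫ y : S2, F (zrsMap N (q.1, y)) ∂surface) * C) :=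
              mul_le_mul_of_nonneg_left this (weightCut_nonneg hω0 _ _)
          _ = _ := by ring
      · rw [weightCut_of_notMem hs]; simp
  exact h2.bdd_mul (c := B) (hbc.comp (by fun_prop)).aestronglyMeasurable
    (Eventually.of_forall fun q => hb _)

theorem integral_testFun_mul (hN : 2 ≤ N) (hω : Measurable ω) (hω0 : ∀ t, 0 ≤ t → 0 ≤ ω t)
    (hFm : Measurable F) (hF : Integrable F volume) (hF0 : ∀ v, 0 ≤ F v) {b : ℝ → ℝ}
    (hbc : Continuous b) {B : ℝ} (hb : ∀ r, |b r| ≤ B) {n : ℕ}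
    (hb0 : ∀ r, r ≤ 1 / (n + 1 : ℝ) → b r = 0) {a : ℕ → Param N × (ℝ × S2) → ℝ}
    (hac : ∀ k, Continuous (a k)) (ha0 : ∀ k x, 0 ≤ a k x)
    (ha1 : ∀ x, ∑ k ∈ Finset.range (n + 1), a k x = 1) :
    ∫ v, testFun hN n b (weightCut ω n) (mixKer n a) v * F v =
      ∫ q, ∑ k ∈ Finset.range (n + 1), a k q *
        (b q.1.2.1 * (weightCut ω n q.2.1 * sliceForm F k q))
        ∂((paramMeasure N).prod timeSphere) := by
  obtain ⟨D, hD⟩ := exists_bound_mixKer n ha0 ha1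
  have hθ := continuous_mixKer n hac
  have hwi := integrable_weightCut hω0 hω n
  have hi : Integrable (fun v => testFun hN n b (weightCut ω n) (mixKer n a) v * F v) volume :=
    hF.bdd_mul (continuous_testFun hN n hbc hwi hθ hD).aestronglyMeasurable
      (Eventually.of_forall fun v => abs_testFun_le hN n hb hwi hD v)
  rw [integral_eq_integral_param hN hi, integral_prod]
  · refine integral_congr_ae ?_
    filter_upwards [ae_paramMeasure_pos N, ae_integrable_slice hN hF] with p hp hpi
    rw [integral_testFun hN hb0 hwi hθ hD hp hpi]
    refine integral_congr_ae (Eventually.of_forall fun s => ?_)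
    dsimp only
    rw [weightCut_mul_integral_mixKer ω n hpi, Finset.mul_sum, Finset.mul_sum]
    refine Finset.sum_congr rfl fun k _ => ?_
    rw [sliceForm]; ring
  · refine integrable_finsetSum _ fun k hk => ?_
    refine (integrable_cut_sliceForm hN hω hω0 hFm hF hF0 hbc hb n k).bdd_mul (c := 1)
      (hac k).aestronglyMeasurable (Eventually.of_forall fun x => ?_)
    rw [Real.norm_of_nonneg (ha0 k x), ← ha1 x]
    exact Finset.single_le_sum (f := fun k => a k x) (fun i _ => ha0 i x) hk

/-- The functional of a density is bounded by the supremum of its pairings with test functions. -/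
theorem densK_le_iSup (hN : 2 ≤ N) (hω : Measurable ω) (hω0 : ∀ t, 0 ≤ t → 0 ≤ ω t)
    (hβ : LowerSemicontinuous β) (hβ0 : ∀ r, 0 ≤ β r)
    (hFm : Measurable F) (hF : Integrable F volume) (hF0 : ∀ v, 0 ≤ F v) :
    densK ω β N F ≤ ⨆ (Ψ : C(Config N, ℝ)) (_ : IsTest ω β N Ψ),
      ENNReal.ofReal (∫ v, Ψ v * F v) := by
  obtain ⟨b, hbc, hbn, hbβ, hbB, hb0, hbt⟩ := exists_continuous_approx_below hβ hβ0
  set S := ⨆ (Ψ : C(Config N, ℝ)) (_ : IsTest ω β N Ψ), ENNReal.ofReal (∫ v, Ψ v * F v) with hS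
  set h : ℕ → ℕ → Param N × (ℝ × S2) → ℝ := fun n k q =>
    b n q.1.2.1 * (weightCut ω n q.2.1 * sliceForm F k q) with hh
  have hbB' : ∀ n r, |b n r| ≤ n := fun n r => by rw [abs_of_nonneg (hbn n r)]; exact hbB n r
  have hhm : ∀ n k, Measurable (h n k) := fun n k =>
    ((hbc n).measurable.comp (by fun_prop)).mul
      (((measurable_weightCut hω n).comp (by fun_prop)).mul (measurable_sliceForm hFm k))
  have hhi : ∀ n k, Integrable (h n k) ((paramMeasure N).prod timeSphere) := fun n k =>
    integrable_cut_sliceForm hN hω hω0 hFm hF hF0 (hbc n) (hbB' n) n k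
  have hSm : ∀ n m, Measurable (partialSups (h n) m) := by
    intro n m
    induction m with
    | zero => simpa using hhm n 0
    | succ m ih => rw [partialSups_add_one]; exact ih.sup (hhm n _)
  have hSi : ∀ n m, Integrable (partialSups (h n) m) ((paramMeasure N).prod timeSphere) := by
    intro n m
    induction m with
    | zero => simpa using hhi n 0
    | succ m ih => rw [partialSups_add_one]; exact ih.sup (hhi n _)
  -- The affine form of index 0 is zero, which makes every finite maximum non-negative.
  have hS0 : ∀ n m q, 0 ≤ partialSups (h n) m q := by
    intro n m q
    have := le_partialSups_of_le (h n) (Nat.zero_le m) q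
    refine le_trans (le_of_eq ?_) this
    simp [hh, sliceForm_zero]
  -- The truncated finite maximum is integrable, so its integral is reached up to ε by a continuous
  -- convex combination. The latter is the pairing of F with an admissible test function.
  have hle : ∀ n, ∫⁻ q, ENNReal.ofReal (partialSups (h n) n q)
      ∂((paramMeasure N).prod timeSphere) ≤ S := by
    intro n
    rw [← ofReal_integral_eq_lintegral_ofReal (hSi n n) (Eventually.of_forall (hS0 n n))]
    refine ENNReal.le_of_forall_pos_le_add fun ε hε _ => ?_
    obtain ⟨a, hac, ha0, ha1, hale⟩ := exists_continuous_partition (hhm n) (hhi n) n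
      (NNReal.coe_pos.2 hε)
    rw [← integral_testFun_mul hN hω hω0 hFm hF hF0 (hbc n) (hbB' n) (hb0 n) hac ha0 ha1] at hale
    obtain ⟨D, hD⟩ := exists_bound_mixKer n ha0 ha1
    have hθ := continuous_mixKer n hac
    have hwi := integrable_weightCut hω0 hω n
    have hcont := continuous_testFun hN n (hbc n) hwi hθ hD
    have hT : IsTest ω β N ⟨_, hcont⟩ :=
      ⟨⟨_, abs_testFun_le hN n (hbB' n) hwi hD⟩,
        isAdmissible_testFun hN hω hω0 (hbn n) (hbβ n) (hb0 n) hac ha0 ha1⟩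
    refine (ENNReal.ofReal_le_ofReal hale).trans (ENNReal.ofReal_add_le.trans ?_)
    rw [ENNReal.ofReal_coe_nnreal]
    gcongr
    exact le_iSup₂ (f := fun (Ψ : C(Config N, ℝ)) (_ : IsTest ω β N Ψ) =>
      ENNReal.ofReal (∫ v, Ψ v * F v)) _ hT
  refine (densK_le_lintegral hN hω hβ.measurable hFm hF hF0).trans ?_
  -- For each fixed k the truncated form converges as all cutoffs are removed, and it enters the
  -- maximum as soon as n ≥ k. Fatou's lemma then concludes.
  have hlim : ∀ᵐ q ∂((paramMeasure N).prod timeSphere), ENNReal.ofReal (β q.1.2.1) *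
      ((⨆ k, ENNReal.ofReal (sliceForm F k q)) * ENNReal.ofReal (ω q.2.1)) ≤
      liminf (fun n => ENNReal.ofReal (partialSups (h n) n q)) atTop := by
    have ht : ∀ᵐ s ∂timeSphere, 0 < s.1 :=
      Measure.quasiMeasurePreserving_fst.ae (ae_restrict_mem measurableSet_Ioi)
    filter_upwards [Measure.quasiMeasurePreserving_fst.ae (ae_paramMeasure_pos N),
      Measure.quasiMeasurePreserving_snd.ae ht] with q hq1 hq2
    rw [ENNReal.iSup_mul, ENNReal.mul_iSup]
    refine iSup_le fun k => ?_
    have hconv : Tendsto (fun n => ENNReal.ofReal (h n k q)) atTop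
        (𝓝 (ENNReal.ofReal (β q.1.2.1 * (ω q.2.1 * sliceForm F k q)))) :=
      (ENNReal.continuous_ofReal.tendsto _).comp
        ((hbt _ hq1).mul ((tendsto_weightCut hq2).mul_const _))
    rw [mul_comm (ENNReal.ofReal (sliceForm F k q)), ← ENNReal.ofReal_mul (hω0 _ hq2.le),
      ← ENNReal.ofReal_mul (hβ0 _), ← hconv.liminf_eq]
    refine liminf_le_liminf ?_
    filter_upwards [eventually_ge_atTop k] with n hn
    exact ENNReal.ofReal_le_ofReal (le_partialSups_of_le (h n) hn q)
  refine (lintegral_mono_ae hlim).trans ((lintegral_liminf_le fun n =>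
    (hSm n n).ennreal_ofReal).trans ?_)
  exact (liminf_le_liminf (Eventually.of_forall hle)).trans (by simp)

end

end KacBoltzmann

end

noncomputable section

namespace KacBoltzmann

/-! ### Duality for measures -/

section

variable {N : ℕ} {ω β : ℝ → ℝ} {μ : Measure (Config N)}

theorem measurable_density (μ : Measure (Config N)) : Measurable (density μ) :=
  (Measure.measurable_rnDeriv _ _).ennreal_toReal

theorem density_nonneg (μ : Measure (Config N)) (v : Config N) : 0 ≤ density μ v :=
  ENNReal.toReal_nonneg

theorem integrable_density (μ : Measure (Config N)) [IsFiniteMeasure μ] :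
    Integrable (density μ) volume := Measure.integrable_toReal_rnDeriv

theorem integral_mul_density [IsFiniteMeasure μ] (hμ : μ ≪ volume) (f : Config N → ℝ) :
    ∫ v, f v * density μ v = ∫ v, f v ∂μ := by
  rw [← integral_rnDeriv_smul hμ]
  exact integral_congr_ae (Eventually.of_forall fun v => mul_comm _ _)

/-- Only measurability of Ψ is asked, not continuity, because the functions selected by samples are
not continuous. A measure without density has infinite functional. -/
theorem ofReal_integral_le_KK (hN : 2 ≤ N) [IsFiniteMeasure μ] {Ψ : Config N → ℝ}
    (hΨm : Measurable Ψ) {C : ℝ} (hΨb : ∀ v, |Ψ v| ≤ C) (hΨ : IsAdmissible ω β N Ψ) :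
    ENNReal.ofReal (∫ v, Ψ v ∂μ) ≤ 17 * KK ω β μ := by
  rw [KK]
  split_ifs with hμ
  · rw [← integral_mul_density hμ]
    exact ofReal_integral_mul_le_densK hN hΨm hΨb hΨ (integrable_density μ) (density_nonneg μ)
  · simp

theorem KK_le_iSup (hN : 2 ≤ N) [IsFiniteMeasure μ] (hμ : μ ≪ volume) (hω : Measurable ω)
    (hω0 : ∀ t, 0 ≤ t → 0 ≤ ω t) (hβ : LowerSemicontinuous β) (hβ0 : ∀ r, 0 ≤ β r) :
    KK ω β μ ≤ ⨆ (Ψ : C(Config N, ℝ)) (_ : IsTest ω β N Ψ), ENNReal.ofReal (∫ v, Ψ v ∂μ) := by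
  rw [KK, if_pos hμ]
  refine (densK_le_iSup hN hω hω0 hβ hβ0 (measurable_density μ) (integrable_density μ)
    (density_nonneg μ)).trans (le_of_eq ?_)
  simp only [integral_mul_density hμ]

/-- A countable family of test functions suffices. -/
theorem exists_seq_isTest (ω β : ℝ → ℝ) (N : ℕ) : ∃ Ψ : ℕ → C(Config N, ℝ),
    (∀ i, IsTest ω β N (Ψ i)) ∧ ∀ μ : Measure (Config N), IsProbabilityMeasure μ →
      (⨆ (Φ : C(Config N, ℝ)) (_ : IsTest ω β N Φ), ENNReal.ofReal (∫ v, Φ v ∂μ)) ≤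
        ⨆ i, ENNReal.ofReal (∫ v, Ψ i v ∂μ) := by
  -- Each set of test functions with a common bound is separable for locally uniform convergence,
  -- and the common bound allows dominated convergence for every probability measure.
  set A : ℕ → Set C(Config N, ℝ) := fun n =>
    {Φ | (∀ v, |Φ v| ≤ n) ∧ IsAdmissible ω β N Φ} with hA
  have hne : ∀ n, Nonempty (A n) := fun n => ⟨0, fun v => by simp, fun p _ g _ _ => by simp⟩
  refine ⟨fun i => (TopologicalSpace.denseSeq (A i.unpair.1) i.unpair.2 : A i.unpair.1).1,
    fun i => ⟨⟨_, (TopologicalSpace.denseSeq (A i.unpair.1) i.unpair.2).2.1⟩,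
      (TopologicalSpace.denseSeq (A i.unpair.1) i.unpair.2).2.2⟩, fun μ _ => ?_⟩
  refine iSup₂_le fun Φ hΦ => ?_
  obtain ⟨⟨C, hC⟩, hadm⟩ := hΦ
  obtain ⟨n, hn⟩ := exists_nat_ge C
  have hmem : Φ ∈ A n := ⟨fun v => (hC v).trans hn, hadm⟩
  have hcl := (TopologicalSpace.denseRange_denseSeq (A n)) ⟨Φ, hmem⟩
  obtain ⟨x, hx, hxt⟩ := mem_closure_iff_seq_limit.1 hcl
  have hpt : ∀ v, Tendsto (fun m => (x m).1 v) atTop (𝓝 (Φ v)) := fun v =>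
    ((continuous_eval_const v (F := C(Config N, ℝ))).tendsto Φ).comp
      ((continuous_subtype_val.tendsto _).comp hxt)
  have hint : Tendsto (fun m => ∫ v, (x m).1 v ∂μ) atTop (𝓝 (∫ v, Φ v ∂μ)) := by
    refine tendsto_integral_of_dominated_convergence (fun _ => (n : ℝ))
      (fun m => (x m).1.continuous.aestronglyMeasurable) (integrable_const _)
      (fun m => Eventually.of_forall fun v => (x m).2.1 v) (Eventually.of_forall hpt)
  refine le_of_tendsto ((ENNReal.continuous_ofReal.tendsto _).comp hint)
    (Eventually.of_forall fun m => ?_)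
  obtain ⟨k, hk⟩ := hx m
  refine le_trans (le_of_eq ?_) (le_iSup (fun i : ℕ => ENNReal.ofReal (∫ v,
    (TopologicalSpace.denseSeq (A i.unpair.1) i.unpair.2 : A i.unpair.1).1 v ∂μ)) (Nat.pair n k))
  have key : ∀ q : ℕ × ℕ, q = (n, k) → (x m).1 =
      (TopologicalSpace.denseSeq (A q.1) q.2 : A q.1).1 := by
    rintro _ rfl
    rw [hk]
  rw [Function.comp_apply, ← key _ (Nat.unpair_pair n k)]

end

/-! ### Lower semicontinuity and marginals -/

section

variable {ω β : ℝ → ℝ}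

/-- Each test function gives a weakly continuous pairing, bounded along the sequence by 17 times the
functional. The supremum over test functions is taken at the limit only. -/
theorem KK_le_liminf (hω : Measurable ω) (hω0 : ∀ t, 0 ≤ t → 0 ≤ ω t)
    (hβ : LowerSemicontinuous β) (hβ0 : ∀ r, 0 ≤ β r) {N : ℕ} (hN : 2 ≤ N)
    {F : ℕ → ProbabilityMeasure (Config N)} {Flim : ProbabilityMeasure (Config N)}
    (hac : (Flim : Measure (Config N)) ≪ volume) (hF : Tendsto F atTop (𝓝 Flim)) :
    KK ω β (Flim : Measure (Config N)) ≤
      17 * liminf (fun n => KK ω β (F n : Measure (Config N))) atTop := by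
  refine (KK_le_iSup hN hac hω hω0 hβ hβ0).trans (iSup₂_le fun Ψ hΨ => ?_)
  obtain ⟨⟨C, hC⟩, hadm⟩ := hΨ
  have h1 := (ProbabilityMeasure.tendsto_iff_forall_integral_tendsto.1 hF)
    (BoundedContinuousFunction.ofNormedAddCommGroup Ψ Ψ.continuous C hC)
  have h2 := (ENNReal.continuous_ofReal.tendsto _).comp h1
  rw [← ENNReal.liminf_const_mul_of_ne_top (by norm_num)]
  refine (le_of_eq h2.liminf_eq.symm).trans (liminf_le_liminf (Eventually.of_forall fun n => ?_))
  exact ofReal_integral_le_KK hN Ψ.continuous.measurable hC hadm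

/-- Admissibility only involves the restrictions to spheres. -/
theorem IsAdmissible.of_slices {N j : ℕ} {Ψ : Config N → ℝ}
    (h : ∀ p : Param N, ∃ (Φ : Config j → ℝ) (p' : Param j), IsAdmissible ω β j Φ ∧
      p'.2.1 = p.2.1 ∧ ∀ σ, Ψ (zrsMap N (p, σ)) = Φ (zrsMap j (p', σ))) :
    IsAdmissible ω β N Ψ := by
  intro p hp g hg hg0
  obtain ⟨Φ, p', hΦ, hr, he⟩ := h p
  simp_rw [he]
  rw [← hr]
  exact hΦ p' (by rw [hr]; exact hp) g hg hg0

/-- The projection is a surjective linear map, so it sends Lebesgue measure to a possibly infinite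
multiple of Lebesgue measure. Only null sets matter here. -/
theorem absolutelyContinuous_marginal {j N : ℕ} (h : j ≤ N) {μ : Measure (Config N)}
    (hμ : μ ≪ volume) : marginal h μ ≪ volume := by
  set L : Config N →ₗ[ℝ] Config j := LinearMap.funLeft ℝ E3 (Fin.castLE h) with hL
  have hs : Function.Surjective L :=
    LinearMap.funLeft_surjective_of_injective ℝ E3 _ (Fin.castLE_injective h)
  obtain ⟨c, -, hc⟩ := L.exists_map_addHaar_eq_smul_addHaar (volume : Measure (Config N))
    (volume : Measure (Config j)) hs
  have h1 : marginal h μ ≪ Measure.map L volume :=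
    hμ.map (LinearMap.continuous_of_finiteDimensional L).measurable
  rw [hc] at h1
  exact h1.trans Measure.smul_absolutelyContinuous

theorem zrsMap_castLE {j N : ℕ} (h : j ≤ N) (hj : 2 ≤ j) (p : Param N) (σ : S2) :
    (fun i => zrsMap N (p, σ) (Fin.castLE h i)) = zrsMap j ((p.1, p.2.1,
      fun i => p.2.2 (Fin.castLE (Nat.sub_le_sub_right h 2) i)), σ) := by
  funext i
  simp only [zrsMap, zrsConfig, Fin.val_castLE]
  split_ifs with h1 h2 h3 h4 h5
  · rfl
  · rfl
  · rfl
  · omega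
  · omega
  · rfl

/-- Pulled back to N velocities, a test function keeps its values on each sphere, with the
additional velocities as inert parameters. It is thus admissible for F itself. -/
theorem KK_marginal_le (hω : Measurable ω) (hω0 : ∀ t, 0 ≤ t → 0 ≤ ω t)
    (hβ : LowerSemicontinuous β) (hβ0 : ∀ r, 0 ≤ β r) {j N : ℕ} (h : j ≤ N) (hj : 2 ≤ j)
    {μ : Measure (Config N)} [IsProbabilityMeasure μ] (hμ : μ ≪ volume) :
    KK ω β (marginal h μ) ≤ 17 * KK ω β μ := by
  have hm : Measurable fun (v : Config N) (i : Fin j) => v (Fin.castLE h i) := by fun_prop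
  have : IsFiniteMeasure (marginal h μ) := by unfold marginal; infer_instance
  refine (KK_le_iSup hj (absolutelyContinuous_marginal h hμ) hω hω0 hβ hβ0).trans
    (iSup₂_le fun Ψ hΨ => ?_)
  obtain ⟨⟨C, hC⟩, hadm⟩ := hΨ
  rw [marginal, integral_map hm.aemeasurable Ψ.continuous.aestronglyMeasurable]
  refine ofReal_integral_le_KK (hj.trans h) (Ψ.continuous.measurable.comp hm) (fun v => hC _) ?_
  exact IsAdmissible.of_slices fun p => ⟨Ψ, _, hadm, rfl, fun σ => by rw [zrsMap_castLE h hj]⟩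

end

end KacBoltzmann

end

noncomputable section

namespace KacBoltzmann

/-! ### Product measures and hierarchies -/

/-- The law of `j` independent velocities with law `ρ`. -/
abbrev iid (ρ : Measure E3) (j : ℕ) : Measure (Config j) := Measure.pi fun _ : Fin j => ρ

theorem measurable_iid (j : ℕ) :
    Measurable fun ρ : ProbabilityMeasure E3 => iid (ρ : Measure E3) j := by
  refine Measurable.measure_of_isPiSystem_of_isProbabilityMeasure
    (S := Set.pi Set.univ '' Set.pi Set.univ fun _ : Fin j => {s : Set E3 | MeasurableSet s})
    generateFrom_pi.symm isPiSystem_pi ?_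
  rintro _ ⟨s, hs, rfl⟩
  simp only [Measure.pi_pi]
  refine Finset.measurable_prod _ fun i _ => ?_
  have hsi : MeasurableSet (s i) := hs i trivial
  exact (Measure.measurable_coe hsi).comp measurable_subtype_coe

/-- The kernel `ρ ↦ ρ^{⊗ j}`. -/
def iidKernel (j : ℕ) : ProbabilityTheory.Kernel (ProbabilityMeasure E3) (Config j) where
  toFun ρ := iid (ρ : Measure E3) j
  measurable' := measurable_iid j

instance (j : ℕ) : ProbabilityTheory.IsMarkovKernel (iidKernel j) :=
  ⟨fun ρ => inferInstanceAs (IsProbabilityMeasure (iid (ρ : Measure E3) j))⟩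

theorem iidKernel_apply (j : ℕ) (ρ : ProbabilityMeasure E3) :
    iidKernel j ρ = iid (ρ : Measure E3) j := rfl

theorem hierarchy_eq (ν : ProbabilityMeasure (ProbabilityMeasure E3)) (j : ℕ) :
    hierarchy ν j = (ν : Measure (ProbabilityMeasure E3)).bind (iidKernel j) := rfl

instance (ν : ProbabilityMeasure (ProbabilityMeasure E3)) (j : ℕ) :
    IsProbabilityMeasure (hierarchy ν j) := by
  rw [hierarchy_eq]; infer_instance

section

variable {j : ℕ} {q : Config j → ℝ} {C : ℝ}

theorem integrable_of_bounded {α : Type*} [MeasurableSpace α] {μ : Measure α} [IsFiniteMeasure μ]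
    {f : α → ℝ} (hf : Measurable f) {C : ℝ} (hC : ∀ x, |f x| ≤ C) : Integrable f μ :=
  (integrable_const C).mono' hf.aestronglyMeasurable (Eventually.of_forall hC)

theorem integral_hierarchy (ν : ProbabilityMeasure (ProbabilityMeasure E3)) (hq : Measurable q)
    (hC : ∀ v, |q v| ≤ C) :
    ∫ v, q v ∂hierarchy ν j = ∫ ρ : ProbabilityMeasure E3, ∫ v, q v ∂iid (ρ : Measure E3) j
      ∂(ν : Measure (ProbabilityMeasure E3)) := by
  have hi : Integrable q (hierarchy ν j) := integrable_of_bounded hq hC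
  rw [hierarchy_eq, Measure.comp_eq_comp_const_apply] at hi ⊢
  rw [ProbabilityTheory.Kernel.integral_comp hi]
  simp only [iidKernel_apply, ProbabilityTheory.Kernel.const_apply]

theorem measurable_integral_iid (hq : Measurable q) :
    Measurable fun ρ : ProbabilityMeasure E3 => ∫ v, q v ∂iid (ρ : Measure E3) j := by
  have := hq.stronglyMeasurable.integral_kernel (κ := iidKernel j)
  exact this.measurable

theorem abs_integral_le_of_bounded {α : Type*} [MeasurableSpace α] {μ : Measure α}
    [IsProbabilityMeasure μ] {f : α → ℝ} {C : ℝ} (hC : ∀ x, |f x| ≤ C) : |∫ x, f x ∂μ| ≤ C := by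
  have := norm_integral_le_of_norm_le_const (μ := μ) (f := f) (Eventually.of_forall hC)
  simpa using this

end

section

variable (ρ : Measure E3) [IsProbabilityMeasure ρ]

theorem iid_map_injective {a b : ℕ} {ι : Fin a → Fin b} (hι : Function.Injective ι) :
    MeasurePreserving (fun (v : Config b) i => v (ι i)) (iid ρ b) (iid ρ a) := by
  have h := (ProbabilityTheory.iIndepFun_pi (μ := fun _ : Fin b => ρ) (X := fun _ => id)
    fun _ => aemeasurable_id).precomp hι
  have h2 : Measure.map (fun (v : Config b) i => v (ι i)) (iid ρ b) =
      Measure.pi fun i => Measure.map (fun v : Config b => v (ι i)) (iid ρ b) :=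
    h.map_fun_eq_pi_map fun i => (measurable_pi_apply _).aemeasurable
  refine ⟨by fun_prop, h2.trans ?_⟩
  congr 1
  funext i
  exact (measurePreserving_eval (fun _ : Fin b => ρ) (ι i)).map_eq

/-- Prepend a pair of velocities. -/
def joinPair {n : ℕ} (p : Config 2 × Config n) : Config (n + 2) :=
  Fin.cons (p.1 0) (Fin.cons (p.1 1) p.2)

theorem measurePreserving_joinPair (n : ℕ) :
    MeasurePreserving (joinPair (n := n)) ((iid ρ 2).prod (iid ρ n)) (iid ρ (n + 2)) := by
  have hm : Measurable (joinPair (n := n)) := by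
    refine measurable_pi_iff.2 fun i => ?_
    refine Fin.cases ?_ (fun k => Fin.cases ?_ (fun l => ?_) k) i
    · exact (measurable_pi_apply (0 : Fin 2)).comp measurable_fst
    · exact (measurable_pi_apply (1 : Fin 2)).comp measurable_fst
    · exact (measurable_pi_apply l).comp measurable_snd
  refine ⟨hm, (Measure.pi_eq fun s hs => ?_).symm⟩
  rw [Measure.map_apply hm (MeasurableSet.univ_pi hs)]
  have : joinPair ⁻¹' (Set.pi Set.univ s) =
      (Set.pi Set.univ ![s 0, s 1]) ×ˢ (Set.pi Set.univ fun l : Fin n => s l.succ.succ) := by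
    ext p
    simp only [Set.mem_preimage, Set.mem_pi, Set.mem_univ, true_implies, Set.mem_prod,
      Fin.forall_fin_succ, joinPair, Fin.cons_zero, Fin.cons_succ]
    simp [and_assoc]
  rw [this, Measure.prod_prod, Measure.pi_pi, Measure.pi_pi, Fin.prod_univ_succ (n := n + 1),
    Fin.prod_univ_succ (n := n), Fin.prod_univ_two, mul_assoc]
  rfl

/-- The positions of the `l`-th pair. -/
def pairIdx (n : ℕ) (l : Fin (n / 2)) (i : Fin 2) : Fin n := ⟨2 * l + i, by omega⟩

theorem pairIdx_injective (n : ℕ) (l : Fin (n / 2)) : Function.Injective (pairIdx n l) := by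
  intro i i' h
  simp only [pairIdx, Fin.mk.injEq] at h
  omega

/-- The mean of `f` over disjoint pairs of velocities. -/
def pairMean (f : Config 2 → ℝ) (n : ℕ) (w : Config n) : ℝ :=
  ((n / 2 : ℕ) : ℝ)⁻¹ * ∑ l : Fin (n / 2), f fun i => w (pairIdx n l i)

theorem measurable_pairMean {f : Config 2 → ℝ} (hf : Measurable f) (n : ℕ) :
    Measurable (pairMean f n) := by
  refine measurable_const.mul (Finset.measurable_fun_sum _ fun l _ => hf.comp ?_)
  exact measurable_pi_iff.2 fun i => measurable_pi_apply _

/-- Disjoint pairs of independent velocities are independent, so the variances of the n/2 summands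
add. Overlapping pairs would use more samples but lose this. -/
theorem variance_pairMean_le {f : Config 2 → ℝ} (hf : Measurable f) {C : ℝ} (hC : ∀ v, |f v| ≤ C)
    {n : ℕ} (hn : 2 ≤ n) :
    Integrable (fun w => (pairMean f n w - ∫ v, f v ∂iid ρ 2) ^ 2) (iid ρ n) ∧
    ∫ w, (pairMean f n w - ∫ v, f v ∂iid ρ 2) ^ 2 ∂iid ρ n ≤ C ^ 2 / (n / 2 : ℕ) := by
  have hm0 : (0 : ℝ) < (n / 2 : ℕ) := by
    have : 0 < n / 2 := by omega
    exact_mod_cast this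
  set X : Fin (n / 2) → Config n → ℝ := fun l w => f fun i => w (pairIdx n l i) with hX
  have hXm : ∀ l, Measurable (X l) := fun l =>
    hf.comp (measurable_pi_iff.2 fun i => measurable_pi_apply _)
  have hXL : ∀ l, MemLp (X l) 2 (iid ρ n) := fun l =>
    MemLp.of_bound (hXm l).aestronglyMeasurable C (Eventually.of_forall fun w => hC _)
  have hXi : ∀ l, Integrable (X l) (iid ρ n) := fun l => (hXL l).integrable (by norm_num)
  have hmean : ∀ l, ∫ w, X l w ∂iid ρ n = ∫ v, f v ∂iid ρ 2 := by
    intro l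
    have h := iid_map_injective ρ (pairIdx_injective n l)
    rw [← h.map_eq, integral_map h.measurable.aemeasurable hf.aestronglyMeasurable]
  have hind : ∀ l k, l ≠ k → ProbabilityTheory.IndepFun (X l) (X k) (iid ρ n) := by
    intro l k hlk
    have h := ProbabilityTheory.iIndepFun_pi (μ := fun _ : Fin n => ρ) (X := fun _ => id)
      fun _ => aemeasurable_id
    have hlk' : (l : ℕ) ≠ k := fun h => hlk (Fin.ext h)
    have h2 := h.indepFun_prodMk_prodMk (fun i => measurable_pi_apply i)
      (pairIdx n l 0) (pairIdx n l 1) (pairIdx n k 0) (pairIdx n k 1)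
      (by simp [pairIdx, Fin.ext_iff]; omega) (by simp [pairIdx, Fin.ext_iff]; omega)
      (by simp [pairIdx, Fin.ext_iff]; omega) (by simp [pairIdx, Fin.ext_iff]; omega)
    have hg : Measurable fun p : E3 × E3 => f ![p.1, p.2] := by
      refine hf.comp (measurable_pi_iff.2 fun i => ?_)
      fin_cases i
      · exact measurable_fst
      · exact measurable_snd
    have h3 := h2.comp hg hg
    have e : ∀ l : Fin (n / 2), X l = (fun p : E3 × E3 => f ![p.1, p.2]) ∘
        fun w : Config n => (id (w (pairIdx n l 0)), id (w (pairIdx n l 1))) := by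
      intro l
      funext w
      simp only [hX, Function.comp, id]
      congr 1
      funext i
      fin_cases i <;> rfl
    rw [e l, e k]
    exact h3
  have hvar : ∀ l, ProbabilityTheory.variance (X l) (iid ρ n) ≤ C ^ 2 := by
    intro l
    refine (ProbabilityTheory.variance_le_expectation_sq (hXm l).aestronglyMeasurable).trans ?_
    refine (le_abs_self _).trans (abs_integral_le_of_bounded fun w => ?_)
    simp only [Pi.pow_apply, abs_pow]
    exact pow_le_pow_left₀ (abs_nonneg _) (hC _) 2
  have hsum := ProbabilityTheory.IndepFun.variance_sum (s := Finset.univ) (X := X)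
    (fun l _ => hXL l) fun l _ k _ hlk => hind l k hlk
  have hAm : MemLp (pairMean f n) 2 (iid ρ n) := by
    have := (memLp_finsetSum Finset.univ fun l _ => hXL l).const_mul ((n / 2 : ℕ) : ℝ)⁻¹
    exact this
  have hA : ∫ w, pairMean f n w ∂iid ρ n = ∫ v, f v ∂iid ρ 2 := by
    simp only [pairMean]
    rw [integral_const_mul, integral_finsetSum _ fun l _ => hXi l]
    rw [Finset.sum_congr rfl fun l _ => hmean l]
    simp [hm0.ne']
  have hV := ProbabilityTheory.variance_eq_integral (μ := iid ρ n) hAm.aestronglyMeasurable.aemeasurable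
  rw [hA] at hV
  refine ⟨(hAm.sub (memLp_const _)).integrable_sq, ?_⟩
  rw [← hV]
  have e : pairMean f n = fun w => ((n / 2 : ℕ) : ℝ)⁻¹ * (∑ l, X l) w := by
    funext w
    simp [pairMean, hX]
  rw [e, ProbabilityTheory.variance_const_mul, hsum]
  calc (((n / 2 : ℕ) : ℝ)⁻¹) ^ 2 * ∑ l, ProbabilityTheory.variance (X l) (iid ρ n)
      ≤ (((n / 2 : ℕ) : ℝ)⁻¹) ^ 2 * ∑ _l : Fin (n / 2), C ^ 2 := by
        gcongr with l
        exact hvar l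
    _ = C ^ 2 / (n / 2 : ℕ) := by
        rw [Finset.sum_const, Finset.card_univ, Fintype.card_fin, nsmul_eq_mul]
        field_simp

theorem integral_abs_pairMean_sub_le {f : Config 2 → ℝ} (hf : Measurable f) {C : ℝ}
    (hC : ∀ v, |f v| ≤ C) {n : ℕ} (hn : 2 ≤ n) {δ : ℝ} (hδ : 0 < δ) :
    ∫ w, |pairMean f n w - ∫ v, f v ∂iid ρ 2| ∂iid ρ n ≤ δ + C ^ 2 / δ / (n / 2 : ℕ) := by
  obtain ⟨hi, hv⟩ := variance_pairMean_le ρ hf hC hn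
  have h1 : ∫ w, |pairMean f n w - ∫ v, f v ∂iid ρ 2| ∂iid ρ n ≤
      ∫ w, (δ + δ⁻¹ * (pairMean f n w - ∫ v, f v ∂iid ρ 2) ^ 2) ∂iid ρ n := by
    refine integral_mono_of_nonneg (Eventually.of_forall fun w => abs_nonneg _)
      (by exact (integrable_const δ).add (hi.const_mul δ⁻¹)) (Eventually.of_forall fun w => ?_)
    dsimp only
    rw [← sq_abs]
    set x := |pairMean f n w - ∫ v, f v ∂iid ρ 2|
    have hx : δ * x ≤ δ * (δ + δ⁻¹ * x ^ 2) := by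
      rw [mul_add, ← mul_assoc, mul_inv_cancel₀ hδ.ne']
      nlinarith [sq_nonneg (δ - x), sq_nonneg (δ + x)]
    exact le_of_mul_le_mul_left hx hδ
  rw [integral_add (integrable_const δ) (hi.const_mul δ⁻¹), integral_const_mul] at h1
  refine h1.trans ?_
  have : C ^ 2 / δ / (n / 2 : ℕ) = δ⁻¹ * (C ^ 2 / (n / 2 : ℕ)) := by ring
  rw [this]
  simp only [integral_const, probReal_univ, one_smul]
  gcongr

end

theorem exists_measurable_argmax {X : Type*} [MeasurableSpace X] {A : ℕ → X → ℝ}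
    (hA : ∀ i, Measurable (A i)) (K : ℕ) :
    ∃ s : X → ℕ, Measurable s ∧ (∀ x, s x ≤ K) ∧ ∀ x, ∀ i ≤ K, A i x ≤ A (s x) x := by
  induction K with
  | zero =>
    refine ⟨fun _ => 0, measurable_const, fun _ => le_rfl, fun x i hi => ?_⟩
    rw [Nat.le_zero.1 hi]
  | succ K ih =>
    obtain ⟨s, hs, hsK, hmax⟩ := ih
    have hAs : Measurable fun x => A (s x) x :=
      (measurable_from_prod_countable_left (f := fun p : X × ℕ => A p.2 p.1) hA).comp
        (measurable_id.prodMk hs)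
    refine ⟨fun x => if A (s x) x < A (K + 1) x then K + 1 else s x,
      Measurable.ite (measurableSet_lt hAs (hA _)) measurable_const hs, fun x => ?_,
      fun x i hi => ?_⟩
    · dsimp only
      split_ifs
      · exact le_rfl
      · exact (hsK x).trans (Nat.le_succ K)
    · dsimp only
      split_ifs with h
      · rcases Nat.lt_or_ge K i with h1 | h1
        · rw [show i = K + 1 by omega]
        · exact (hmax x i h1).trans h.le
      · rcases Nat.lt_or_ge K i with h1 | h1
        · rw [show i = K + 1 by omega]; exact not_lt.1 h
        · exact hmax x i h1

end KacBoltzmann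

end

noncomputable section

namespace KacBoltzmann

/-! ### Selection of test functions by sampling -/

/-- The function of the first two velocities selected by the others. -/
def selFun (f : ℕ → Config 2 → ℝ) {n : ℕ} (s : Config n → ℕ) (v : Config (n + 2)) : ℝ :=
  f (s fun i => v i.succ.succ) fun i => v (Fin.castLE (Nat.le_add_left 2 n) i)

theorem selFun_joinPair (f : ℕ → Config 2 → ℝ) {n : ℕ} (s : Config n → ℕ)
    (p : Config 2 × Config n) : selFun f s (joinPair p) = f (s p.2) p.1 := by
  have : (fun i => joinPair p (Fin.castLE (Nat.le_add_left 2 n) i)) = p.1 := by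
    funext i
    fin_cases i <;> rfl
  rw [selFun, this]
  rfl

theorem measurable_select {α : Type*} [MeasurableSpace α] {f : ℕ → α → ℝ}
    (hf : ∀ i, Measurable (f i)) {β : Type*} [MeasurableSpace β] {s : β → ℕ} (hs : Measurable s)
    {g : β → α} (hg : Measurable g) : Measurable fun x => f (s x) (g x) :=
  (measurable_from_prod_countable_left (f := fun p : α × ℕ => f p.2 p.1) hf).comp (hg.prodMk hs)

theorem measurable_selFun {f : ℕ → Config 2 → ℝ} (hf : ∀ i, Measurable (f i)) {n : ℕ}
    {s : Config n → ℕ} (hs : Measurable s) : Measurable (selFun f s) :=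
  measurable_select hf (hs.comp (by fun_prop)) (by fun_prop)

/-- The selector depends only on the last n velocities, so integrating over the first two replaces
the selected function by its true mean. Selecting by empirical means costs at most two estimation
errors, one for the competing index and one for the chosen one. -/
theorem partialSups_integral_le {f : ℕ → Config 2 → ℝ} (hf : ∀ i, Measurable (f i)) {C : ℕ → ℝ}
    (hC : ∀ i v, |f i v| ≤ C i) {n K : ℕ} (hn : 2 ≤ n) {s : Config n → ℕ} (hs : Measurable s)
    (hsK : ∀ w, s w ≤ K) (hmax : ∀ w, ∀ i ≤ K, pairMean (f i) n w ≤ pairMean (f (s w)) n w)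
    (ρ : Measure E3) [IsProbabilityMeasure ρ] {δ : ℝ} (hδ : 0 < δ) :
    partialSups (fun i => ∫ v, f i v ∂iid ρ 2) K ≤ ∫ v, selFun f s v ∂iid ρ (n + 2) +
      2 * ∑ i ∈ Finset.range (K + 1), (δ + C i ^ 2 / δ / (n / 2 : ℕ)) := by
  set Φ : ℕ → ℝ := fun i => ∫ v, f i v ∂iid ρ 2 with hΦ
  have hC0 : ∀ i, 0 ≤ C i := fun i => (abs_nonneg _).trans (hC i 0)
  have hCK : ∀ i, i ≤ K → C i ≤ ∑ i ∈ Finset.range (K + 1), C i := fun i hi =>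
    Finset.single_le_sum (fun i _ => hC0 i) (Finset.mem_range.2 (Nat.lt_succ_of_le hi))
  have hmp := measurePreserving_joinPair ρ n
  have hsm := measurable_selFun hf hs
  have e1 : ∫ v, selFun f s v ∂iid ρ (n + 2) = ∫ w, Φ (s w) ∂iid ρ n := by
    rw [← hmp.map_eq, integral_map hmp.measurable.aemeasurable hsm.aestronglyMeasurable,
      integral_prod_symm]
    · simp only [selFun_joinPair, hΦ]
    · refine integrable_of_bounded (hsm.comp hmp.measurable)
        (C := ∑ i ∈ Finset.range (K + 1), C i) fun p => ?_
      rw [selFun_joinPair]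
      exact (hC _ _).trans (hCK _ (hsK _))
  have hΦm : Measurable fun w => Φ (s w) := (measurable_of_countable Φ).comp hs
  have iΦ : Integrable (fun w => Φ (s w)) (iid ρ n) :=
    integrable_of_bounded hΦm (C := ∑ i ∈ Finset.range (K + 1), C i) fun w =>
      (abs_integral_le_of_bounded (hC _)).trans (hCK _ (hsK _))
  have iA : ∀ i, Integrable (fun w => |pairMean (f i) n w - Φ i|) (iid ρ n) := by
    intro i
    have hm : Measurable fun w => pairMean (f i) n w - Φ i :=
      (measurable_pairMean (hf i) n).sub measurable_const
    obtain ⟨h, -⟩ := variance_pairMean_le ρ (hf i) (hC i) hn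
    refine ((integrable_const (1 : ℝ)).add h).mono' hm.abs.aestronglyMeasurable
      (Eventually.of_forall fun w => ?_)
    simp only [Real.norm_eq_abs, abs_abs, Pi.add_apply]
    rw [← sq_abs]
    nlinarith [sq_nonneg (|pairMean (f i) n w - Φ i| - 1), abs_nonneg (pairMean (f i) n w - Φ i)]
  have iS : Integrable (fun w => 2 * ∑ i ∈ Finset.range (K + 1), |pairMean (f i) n w - Φ i|)
      (iid ρ n) := (integrable_finsetSum _ fun i _ => iA i).const_mul 2
  -- The chain is: true mean of i, empirical mean of i, empirical mean of the chosen index, true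
  -- mean of the chosen index. Both errors are bounded by the sum over all indices up to K.
  have hpt : ∀ w, partialSups Φ K ≤ Φ (s w) +
      2 * ∑ i ∈ Finset.range (K + 1), |pairMean (f i) n w - Φ i| := by
    intro w
    refine partialSups_le _ _ _ fun i hi => ?_
    have hle : ∀ j, j ≤ K → |pairMean (f j) n w - Φ j| ≤
        ∑ i ∈ Finset.range (K + 1), |pairMean (f i) n w - Φ i| := fun j hj =>
      Finset.single_le_sum (f := fun i => |pairMean (f i) n w - Φ i|) (fun i _ => abs_nonneg _)
        (Finset.mem_range.2 (Nat.lt_succ_of_le hj))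
    have h1 := hle i hi
    have h2 := hle (s w) (hsK w)
    have h3 := hmax w i hi
    have h4 := neg_abs_le (pairMean (f i) n w - Φ i)
    have h5 := le_abs_self (pairMean (f (s w)) n w - Φ (s w))
    linarith
  have h1 : partialSups Φ K ≤ ∫ w, (Φ (s w) +
      2 * ∑ i ∈ Finset.range (K + 1), |pairMean (f i) n w - Φ i|) ∂iid ρ n := by
    have := integral_mono (μ := iid ρ n) (integrable_const _) (by exact iΦ.add iS) hpt
    simpa using this
  rw [integral_add iΦ iS, integral_const_mul, integral_finsetSum _ fun i _ => iA i] at h1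
  rw [e1]
  refine h1.trans ?_
  gcongr with i
  exact integral_abs_pairMean_sub_le ρ (hf i) (hC i) hn hδ

/-- If the functions selected by independent samples have small means, then so does the
supremum of the means. -/
theorem lintegral_iSup_le_liminf (ν : ProbabilityMeasure (ProbabilityMeasure E3))
    {f : ℕ → Config 2 → ℝ} (hf : ∀ i, Measurable (f i)) (hb : ∀ i, ∃ C, ∀ v, |f i v| ≤ C)
    (h0 : ∀ v, f 0 v = 0) {c : ℕ → ℝ≥0∞}
    (hc : ∀ (n K : ℕ) (s : Config n → ℕ), Measurable s → (∀ w, s w ≤ K) →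
      ENNReal.ofReal (∫ v, selFun f s v ∂hierarchy ν (n + 2)) ≤ c (n + 2)) :
    ∫⁻ ρ : ProbabilityMeasure E3, ⨆ i, ENNReal.ofReal (∫ v, f i v ∂iid (ρ : Measure E3) 2)
      ∂(ν : Measure (ProbabilityMeasure E3)) ≤ liminf c atTop := by
  choose C hC using hb
  have hC0 : ∀ i, 0 ≤ C i := fun i => (abs_nonneg _).trans (hC i 0)
  have hCK : ∀ K i, i ≤ K → C i ≤ ∑ i ∈ Finset.range (K + 1), C i := fun K i hi =>
    Finset.single_le_sum (fun i _ => hC0 i) (Finset.mem_range.2 (Nat.lt_succ_of_le hi))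
  set Φ : ℕ → ProbabilityMeasure E3 → ℝ := fun i ρ => ∫ v, f i v ∂iid (ρ : Measure E3) 2 with hΦ
  have hΦm : ∀ i, Measurable (Φ i) := fun i => measurable_integral_iid (hf i)
  have hΦi : ∀ i, Integrable (Φ i) (ν : Measure (ProbabilityMeasure E3)) := fun i =>
    integrable_of_bounded (hΦm i) fun ρ => abs_integral_le_of_bounded (hC i)
  have hSm : ∀ m, Measurable (partialSups Φ m) := by
    intro m
    induction m with
    | zero => simpa using hΦm 0
    | succ m ih => rw [partialSups_add_one]; exact ih.sup (hΦm _)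
  have hSi : ∀ m, Integrable (partialSups Φ m) (ν : Measure (ProbabilityMeasure E3)) := by
    intro m
    induction m with
    | zero => simpa using hΦi 0
    | succ m ih => rw [partialSups_add_one]; exact ih.sup (hΦi _)
  -- Since the function of index 0 vanishes, finite maxima are non-negative and their integrals
  -- agree with extended ones.
  have hS0 : ∀ m ρ, 0 ≤ partialSups Φ m ρ := fun m ρ => by
    refine le_trans (le_of_eq ?_) (le_partialSups_of_le Φ (Nat.zero_le m) ρ)
    simp [hΦ, h0]
  have hSap : ∀ m ρ, partialSups Φ m ρ = partialSups (fun i => Φ i ρ) m := by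
    intro m ρ
    induction m with
    | zero => simp
    | succ m ih => rw [partialSups_add_one, partialSups_add_one, Pi.sup_apply, ih]
  have key : ∀ K, ∫⁻ ρ, ENNReal.ofReal (partialSups Φ K ρ)
      ∂(ν : Measure (ProbabilityMeasure E3)) ≤ liminf c atTop := by
    intro K
    rw [← ofReal_integral_eq_lintegral_ofReal (hSi K) (Eventually.of_forall (hS0 K))]
    refine ENNReal.le_of_forall_pos_le_add fun ε hε _ => ?_
    have hε' : (0 : ℝ) < ε := hε
    -- With this choice the K+1 constant errors, counted twice, add up to ε/2. The remaining error
    -- D/(n/2) vanishes as n grows with K fixed.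
    set δ : ℝ := ε / (4 * (K + 1)) with hδdef
    have hδ : 0 < δ := by positivity
    set D : ℝ := 2 * ∑ i ∈ Finset.range (K + 1), C i ^ 2 / δ with hD
    have hD0 : Tendsto (fun n : ℕ => D / (n / 2 : ℕ)) atTop (𝓝 0) := by
      refine (tendsto_const_div_atTop_nhds_zero_nat D).comp ?_
      exact Nat.tendsto_div_const_atTop (by norm_num)
    have hE : ∀ n : ℕ, 2 * ∑ i ∈ Finset.range (K + 1), (δ + C i ^ 2 / δ / (n / 2 : ℕ)) =
        ε / 2 + D / (n / 2 : ℕ) := by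
      intro n
      have h1 : (K + 1 : ℝ) * δ = ε / 4 := by rw [hδdef]; field_simp
      have h2 : ∑ i ∈ Finset.range (K + 1), C i ^ 2 / δ / (n / 2 : ℕ) =
          (∑ i ∈ Finset.range (K + 1), C i ^ 2 / δ) / (n / 2 : ℕ) := (Finset.sum_div _ _ _).symm
      rw [Finset.sum_add_distrib, h2, Finset.sum_const, Finset.card_range,
        nsmul_eq_mul, hD, mul_add, mul_div_assoc]
      push_cast
      rw [h1]
      ring
    rw [← tsub_le_iff_right, ← liminf_nat_add c 2]
    refine le_liminf_of_le ?_ ?_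
    · isBoundedDefault
    filter_upwards [hD0.eventually (gt_mem_nhds (half_pos hε')), eventually_ge_atTop 2] with n hn hn2
    obtain ⟨s, hs, hsK, hmax⟩ := exists_measurable_argmax
      (fun i => measurable_pairMean (hf i) n) K
    have hsm := measurable_selFun hf hs
    have hsb : ∀ v, |selFun f s v| ≤ ∑ i ∈ Finset.range (K + 1), C i := fun v =>
      (hC _ _).trans (hCK _ _ (hsK _))
    rw [tsub_le_iff_right]
    refine le_trans ?_ (add_le_add_left (hc n K s hs hsK) _)
    rw [integral_hierarchy ν hsm hsb, ← ENNReal.ofReal_coe_nnreal]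
    refine le_trans (ENNReal.ofReal_le_ofReal ?_) ENNReal.ofReal_add_le
    have hi2 : Integrable (fun ρ : ProbabilityMeasure E3 => ∫ v, selFun f s v
        ∂iid (ρ : Measure E3) (n + 2)) (ν : Measure (ProbabilityMeasure E3)) :=
      integrable_of_bounded (measurable_integral_iid hsm) fun ρ => abs_integral_le_of_bounded hsb
    have h2 := integral_mono (hSi K) (by exact hi2.add (integrable_const (ε : ℝ))) fun ρ => by
      have h := partialSups_integral_le hf hC hn2 hs hsK hmax (ρ : Measure E3) hδ
      rw [hE] at h
      rw [hSap]
      exact h.trans (by simp only [Pi.add_apply]; linarith)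
    rw [integral_add' hi2 (integrable_const _)] at h2
    simpa using h2
  have hmono : Monotone fun K (ρ : ProbabilityMeasure E3) =>
      ENNReal.ofReal (partialSups Φ K ρ) := fun a b hab ρ =>
    ENNReal.ofReal_le_ofReal ((partialSups Φ).monotone hab ρ)
  calc _ ≤ ∫⁻ ρ, ⨆ K, ENNReal.ofReal (partialSups Φ K ρ)
        ∂(ν : Measure (ProbabilityMeasure E3)) := by
        refine lintegral_mono fun ρ => iSup_mono fun i => ?_
        exact ENNReal.ofReal_le_ofReal (le_partialSups Φ i ρ)
    _ = ⨆ K, ∫⁻ ρ, ENNReal.ofReal (partialSups Φ K ρ)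
        ∂(ν : Measure (ProbabilityMeasure E3)) :=
        lintegral_iSup (fun K => (hSm K).ennreal_ofReal) hmono
    _ ≤ _ := iSup_le key

end KacBoltzmann

end

open scoped ENNReal Convolution

noncomputable section

namespace KacBoltzmann

/-! ### Translations of weakly differentiable densities -/

/-- Truncation to balls and mollification preserve the bound one, and dominated convergence against
the integrable D passes the estimate to the limit. -/
theorem integral_mul_le_of_smooth {N : ℕ} {D : Config N → ℝ} (hD : Integrable D volume) {c : ℝ}
    (h : ∀ φ : Config N → ℝ, ContDiff ℝ (⊤ : ℕ∞) φ → HasCompactSupport φ → (∀ v, |φ v| ≤ 1) →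
      ∫ v, D v * φ v ≤ c)
    {ζ : Config N → ℝ} (hζ : Measurable ζ) (hζ1 : ∀ v, |ζ v| ≤ 1) : ∫ v, D v * ζ v ≤ c := by
  have : (volume : Measure (Config N)).IsNegInvariant :=
    Measure.pi.isNegInvariant fun _ => volume
  set B : ℕ → ContDiffBump (0 : Config N) := fun n =>
    ⟨1 / (n + 1), 2 / (n + 1), by positivity, by gcongr; norm_num⟩ with hB
  have hcs : ∀ g : Config N → ℝ, Measurable g → (∀ v, |g v| ≤ 1) → HasCompactSupport g →
      ∫ v, D v * g v ≤ c := by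
    intro g hg hg1 hgc
    have hgl : LocallyIntegrable g volume :=
      (locallyIntegrable_const (1 : ℝ)).mono hg.aestronglyMeasurable
        (Eventually.of_forall fun v => by simpa using hg1 v)
    set g' : ℕ → Config N → ℝ := fun n =>
      ((B n).normed volume ⋆[ContinuousLinearMap.lsmul ℝ ℝ, volume] g) with hg'
    have hg'c : ∀ n, ContDiff ℝ (⊤ : ℕ∞) (g' n) := fun n =>
      (B n).hasCompactSupport_normed.contDiff_convolution_left _ (B n).contDiff_normed hgl
    have hg's : ∀ n, HasCompactSupport (g' n) := fun n =>
      (B n).hasCompactSupport_normed.convolution _ hgc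
    have hg'1 : ∀ n v, |g' n v| ≤ 1 := by
      intro n v
      rw [← (B n).integral_normed (μ := volume), ← Real.norm_eq_abs]
      refine norm_integral_le_of_norm_le (B n).integrable_normed (Eventually.of_forall fun t => ?_)
      simp only [ContinuousLinearMap.lsmul_apply, smul_eq_mul, norm_mul]
      rw [Real.norm_of_nonneg ((B n).nonneg_normed t)]
      exact mul_le_of_le_one_right ((B n).nonneg_normed t) (hg1 _)
    have hlim : ∀ᵐ v, Tendsto (fun n => g' n v) atTop (𝓝 (g v)) := by
      refine ContDiffBump.ae_convolution_tendsto_right_of_locallyIntegrable (K := 2) ?_ ?_ hgl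
      · have := (tendsto_const_div_atTop_nhds_zero_nat (2 : ℝ)).comp (tendsto_add_atTop_nat 1)
        refine this.congr fun n => ?_
        simp [hB]
      · refine Eventually.of_forall fun n => le_of_eq ?_
        simp only [hB]; ring
    have ht : Tendsto (fun n => ∫ v, D v * g' n v) atTop (𝓝 (∫ v, D v * g v)) := by
      refine tendsto_integral_of_dominated_convergence (fun v => |D v|)
        (fun n => hD.1.mul (hg'c n).continuous.aestronglyMeasurable) hD.abs
        (fun n => Eventually.of_forall fun v => ?_) ?_
      · rw [norm_mul, Real.norm_eq_abs]
        exact mul_le_of_le_one_right (abs_nonneg _) (hg'1 n v)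
      · filter_upwards [hlim] with v hv using hv.const_mul _
    exact le_of_tendsto ht (Eventually.of_forall fun n => h _ (hg'c n) (hg's n) (hg'1 n))
  set χ : ℕ → Config N → ℝ := fun n => (Metric.closedBall 0 (n : ℝ)).indicator ζ with hχ
  have hχ1 : ∀ n v, |χ n v| ≤ 1 := by
    intro n v
    by_cases hv : v ∈ Metric.closedBall (0 : Config N) (n : ℝ)
    · simpa [hχ, hv] using hζ1 v
    · simp [hχ, Set.indicator_of_notMem hv]
  have ht : Tendsto (fun n => ∫ v, D v * χ n v) atTop (𝓝 (∫ v, D v * ζ v)) := by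
    refine tendsto_integral_of_dominated_convergence (fun v => |D v|)
      (fun n => hD.1.mul (hζ.indicator measurableSet_closedBall).aestronglyMeasurable) hD.abs
      (fun n => Eventually.of_forall fun v => ?_) (Eventually.of_forall fun v => ?_)
    · rw [norm_mul, Real.norm_eq_abs]
      exact mul_le_of_le_one_right (abs_nonneg _) (hχ1 n v)
    · refine tendsto_const_nhds.congr' ?_
      obtain ⟨n0, hn0⟩ := exists_nat_ge ‖v‖
      filter_upwards [eventually_ge_atTop n0] with n hn
      have : v ∈ Metric.closedBall (0 : Config N) (n : ℝ) := by
        rw [mem_closedBall_zero_iff]; exact hn0.trans (by exact_mod_cast hn)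
      rw [hχ]
      dsimp only
      rw [Set.indicator_of_mem this]
  refine le_of_tendsto ht (Eventually.of_forall fun n => hcs _
    (hζ.indicator measurableSet_closedBall) (hχ1 n) ?_)
  exact HasCompactSupport.of_support_subset_isCompact (isCompact_closedBall 0 (n : ℝ))
    Set.support_indicator_subset

section

variable {N : ℕ} {F : Config N → ℝ} {G : Fin N → Fin 3 → Config N → ℝ}

theorem single_eq_sum (i : Fin N) (x : E3) : (Pi.single i x : Config N) =
    ∑ k, x k • (Pi.single i (EuclideanSpace.single k (1 : ℝ)) : Config N) := by
  have hx : x = ∑ k, x k • (EuclideanSpace.single k (1 : ℝ) : E3) := by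
    ext l
    simp [Fin.sum_univ_three]
    fin_cases l <;> simp
  have h : ∀ k, x k • (Pi.single i (EuclideanSpace.single k (1 : ℝ)) : Config N) =
      (Pi.single i (x k • EuclideanSpace.single k (1 : ℝ)) : Config N) := by
    intro k
    funext l
    by_cases hl : l = i
    · subst hl; simp
    · simp [Pi.single_eq_of_ne hl]
  simp_rw [h]
  conv_lhs => rw [hx]
  exact map_sum (AddMonoidHom.single (fun _ : Fin N => E3) i) _ _

theorem IsWeakGradient.abs_integral_fderiv_le (hG : IsWeakGradient F G)
    (hF : Integrable F volume) (i : Fin N) (hGi : ∀ k, Integrable (G i k) volume) (x : E3)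
    {φ : Config N → ℝ} (hφ : ContDiff ℝ (⊤ : ℕ∞) φ) (hc : HasCompactSupport φ)
    (hφ1 : ∀ v, |φ v| ≤ 1) :
    |∫ v, F v * fderiv ℝ φ v (Pi.single i x)| ≤ ‖x‖ * ∑ k, ∫ v, |G i k v| := by
  have hd : ∀ u, Integrable (fun v => F v * fderiv ℝ φ v u) volume := by
    intro u
    have hcd : HasCompactSupport fun v => fderiv ℝ φ v u := hc.fderiv_apply (𝕜 := ℝ) u
    have hcc : Continuous fun v => fderiv ℝ φ v u :=
      (hφ.continuous_fderiv (by simp)).clm_apply continuous_const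
    obtain ⟨C, hC⟩ := hcd.exists_bound_of_continuous hcc
    exact hF.mul_bdd (c := C) hcc.aestronglyMeasurable (Eventually.of_forall hC)
  have e : ∫ v, F v * fderiv ℝ φ v (Pi.single i x) = ∑ k, x k * -∫ v, G i k v * φ v := by
    rw [single_eq_sum i x]
    simp only [map_sum, map_smul, smul_eq_mul, Finset.mul_sum]
    rw [integral_finsetSum]
    · refine Finset.sum_congr rfl fun k _ => ?_
      rw [← (hG.2 i k).2 φ hφ hc, ← integral_const_mul]
      refine integral_congr_ae (Eventually.of_forall fun v => ?_)
      dsimp only; ring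
    · intro k _
      refine ((hd (Pi.single i (EuclideanSpace.single k 1))).const_mul (x k)).congr
        (Eventually.of_forall fun v => ?_)
      dsimp only; ring
  rw [e, Finset.mul_sum]
  refine (Finset.abs_sum_le_sum_abs _ _).trans (Finset.sum_le_sum fun k _ => ?_)
  rw [abs_mul, abs_neg]
  refine mul_le_mul ?_ ?_ (abs_nonneg _) (norm_nonneg _)
  · exact PiLp.norm_apply_le x k
  · rw [← Real.norm_eq_abs]
    refine norm_integral_le_of_norm_le (hGi k).abs (Eventually.of_forall fun v => ?_)
    rw [norm_mul, Real.norm_eq_abs]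
    exact mul_le_of_le_one_right (abs_nonneg _) (hφ1 v)

/-- This is the L¹ modulus of continuity of a weakly differentiable function, stated dually for
measurable tests, since the selected functions are only measurable. -/
theorem IsWeakGradient.integral_translate_le (hG : IsWeakGradient F G)
    (hF : Integrable F volume) (i : Fin N) (hGi : ∀ k, Integrable (G i k) volume) (x : E3)
    {ζ : Config N → ℝ} (hζ : Measurable ζ) (hζ1 : ∀ v, |ζ v| ≤ 1) :
    ∫ v, F v * (ζ (v + Pi.single i x) - ζ v) ≤ ‖x‖ * ∑ k, ∫ v, |G i k v| := by
  set u : Config N := Pi.single i x with hu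
  -- Moving the translation onto F leaves a fixed integrable function paired with the test, which
  -- permits the reduction to smooth compactly supported tests.
  have hshift : ∀ g : Config N → ℝ, Measurable g → (∀ v, |g v| ≤ 1) →
      ∫ v, F v * (g (v + u) - g v) = ∫ v, (F (v - u) - F v) * g v := by
    intro g hg hg1
    have i1 : Integrable (fun v => F v * g (v + u)) volume :=
      hF.mul_bdd (c := 1) (hg.comp (by fun_prop)).aestronglyMeasurable
        (Eventually.of_forall fun v => hg1 _)
    have i2 : Integrable (fun v => F v * g v) volume :=
      hF.mul_bdd (c := 1) hg.aestronglyMeasurable (Eventually.of_forall fun v => hg1 _)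
    have i3 : Integrable (fun v => F (v - u) * g v) volume :=
      (hF.comp_sub_right u).mul_bdd (c := 1) hg.aestronglyMeasurable
        (Eventually.of_forall fun v => hg1 _)
    simp only [mul_sub, sub_mul]
    rw [integral_sub i1 i2, integral_sub i3 i2]
    congr 1
    rw [← integral_add_right_eq_self (fun v => F (v - u) * g v) u]
    simp
  rw [hshift ζ hζ hζ1]
  refine integral_mul_le_of_smooth (by exact (hF.comp_sub_right u).sub hF) (fun φ hφ hc hφ1 => ?_)
    hζ hζ1
  rw [← hshift φ hφ.continuous.measurable hφ1]
  have hcc : Continuous fun v => fderiv ℝ φ v u :=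
    (hφ.continuous_fderiv (by simp)).clm_apply continuous_const
  have hcd : HasCompactSupport fun v => fderiv ℝ φ v u := hc.fderiv_apply (𝕜 := ℝ) u
  obtain ⟨C, hC⟩ := hcd.exists_bound_of_continuous hcc
  -- For a smooth test the pairing along the segment is differentiable, and its derivative is again
  -- a pairing with a translated test, so the weak gradient bounds it uniformly.
  have hderiv : ∀ t : ℝ, HasDerivAt (fun t : ℝ => ∫ v, F v * φ (v + t • u))
      (∫ v, F v * fderiv ℝ φ (v + t • u) u) t := by
    intro t
    refine (hasDerivAt_integral_of_dominated_loc_of_deriv_le (bound := fun v => |F v| * C)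
      (F := fun (t : ℝ) v => F v * φ (v + t • u)) (F' := fun t v => F v * fderiv ℝ φ (v + t • u) u)
      (s := Set.univ) univ_mem ?_ ?_ ?_ ?_ (hF.abs.mul_const C) ?_).2
    · exact Eventually.of_forall fun s => hF.1.mul
        (hφ.continuous.comp (by fun_prop)).aestronglyMeasurable
    · exact hF.mul_bdd (c := 1) (hφ.continuous.comp (by fun_prop)).aestronglyMeasurable
        (Eventually.of_forall fun v => hφ1 _)
    · exact hF.1.mul (hcc.comp (by fun_prop : Continuous fun v : Config N =>
        v + t • u)).aestronglyMeasurable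
    · refine Eventually.of_forall fun v s _ => ?_
      rw [norm_mul, Real.norm_eq_abs]
      exact mul_le_mul_of_nonneg_left (hC _) (abs_nonneg _)
    · refine Eventually.of_forall fun v s _ => HasDerivAt.const_mul _ ?_
      have h1 : HasDerivAt (fun s : ℝ => v + s • u) u s := by
        simpa using ((hasDerivAt_id s).smul_const u).const_add v
      exact (hφ.differentiable (by simp) _).hasFDerivAt.comp_hasDerivAt s h1
  have hbound : ∀ t : ℝ, ‖∫ v, F v * fderiv ℝ φ (v + t • u) u‖ ≤
      ‖x‖ * ∑ k, ∫ v, |G i k v| := by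
    intro t
    have hφt : ContDiff ℝ (⊤ : ℕ∞) fun v => φ (v + t • u) := hφ.comp (by fun_prop)
    have hct : HasCompactSupport fun v => φ (v + t • u) :=
      hc.comp_homeomorph (Homeomorph.addRight (t • u))
    have := hG.abs_integral_fderiv_le hF i hGi x hφt hct fun v => hφ1 _
    simp only [fderiv_comp_add_right] at this
    exact this
  have h1 := norm_image_sub_le_of_norm_deriv_le_segment_01'
    (f := fun t : ℝ => ∫ v, F v * φ (v + t • u)) (fun t _ => (hderiv t).hasDerivWithinAt)
    fun t _ => hbound t
  have i1 : Integrable (fun v => F v * φ (v + u)) volume :=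
    hF.mul_bdd (c := 1) (hφ.continuous.comp (by fun_prop)).aestronglyMeasurable
      (Eventually.of_forall fun v => hφ1 _)
  have i2 : Integrable (fun v => F v * φ v) volume :=
    hF.mul_bdd (c := 1) hφ.continuous.aestronglyMeasurable (Eventually.of_forall fun v => hφ1 _)
  simp only [one_smul, zero_smul, add_zero] at h1
  simp only [mul_sub]
  rw [integral_sub i1 i2]
  exact (le_abs_self _).trans h1

end

end KacBoltzmann

end

noncomputable section

namespace KacBoltzmann

/-! ### Consequences of a bound on the Fisher information -/

/-- This is the inequality between arithmetic and geometric means. Where F = 0, the convention that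
a positive number over zero is infinite keeps it true. -/
theorem enorm_le_sq_div_add (g : ℝ) {F : ℝ} (hF : 0 ≤ F) :
    ‖g‖ₑ ≤ ENNReal.ofReal (g ^ 2) / ENNReal.ofReal F + ENNReal.ofReal F := by
  rcases hF.eq_or_lt with rfl | hF
  · rcases eq_or_ne g 0 with rfl | hg
    · simp
    · have : ENNReal.ofReal (g ^ 2) ≠ 0 := by simpa using hg
      simp [ENNReal.div_zero this]
  · rw [← ENNReal.ofReal_div_of_pos hF, ← ENNReal.ofReal_add (by positivity) hF.le,
      ← ofReal_norm, Real.norm_eq_abs]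
    refine ENNReal.ofReal_le_ofReal ?_
    rw [← sq_abs, div_add' _ _ _ hF.ne', le_div_iff₀ hF]
    nlinarith [sq_nonneg (|g| - F), sq_nonneg (|g| + F), abs_nonneg g]

/-- Summing |G| ≤ G²/F + F over all 3N coordinates bounds the total L¹ norm of the gradient by N(B +
3). Some velocity must then carry at most the average B + 3. -/
theorem exists_weakGradient_of_fisherInfo_lt {N : ℕ} (hN : 1 ≤ N) {μ : Measure (Config N)}
    [IsProbabilityMeasure μ] {B : ℝ≥0∞} (hB : fisherInfo μ < B) :
    μ ≪ volume ∧ ∃ G, IsWeakGradient (density μ) G ∧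
      ∃ i, ∑ k, ∫⁻ v, ‖G i k v‖ₑ ≤ B + 3 := by
  have hac : μ ≪ volume := by
    by_contra h
    rw [fisherInfo, if_neg h] at hB
    exact not_top_lt hB
  refine ⟨hac, ?_⟩
  have hN0 : (N : ℝ≥0∞) ≠ 0 := by simpa using (by omega : N ≠ 0)
  rw [fisherInfo, if_pos hac] at hB
  have hB' : (⨅ (G : Fin N → Fin 3 → Config N → ℝ) (_ : IsWeakGradient (density μ) G),
      ∫⁻ v, ENNReal.ofReal (∑ i, ∑ k, G i k v ^ 2) / ENNReal.ofReal (density μ v)) < N * B := by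
    by_contra h
    have h1 := mul_le_mul_right (not_lt.1 h) (N : ℝ≥0∞)⁻¹
    rw [← mul_assoc, ENNReal.inv_mul_cancel hN0 (ENNReal.natCast_ne_top N), one_mul] at h1
    exact absurd hB (not_lt.2 h1)
  obtain ⟨G, hG'⟩ := iInf_lt_iff.1 hB'
  obtain ⟨hG, hGB⟩ := iInf_lt_iff.1 hG'
  refine ⟨G, hG, ?_⟩
  have hm : ∀ i k, AEMeasurable (fun v => ‖G i k v‖ₑ) volume := fun i k =>
    (hG.2 i k).1.aestronglyMeasurable.enorm
  have hF1 : ∫⁻ v, ENNReal.ofReal (density μ v) = 1 := by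
    rw [← ofReal_integral_eq_lintegral_ofReal (integrable_density _)
      (Eventually.of_forall fun v => density_nonneg _ v)]
    have := integral_mul_density hac fun _ => (1 : ℝ)
    simp only [one_mul] at this
    rw [this]
    simp
  have hpt : ∀ v, ∑ i, ∑ k, ‖G i k v‖ₑ ≤ ENNReal.ofReal (∑ i, ∑ k, G i k v ^ 2) /
      ENNReal.ofReal (density μ v) + (N * 3) * ENNReal.ofReal (density μ v) := by
    intro v
    calc _ ≤ ∑ i, ∑ k, (ENNReal.ofReal (G i k v ^ 2) / ENNReal.ofReal (density μ v) +
          ENNReal.ofReal (density μ v)) := Finset.sum_le_sum fun i _ => Finset.sum_le_sum fun k _ =>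
            enorm_le_sq_div_add _ (density_nonneg _ v)
      _ = _ := by
        rw [ENNReal.ofReal_sum_of_nonneg fun i _ => Finset.sum_nonneg fun k _ => sq_nonneg _]
        simp_rw [ENNReal.ofReal_sum_of_nonneg fun k (_ : k ∈ Finset.univ) => sq_nonneg _]
        simp_rw [Finset.sum_add_distrib, div_eq_mul_inv, Finset.sum_mul]
        simp [mul_assoc]
  by_contra! hcon
  have h1 : N * (B + 3) < ∑ i, ∑ k, ∫⁻ v, ‖G i k v‖ₑ := by
    have : (Finset.univ : Finset (Fin N)).Nonempty := ⟨⟨0, hN⟩, Finset.mem_univ _⟩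
    have := ENNReal.sum_lt_sum_of_nonempty this fun i _ => hcon i
    simpa [mul_add] using this
  refine absurd h1 (not_lt.2 ?_)
  calc ∑ i, ∑ k, ∫⁻ v, ‖G i k v‖ₑ = ∫⁻ v, ∑ i, ∑ k, ‖G i k v‖ₑ := by
        rw [lintegral_finsetSum' _ fun i _ => Finset.aemeasurable_fun_sum _ fun k _ => hm i k]
        exact Finset.sum_congr rfl fun i _ => (lintegral_finsetSum' _ fun k _ => hm i k).symm
    _ ≤ ∫⁻ v, (ENNReal.ofReal (∑ i, ∑ k, G i k v ^ 2) / ENNReal.ofReal (density μ v) +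
          (N * 3) * ENNReal.ofReal (density μ v)) := lintegral_mono hpt
    _ ≤ N * (B + 3) := by
        rw [lintegral_add_right _ ((measurable_density _).ennreal_ofReal.const_mul _),
          lintegral_const_mul _ (measurable_density _).ennreal_ofReal, hF1, mul_one, mul_add]
        gcongr

theorem integral_translate_le_of_fisherInfo_lt {N : ℕ} (hN : 1 ≤ N) {μ : Measure (Config N)}
    [IsProbabilityMeasure μ] {B : ℝ≥0∞} (hB : fisherInfo μ < B) (hB' : B ≠ ⊤) :
    ∃ i, ∀ (x : E3) (ζ : Config N → ℝ), Measurable ζ → (∀ v, |ζ v| ≤ 1) →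
      ∫ v, (ζ (v + Pi.single i x) - ζ v) ∂μ ≤ ‖x‖ * (B + 3).toReal := by
  obtain ⟨hac, G, hG, i, hi⟩ := exists_weakGradient_of_fisherInfo_lt hN hB
  have hB3 : B + 3 ≠ ⊤ := by simp [hB']
  have hfin : ∀ k, ∫⁻ v, ‖G i k v‖ₑ < ⊤ := fun k =>
    ((Finset.single_le_sum (f := fun k => ∫⁻ v, ‖G i k v‖ₑ) (fun _ _ => zero_le)
      (Finset.mem_univ k)).trans hi).trans_lt hB3.lt_top
  have hGi : ∀ k, Integrable (G i k) volume := fun k =>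
    ⟨(hG.2 i k).1.aestronglyMeasurable, hfin k⟩
  refine ⟨i, fun x ζ hζ hζ1 => ?_⟩
  have h := hG.integral_translate_le (integrable_density _) i hGi x hζ hζ1
  have e : ∫ v, density μ v * (ζ (v + Pi.single i x) - ζ v) =
      ∫ v, (ζ (v + Pi.single i x) - ζ v) ∂μ := by
    rw [← integral_mul_density hac]
    simp only [mul_comm]
  rw [e] at h
  refine h.trans (mul_le_mul_of_nonneg_left ?_ (norm_nonneg _))
  refine le_trans (le_of_eq ?_) (ENNReal.toReal_mono hB3 hi)
  rw [ENNReal.toReal_sum fun k _ => (hfin k).ne]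
  refine Finset.sum_congr rfl fun k _ => ?_
  exact integral_norm_eq_lintegral_enorm (hGi k).1

/-- The velocity with a small gradient is not known in advance. Exchangeability of the hierarchy
moves it to the first position. -/
theorem integral_hierarchy_translate_le (ν : ProbabilityMeasure (ProbabilityMeasure E3)) {n : ℕ}
    {B : ℝ≥0∞} (hB : fisherInfo (hierarchy ν (n + 1)) < B) (hB' : B ≠ ⊤) (x : E3)
    {ζ : Config (n + 1) → ℝ} (hζ : Measurable ζ) (hζ1 : ∀ v, |ζ v| ≤ 1) :
    ∫ v, (ζ (v + Pi.single 0 x) - ζ v) ∂hierarchy ν (n + 1) ≤ ‖x‖ * (B + 3).toReal := by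
  obtain ⟨i, hi⟩ := integral_translate_le_of_fisherInfo_lt (by omega) hB hB'
  have hτm : Measurable fun (v : Config (n + 1)) l => v (Equiv.swap 0 i l) := by fun_prop
  have h := hi x (fun v => ζ fun l => v (Equiv.swap 0 i l)) (hζ.comp hτm) fun v => hζ1 _
  refine le_trans (le_of_eq ?_) h
  have hq : Measurable fun v : Config (n + 1) => ζ (v + Pi.single 0 x) - ζ v :=
    (hζ.comp (by fun_prop)).sub hζ
  have hqb : ∀ v : Config (n + 1), |ζ (v + Pi.single 0 x) - ζ v| ≤ 2 := fun v =>
    (abs_sub _ _).trans (by linarith [hζ1 (v + Pi.single 0 x), hζ1 v])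
  have e : ∀ v : Config (n + 1), (fun l => (v + Pi.single i x : Config (n + 1))
      (Equiv.swap 0 i l)) = (fun l => v (Equiv.swap 0 i l)) + Pi.single 0 x := by
    intro v
    funext l
    have : (Pi.single i x : Config (n + 1)) (Equiv.swap 0 i l) =
        (Pi.single 0 x : Config (n + 1)) l := by
      simp only [Pi.single_apply, Equiv.swap_apply_eq_iff, Equiv.swap_apply_right]
    simp [this]
  simp only [e]
  have hq2 := hq.comp hτm
  refine (integral_hierarchy ν hq hqb).trans (Eq.trans ?_ (integral_hierarchy ν hq2 fun v =>
    hqb _).symm)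
  refine integral_congr_ae (Eventually.of_forall fun ρ => ?_)
  have hmp := iid_map_injective (ρ : Measure E3) (Equiv.swap (0 : Fin (n + 1)) i).injective
  dsimp only
  conv_lhs => rw [← hmp.map_eq]
  rw [integral_map hmp.measurable.aemeasurable hq.aestronglyMeasurable]
  rfl

end KacBoltzmann

end

noncomputable section

namespace KacBoltzmann

/-! ### Absolute continuity of almost every measure -/

/-- The difference between `g` and its average over the translations distributed as `m`. -/
def avgDiff (m : Measure E3) (g : E3 → ℝ) (y : E3) : ℝ := ∫ x, (g y - g (y + x)) ∂m

theorem measurable_avgDiff (m : Measure E3) [IsProbabilityMeasure m] {g : E3 → ℝ}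
    (hg : Measurable g) : Measurable (avgDiff m g) := by
  have h : StronglyMeasurable (Function.uncurry fun y x : E3 => g y - g (y + x)) :=
    ((hg.comp measurable_fst).sub
      (hg.comp (measurable_fst.add measurable_snd))).stronglyMeasurable
  exact h.integral_prod_right.measurable

theorem abs_avgDiff_le (m : Measure E3) [IsProbabilityMeasure m] {g : E3 → ℝ}
    (hg : ∀ y, |g y| ≤ 1) (y : E3) : |avgDiff m g y| ≤ 2 :=
  abs_integral_le_of_bounded fun x => (abs_sub _ _).trans (by linarith [hg y, hg (y + x)])

/-- Translating the first velocity does not affect the selector, which reads only the velocities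
from the third on. The selected difference is thus a translation difference of one bounded
measurable function, uniformly in the selector. -/
theorem integral_selFun_avgDiff_le (ν : ProbabilityMeasure (ProbabilityMeasure E3)) {n : ℕ}
    {B : ℝ≥0∞} (hB : fisherInfo (hierarchy ν (n + 2)) < B) (hB' : B ≠ ⊤)
    (m : Measure E3) [IsProbabilityMeasure m] {ε : ℝ} (hm : ∀ᵐ x ∂m, ‖x‖ ≤ ε)
    {g : ℕ → E3 → ℝ} (hg : ∀ i, Measurable (g i)) (hg1 : ∀ i y, |g i y| ≤ 1)
    {s : Config n → ℕ} (hs : Measurable s) :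
    ∫ v, selFun (fun i v => avgDiff m (g i) (v 0)) s v ∂hierarchy ν (n + 2) ≤
      ε * (B + 3).toReal := by
  set ζ : Config (n + 2) → ℝ := fun v => -g (s fun i => v i.succ.succ) (v 0) with hζ
  have hζm : Measurable ζ := (measurable_select hg (hs.comp (by fun_prop)) (by fun_prop)).neg
  have hζ1 : ∀ v, |ζ v| ≤ 1 := fun v => by simpa [hζ] using hg1 _ _
  have e : ∀ v, selFun (fun i v => avgDiff m (g i) (v 0)) s v =
      ∫ x, (ζ (v + Pi.single 0 x) - ζ v) ∂m := by
    intro v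
    have h0 : ∀ x, (fun i : Fin n => (v + Pi.single 0 x : Config (n + 2)) i.succ.succ) =
        fun i => v i.succ.succ := by
      intro x; funext i
      simp
    simp only [hζ, h0, selFun, avgDiff]
    simp only [Pi.add_apply, Pi.single_eq_same, sub_neg_eq_add, neg_add_eq_sub, Fin.castLE_zero]
  have hi : Integrable (Function.uncurry fun (v : Config (n + 2)) (x : E3) =>
      ζ (v + Pi.single 0 x) - ζ v) ((hierarchy ν (n + 2)).prod m) := by
    refine integrable_of_bounded (C := 2) ?_ fun p =>
      (abs_sub _ _).trans (by linarith [hζ1 (p.1 + Pi.single 0 p.2), hζ1 p.1])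
    refine (hζm.comp ?_).sub (hζm.comp measurable_fst)
    have hsm : Measurable fun x : E3 => (Pi.single 0 x : Config (n + 2)) :=
      (continuous_single 0).measurable
    exact measurable_fst.add (hsm.comp measurable_snd)
  simp only [e]
  rw [integral_integral_swap hi]
  calc _ ≤ ∫ _, ε * (B + 3).toReal ∂m := by
        refine integral_mono_ae hi.integral_prod_right (integrable_const _) ?_
        filter_upwards [hm] with x hx
        exact (integral_hierarchy_translate_le ν hB hB' x hζm hζ1).trans
          (mul_le_mul_of_nonneg_right hx ENNReal.toReal_nonneg)
    _ = _ := by simp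

/-- There are countably many open sets that separate the compact sets from the open sets. -/
theorem exists_seq_isOpen_separating : ∃ U : ℕ → Set E3, U 0 = ∅ ∧ (∀ i, IsOpen (U i)) ∧
    ∀ K V : Set E3, IsCompact K → IsOpen V → K ⊆ V → ∃ i, K ⊆ U i ∧ U i ⊆ V := by
  obtain ⟨e, he⟩ := exists_surjective_nat (Finset (TopologicalSpace.countableBasis E3))
  have hb := TopologicalSpace.isBasis_countableBasis E3
  refine ⟨fun i => Nat.casesOn i ∅ fun i => ⋃ b ∈ e i, (b : Set E3), rfl, ?_, ?_⟩
  · rintro (_ | i)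
    · exact isOpen_empty
    · exact isOpen_biUnion fun b _ => hb.isOpen b.2
  · intro K V hK hV hKV
    have hcov : K ⊆ ⋃ b : {b : TopologicalSpace.countableBasis E3 // (b : Set E3) ⊆ V},
        (b.1 : Set E3) := by
      intro x hx
      obtain ⟨b, hbB, hxb, hbV⟩ := hb.exists_subset_of_mem_open (hKV hx) hV
      exact Set.mem_iUnion.2 ⟨⟨⟨b, hbB⟩, hbV⟩, hxb⟩
    obtain ⟨t, ht⟩ := hK.elim_finite_subcover _ (fun b => hb.isOpen b.1.2) hcov
    obtain ⟨i, hi⟩ := he (t.map (Function.Embedding.subtype _))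
    refine ⟨i + 1, ?_, ?_⟩
    · intro x hx
      obtain ⟨b, hbt, hxb⟩ := Set.mem_iUnion₂.1 (ht hx)
      refine Set.mem_iUnion₂.2 ⟨b.1, ?_, hxb⟩
      rw [hi]
      exact Finset.mem_map_of_mem (Function.Embedding.subtype _) hbt
    · refine Set.iUnion₂_subset fun b hbt => ?_
      rw [hi, Finset.mem_map] at hbt
      obtain ⟨b', -, rfl⟩ := hbt
      exact b'.2

/-- The uniform distribution on a ball. -/
def unifBall (ε : ℝ) : Measure E3 := ProbabilityTheory.cond volume (Metric.ball 0 ε)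

theorem isProbabilityMeasure_unifBall {ε : ℝ} (hε : 0 < ε) : IsProbabilityMeasure (unifBall ε) :=
  ProbabilityTheory.cond_isProbabilityMeasure_of_finite
    (Metric.measure_ball_pos _ _ hε).ne' measure_ball_lt_top.ne

theorem ae_norm_le_unifBall (ε : ℝ) : ∀ᵐ x ∂unifBall ε, ‖x‖ ≤ ε := by
  filter_upwards [ProbabilityTheory.ae_cond_mem measurableSet_ball] with x hx
  exact (mem_ball_zero_iff.1 hx).le

/-- An open neighbourhood of a null compact set can be so small that averaging its indicator over a
ball gives at most δ everywhere, while the indicator is one on K. The difference therefore detects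
ρ(K). -/
theorem measure_le_iSup_avgDiff {ε : ℝ} (hε : 0 < ε) {U : ℕ → Set E3} (hU : ∀ i, IsOpen (U i))
    (hsep : ∀ K V : Set E3, IsCompact K → IsOpen V → K ⊆ V → ∃ i, K ⊆ U i ∧ U i ⊆ V)
    (ρ : Measure E3) [IsProbabilityMeasure ρ] {K : Set E3} (hK : IsCompact K)
    (hK0 : volume K = 0) :
    ρ K ≤ ⨆ i, ENNReal.ofReal
      (∫ v : Config 2, avgDiff (unifBall ε) ((U i).indicator 1) (v 0) ∂iid ρ 2) := by
  have := isProbabilityMeasure_unifBall hε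
  have hB0 : volume (Metric.ball (0 : E3) ε) ≠ 0 := (Metric.measure_ball_pos _ _ hε).ne'
  have hBt : volume (Metric.ball (0 : E3) ε) ≠ ⊤ := measure_ball_lt_top.ne
  refine ENNReal.le_of_forall_pos_le_add fun δ hδ _ => ?_
  have hδ' : (0 : ℝ≥0∞) < δ := by exact_mod_cast hδ
  obtain ⟨V, hKV, hVo, hV⟩ := K.exists_isOpen_lt_of_lt (μ := volume)
    (volume (Metric.ball (0 : E3) ε) * δ) (by
      rw [hK0]; exact ENNReal.mul_pos hB0 hδ'.ne')
  obtain ⟨i, hKi, hiV⟩ := hsep K V hK hVo hKV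
  have hUm := (hU i).measurableSet
  have hind : Measurable ((U i).indicator (1 : E3 → ℝ)) := measurable_one.indicator hUm
  have hind1 : ∀ y, |(U i).indicator (1 : E3 → ℝ) y| ≤ 1 := fun y => by
    by_cases hy : y ∈ U i <;> simp [hy]
  have hsmall : ∀ y, (unifBall ε).real ((fun x => y + x) ⁻¹' U i) ≤ δ := by
    intro y
    refine ENNReal.toReal_le_of_le_ofReal δ.2 ?_
    rw [ENNReal.ofReal_coe_nnreal]
    have h1 : volume ((fun x => y + x) ⁻¹' U i) ≤ volume (Metric.ball (0 : E3) ε) * δ := by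
      rw [measure_preimage_add]
      exact (measure_mono hiV).trans hV.le
    rw [unifBall, ProbabilityTheory.cond_apply measurableSet_ball]
    calc _ ≤ (volume (Metric.ball (0 : E3) ε))⁻¹ * (volume (Metric.ball (0 : E3) ε) * δ) := by
          gcongr
          exact (measure_mono Set.inter_subset_right).trans h1
      _ = δ := by rw [← mul_assoc, ENNReal.inv_mul_cancel hB0 hBt, one_mul]
  have hpt : ∀ y, K.indicator (1 : E3 → ℝ) y - δ ≤ avgDiff (unifBall ε) ((U i).indicator 1) y := by
    intro y
    have h1 : Integrable (fun x => (U i).indicator (1 : E3 → ℝ) (y + x)) (unifBall ε) :=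
      integrable_of_bounded (hind.comp (measurable_const_add y)) fun x => hind1 _
    have h2 : ∫ x, (U i).indicator (1 : E3 → ℝ) (y + x) ∂unifBall ε =
        (unifBall ε).real ((fun x => y + x) ⁻¹' U i) := by
      rw [← integral_indicator_one (measurable_const_add y hUm)]
      rfl
    rw [avgDiff, integral_sub (integrable_const _) h1, h2]
    simp only [integral_const, probReal_univ, one_smul]
    have h3 : K.indicator (1 : E3 → ℝ) y ≤ (U i).indicator 1 y :=
      Set.indicator_le_indicator_of_subset hKi (fun _ => zero_le_one) y
    linarith [hsmall y]
  have hmp : MeasurePreserving (Function.eval (0 : Fin 2)) (iid ρ 2) ρ :=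
    measurePreserving_eval (fun _ : Fin 2 => ρ) 0
  have hKm := hK.measurableSet
  have hav := measurable_avgDiff (unifBall ε) hind
  have hint : ρ.real K - δ ≤
      ∫ v : Config 2, avgDiff (unifBall ε) ((U i).indicator 1) (v 0) ∂iid ρ 2 := by
    have e1 : ∫ v : Config 2, avgDiff (unifBall ε) ((U i).indicator 1) (v 0) ∂iid ρ 2 =
        ∫ y, avgDiff (unifBall ε) ((U i).indicator 1) y ∂ρ := by
      conv_rhs => rw [← hmp.map_eq]
      rw [integral_map hmp.measurable.aemeasurable hav.aestronglyMeasurable]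
    have iK : Integrable (K.indicator (1 : E3 → ℝ)) ρ :=
      (integrable_const (1 : ℝ)).indicator hKm
    have h := integral_mono (μ := ρ) (by exact iK.sub (integrable_const (δ : ℝ)))
      (integrable_of_bounded hav (abs_avgDiff_le _ hind1)) hpt
    rw [integral_sub iK (integrable_const _), integral_indicator_one hKm] at h
    rw [e1]
    simpa using h
  calc ρ K = ENNReal.ofReal (ρ.real K) := (ofReal_measureReal).symm
    _ ≤ ENNReal.ofReal ((∫ v : Config 2, avgDiff (unifBall ε) ((U i).indicator 1) (v 0)
          ∂iid ρ 2) + δ) := ENNReal.ofReal_le_ofReal (by linarith)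
    _ ≤ _ := ENNReal.ofReal_add_le
    _ ≤ _ := by
        rw [ENNReal.ofReal_coe_nnreal]
        gcongr
        exact le_iSup (fun i => ENNReal.ofReal
          (∫ v : Config 2, avgDiff (unifBall ε) ((U i).indicator 1) (v 0) ∂iid ρ 2)) i

/-- If the Fisher informations of the hierarchy are bounded, then almost every measure has a
density. -/
theorem ae_absolutelyContinuous (ν : ProbabilityMeasure (ProbabilityMeasure E3))
    (hI : (⨆ (j : ℕ) (_ : 1 ≤ j), fisherInfo (hierarchy ν j)) < ⊤) :
    ∀ᵐ ρ : ProbabilityMeasure E3 ∂(ν : Measure (ProbabilityMeasure E3)),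
      (ρ : Measure E3) ≪ volume := by
  obtain ⟨B, hIB, hB⟩ := exists_between hI
  obtain ⟨U, hU0, hU, hsep⟩ := exists_seq_isOpen_separating
  have hind : ∀ i, Measurable ((U i).indicator (1 : E3 → ℝ)) := fun i =>
    measurable_one.indicator (hU i).measurableSet
  have hind1 : ∀ i y, |(U i).indicator (1 : E3 → ℝ) y| ≤ 1 := fun i y => by
    by_cases hy : y ∈ U i <;> simp [hy]
  set ε : ℕ → ℝ := fun n => 1 / (n + 1) with hεdef
  have hε : ∀ n, 0 < ε n := fun n => by positivity
  have := fun n => isProbabilityMeasure_unifBall (hε n)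
  set f : ℕ → ℕ → Config 2 → ℝ := fun n i v =>
    avgDiff (unifBall (ε n)) ((U i).indicator 1) (v 0) with hf
  have hfm : ∀ n i, Measurable (f n i) := fun n i =>
    (measurable_avgDiff _ (hind i)).comp (measurable_pi_apply 0)
  set S : ℕ → ProbabilityMeasure E3 → ℝ≥0∞ := fun n ρ =>
    ⨆ i, ENNReal.ofReal (∫ v, f n i v ∂iid (ρ : Measure E3) 2) with hS
  have hSm : ∀ n, Measurable (S n) := fun n =>
    Measurable.iSup fun i => (measurable_integral_iid (hfm n i)).ennreal_ofReal
  have hSle : ∀ n, ∫⁻ ρ, S n ρ ∂(ν : Measure (ProbabilityMeasure E3)) ≤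
      ENNReal.ofReal (ε n * (B + 3).toReal) := by
    intro n
    have := lintegral_iSup_le_liminf ν (hfm n)
      (fun i => ⟨2, fun v => abs_avgDiff_le _ (hind1 i) _⟩)
      (fun v => by simp [hf, hU0, avgDiff])
      (c := fun _ => ENNReal.ofReal (ε n * (B + 3).toReal)) fun k K s hs _ => by
        refine ENNReal.ofReal_le_ofReal (integral_selFun_avgDiff_le ν ?_ hB.ne _
          (ae_norm_le_unifBall _) hind hind1 hs)
        exact lt_of_le_of_lt (le_iSup₂ (f := fun (j : ℕ) (_ : 1 ≤ j) =>
          fisherInfo (hierarchy ν j)) (k + 2) (by omega)) hIB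
    simpa using this
  have hlim : Tendsto (fun n => ENNReal.ofReal (ε n * (B + 3).toReal)) atTop (𝓝 0) := by
    have := (tendsto_one_div_add_atTop_nhds_zero_nat (𝕜 := ℝ)).mul_const (B + 3).toReal
    rw [zero_mul] at this
    simpa [hεdef] using ENNReal.tendsto_ofReal this
  -- The integrals of these suprema tend to zero with the translation radius, so their infimum
  -- vanishes for almost every ρ.
  have hzero : ∫⁻ ρ, ⨅ n, S n ρ ∂(ν : Measure (ProbabilityMeasure E3)) = 0 := by
    refine le_antisymm (ge_of_tendsto' hlim fun n => ?_) zero_le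
    exact (lintegral_mono fun ρ => iInf_le _ n).trans (hSle n)
  rw [lintegral_eq_zero_iff (Measurable.iInf hSm)] at hzero
  filter_upwards [hzero] with ρ hρ
  refine Measure.AbsolutelyContinuous.mk fun A hA hA0 => ?_
  by_contra hne
  -- Inner regularity turns a null set charged by ρ into a null compact set charged by ρ, whose mass
  -- the vanishing infimum would bound.
  obtain ⟨K, hKA, hK, hKpos⟩ := hA.exists_lt_isCompact (μ := (ρ : Measure E3))
    (pos_iff_ne_zero.2 hne)
  have hK0 : volume K = 0 := measure_mono_null hKA hA0
  have : (ρ : Measure E3) K ≤ ⨅ n, S n ρ := le_iInf fun n =>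
    measure_le_iSup_avgDiff (hε n) hU hsep (ρ : Measure E3) hK hK0
  rw [hρ] at this
  exact absurd this (not_le.2 hKpos)

theorem iid_two_absolutelyContinuous {ρ : Measure E3} [IsProbabilityMeasure ρ]
    (h : ρ ≪ volume) : iid ρ 2 ≪ volume := by
  have h1 := measurePreserving_piFinTwo (fun _ : Fin 2 => ρ)
  have h2 := measurePreserving_piFinTwo (fun _ : Fin 2 => (volume : Measure E3))
  have h3 : ρ.prod ρ ≪ (volume : Measure E3).prod volume := h.prod h
  refine Measure.AbsolutelyContinuous.mk fun A hA hA0 => ?_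
  rw [← (h1.symm _).measure_preimage_equiv]
  refine h3 ?_
  rw [(h2.symm _).measure_preimage_equiv]
  exact hA0

end KacBoltzmann

end

noncomputable section

namespace KacBoltzmann

/-! ### Affinity in infinite dimension -/

section

variable {ω β : ℝ → ℝ}

/-- On a fixed sphere all velocities from the third on are constant, so the selector returns one
index and the function is a single test function there. -/
theorem isAdmissible_selFun {Ψ : ℕ → Config 2 → ℝ} (hΨ : ∀ i, IsAdmissible ω β 2 (Ψ i)) {n : ℕ}
    (s : Config n → ℕ) : IsAdmissible ω β (n + 2) (selFun Ψ s) := by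
  refine IsAdmissible.of_slices fun p => ⟨Ψ (s p.2.2), (p.1, p.2.1,
    fun i => p.2.2 (Fin.castLE (Nat.sub_le_sub_right (Nat.le_add_left 2 n) 2) i)), hΨ _, rfl,
    fun σ => ?_⟩
  have htail : (fun i : Fin n => zrsMap (n + 2) (p, σ) i.succ.succ) = p.2.2 := by
    funext i
    rw [zrsMap, zrsConfig_eq_cons, Fin.cons_succ, Fin.cons_succ]
  rw [selFun, htail, zrsMap_castLE _ le_rfl]

/-- Almost every ρ⊗ρ has a density, so its functional is at most a supremum over a countable test
family. The selection argument moves this supremum under the integral, and the selected functions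
are paired with the hierarchy at the cost of 17. -/
theorem lintegral_KK_iid_le (hω : Measurable ω) (hω0 : ∀ t, 0 ≤ t → 0 ≤ ω t)
    (hβ : LowerSemicontinuous β) (hβ0 : ∀ r, 0 ≤ β r)
    (ν : ProbabilityMeasure (ProbabilityMeasure E3))
    (hI : (⨆ (j : ℕ) (_ : 1 ≤ j), fisherInfo (hierarchy ν j)) < ⊤) :
    ∫⁻ ρ : ProbabilityMeasure E3, KK ω β (iid (ρ : Measure E3) 2)
      ∂(ν : Measure (ProbabilityMeasure E3)) ≤
      17 * liminf (fun j : ℕ => KK ω β (hierarchy ν j)) atTop := by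
  obtain ⟨Ψ, hΨ, hsup⟩ := exists_seq_isTest ω β 2
  -- The zero function is placed at index 0, as the selection lemma requires, and the test functions
  -- are shifted by one.
  set f : ℕ → Config 2 → ℝ := fun i => Nat.casesOn i (fun _ => 0) fun i => Ψ i with hf
  have hfm : ∀ i, Measurable (f i) := by
    rintro (_ | i)
    · exact measurable_const
    · exact (Ψ i).continuous.measurable
  have hfb : ∀ i, ∃ C, ∀ v, |f i v| ≤ C := by
    rintro (_ | i)
    · exact ⟨0, fun v => by simp [hf]⟩
    · exact (hΨ i).1
  have hfa : ∀ i, IsAdmissible ω β 2 (f i) := by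
    rintro (_ | i)
    · exact fun p _ g _ _ => by simp [hf]
    · exact (hΨ i).2
  choose C hC using hfb
  have hC0 : ∀ i, 0 ≤ C i := fun i => (abs_nonneg _).trans (hC i 0)
  rw [← ENNReal.liminf_const_mul_of_ne_top (by norm_num)]
  refine le_trans (lintegral_mono_ae ?_) (lintegral_iSup_le_liminf ν hfm (fun i => ⟨C i, hC i⟩)
    (fun _ => rfl) (c := fun j => 17 * KK ω β (hierarchy ν j)) fun n K s hs hsK => ?_)
  · filter_upwards [ae_absolutelyContinuous ν hI] with ρ hρ
    refine (KK_le_iSup le_rfl (iid_two_absolutelyContinuous hρ) hω hω0 hβ hβ0).trans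
      ((hsup _ inferInstance).trans (iSup_le fun i => ?_))
    exact le_iSup (fun i => ENNReal.ofReal (∫ v, f i v ∂iid (ρ : Measure E3) 2)) (i + 1)
  · refine ofReal_integral_le_KK (by omega) (measurable_selFun hfm hs)
      (C := ∑ i ∈ Finset.range (K + 1), C i) (fun v => (hC _ _).trans ?_)
      (isAdmissible_selFun hfa s)
    exact Finset.single_le_sum (fun i _ => hC0 i) (Finset.mem_range.2 (Nat.lt_succ_of_le (hsK _)))

end

end KacBoltzmann

end

/-! ### The three approximate properties of the functional -/

theorem mainTheorem6 (ω β : ℝ → ℝ) (hω : Measurable ω) (hω0 : ∀ t, 0 ≤ t → 0 ≤ ω t)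
    (hβ : LowerSemicontinuous β) (hβ0 : ∀ r, 0 ≤ β r) :
    -- approximate lower semicontinuity
    (∀ N : ℕ, 2 ≤ N →
      ∀ (F : ℕ → ProbabilityMeasure (KacBoltzmann.Config N))
        (Flim : ProbabilityMeasure (KacBoltzmann.Config N)),
        (∀ n, (F n : Measure (KacBoltzmann.Config N)) ≪ volume) →
        (Flim : Measure (KacBoltzmann.Config N)) ≪ volume →
        Tendsto F atTop (𝓝 Flim) →
        KacBoltzmann.KK ω β (Flim : Measure (KacBoltzmann.Config N)) ≤
          48 * liminf
            (fun n => KacBoltzmann.KK ω β (F n : Measure (KacBoltzmann.Config N))) atTop) ∧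
    -- approximate superadditivity
    (∀ (N j : ℕ) (hjN : j ≤ N), 2 ≤ j →
      ∀ F : Measure (KacBoltzmann.Config N), IsProbabilityMeasure F → F ≪ volume →
        KacBoltzmann.KK ω β (KacBoltzmann.marginal hjN F) ≤ 48 * KacBoltzmann.KK ω β F) ∧
    -- approximate affinity in infinite dimension
    (∀ ν : ProbabilityMeasure (ProbabilityMeasure KacBoltzmann.E3),
      (⨆ (j : ℕ) (_ : 1 ≤ j),
        KacBoltzmann.fisherInfo (KacBoltzmann.hierarchy ν j)) < ⊤ →
      ∫⁻ v, ENNReal.ofReal (‖v 0‖ ^ 2) ∂(KacBoltzmann.hierarchy ν 1) < ⊤ →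
      ∫⁻ ρ, KacBoltzmann.KK ω β
          (Measure.pi fun _ : Fin 2 => (ρ : Measure KacBoltzmann.E3))
          ∂(ν : Measure (ProbabilityMeasure KacBoltzmann.E3)) ≤
        768 * liminf
          (fun j : ℕ => KacBoltzmann.KK ω β (KacBoltzmann.hierarchy ν j)) atTop) := by
  -- Each property has been obtained with the constant 17, which is below both 48 and 768.
  refine ⟨fun N hN F Flim _ hlim hF => ?_, fun N j hjN hj F hF hac => ?_, fun ν hI _ => ?_⟩
  · refine (KacBoltzmann.KK_le_liminf hω hω0 hβ hβ0 hN hlim hF).trans ?_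
    gcongr
    norm_num
  · refine (KacBoltzmann.KK_marginal_le hω hω0 hβ hβ0 hjN hj hac).trans ?_
    gcongr
    norm_num
  · refine (KacBoltzmann.lintegral_KK_iid_le hω hω0 hβ hβ0 ν hI).trans ?_
    gcongr
    norm_num
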